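/- Let $Z$ be a spin anti-self-dual Einstein 4-orbifold with scalar curvature $s>0$, and let $\pi:X^7\to Z$ be the 3-Sasakian $SU(2)$-(orbi)bundle lifting the frame bundle of $\Lambda^2_+Z$, with the connection $\eta=\sum_i\eta_i\otimes T_i$ induced by the Levi-Civita connection of $Z$; here $[T_i,T_j]=2\varepsilon_{ijk}T_k$ is the standard basis of $\mathfrak{su}(2)$, and $F_\eta=-\frac{s}{24}\sum_i\omega_i\otimes T_i$, where $\omega_1,\omega_2,\omega_3$ is the standard orthogonal basis of $\Lambda^2_+\ker\eta$ with $|\omega_i|=\sqrt2$. Let $E=X\times_{SU(2)}\mathbb C^2$, with zero section $Z$, so that $E\setminus Z\cong(0,\infty)_r\times X$. On $E\setminus Z$ let $\Theta=dr\wedge\varphi+\psi$ with $$\varphi=t^3\eta_{123}-t\nu^2\tfrac{s}{48}\sum_i\eta_i\wedge\omega_i,\qquad \psi=\tfrac{\nu^4}{6}\bigl(\tfrac{s}{48}\bigr)^2\sum_i\omega_i\wedge\omega_i-\nu^2t^2\tfrac{s}{48}(\eta_{12}\wedge\omega_3+\eta_{23}\wedge\omega_1+\eta_{31}\wedge\omega_2),$$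 where $t,\nu>0$ are functions of $r\in(0,\infty)$ with $(\nu^2)'=6t$, $t'=1-2t^2/\nu^2$, $t\to0$ and $\nu\to\nu_0>0$ as $r\to0$. This is the torsion-free Spin(7)-structure of the complete asymptotically conical metric $g=dr^2+t^2\sum_i\eta_i^2+\frac{s\nu^2}{48}\pi^*g_Z$ on $E$. A Spin(7)-instanton is a connection with $*F_A=-F_A\wedge\Theta$. Consider the smooth Spin(7)-instantons of the radial form $A=x(r)\sum_i\eta_i\otimes T_i$ on the trivial $SU(2)$-bundle over $E\setminus Z$, and regard them as connections on the associated $\mathbb C^2$-bundle. This bundle is identified in the standard way over $E\setminus Z$ with $E\times\mathbb C^2$ and, through the tautological trivialization, with $\pi^*E$. Then: 1. If $A$ is not flat, then $A$ is asymptotic, as $r\to\infty$, to the connection $a_\infty=\frac35\sum_i\eta_i\otimes T_i$ on $X$ (the canonical $G_2$-instanton of the nearly parallel $X$). 2. Every such $A$ extends smoothly across $Z$, and exactly one of the following two cases holds. (a) $A$ extends to a smooth connection on $\pi^*E\to E$, and $A|_Z$ is the connection on $E\to Z$ induced by the Levi-Civita connection of $Z$. There is exactly one such instanton, $A_{\lim}$.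 (b) $A$ extends to a smooth connection on $E\times\mathbb C^2$, and $A|_Z$ is the flat product connection on $Z\times\mathbb C^2$. These instantons form a real 1-parameter family $\{A_{y_0}\}_{y_0\in[0,\infty)}$, in which each of them occurs for exactly one $y_0$, and $A_{y_0}=r^2y(r)\sum_i\eta_i\otimes T_i$ with $y$ real analytic on $[0,\infty)$ and $y(0)=y_0$. The connection $A_0$ is flat, and $A_{y_0}$ is irreducible for $y_0>0$. 3. For every $y_0<0$ there are $R\in(0,\infty)$ and an instanton $r^2y(r)\sum_i\eta_i\otimes T_i$ on $\{0<r<R\}$, with $y$ real analytic on $[0,R)$ and $y(0)=y_0$, which extends smoothly across $Z$ as in (b). Every instanton of this form, with the same $y_0$, on a set $\{0<r<R'\}$ has $R'\le R$ and is the restriction of this one; in particular none is defined on all of $E$. -/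

import Mathlib

open Set Filter Topology
open scoped Manifold ContDiff Quaternion

noncomputable section

namespace Spin7

/-! ### Multilinear algebra: forms as functions of vectors, wedge products by shuffles -/

section Algebra

variable {V F : Type*} [AddCommGroup F] [Module ℝ F] {n : ℕ}

/-- The wedge product of a 1-form with an `n`-form. -/
def wedge1 (α : V → ℝ) (β : (Fin n → V) → ℝ) : (Fin (n + 1) → V) → ℝ :=
  fun v => ∑ i : Fin (n + 1), (-1) ^ (i : ℕ) * (α (v i) * β (fun k => v (i.succAbove k)))

/-- The wedge product of an `F`-valued 2-form with a real `n`-form. The sum runs over ordered pairs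
of distinct positions, so that every shuffle is counted twice. -/
def wedge2 (α : V → V → F) (β : (Fin n → V) → ℝ) : (Fin (n + 2) → V) → F :=
  fun v => (2⁻¹ : ℝ) • ∑ i : Fin (n + 2), ∑ j : Fin (n + 1),
    ((-1) ^ ((i : ℕ) + (j : ℕ)) * β (fun k => v (i.succAbove (j.succAbove k)))) •
      α (v i) (v (i.succAbove j))

/-- A 1-form, as a function of one-element families of vectors. -/
def form1 (α : V → ℝ) : (Fin 1 → V) → ℝ := fun v => α (v 0)

/-- A 2-form, as a function of two-element families of vectors. -/
def form2 (α : V → V → ℝ) : (Fin 2 → V) → ℝ := fun v => α (v 0) (v 1)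

/-- The wedge product of two 1-forms, as a function of two vectors. -/
def wedge11 (α β : V → ℝ) (u v : V) : ℝ := α u * β v - α v * β u

/-- The form `dx^{abcd}` on `ℝ⁸`. -/
def dx (a b c d : Fin 8) (v : Fin 4 → Fin 8 → ℝ) : ℝ :=
  Matrix.det (Matrix.of fun k l : Fin 4 => v l (![a, b, c, d] k))

/-- The standard Cayley form on `ℝ⁸`. -/
def cayley0 (v : Fin 4 → Fin 8 → ℝ) : ℝ :=
  dx 0 1 2 3 v - dx 0 1 4 5 v - dx 0 1 6 7 v - dx 0 2 4 6 v - dx 0 2 7 5 v - dx 0 3 4 7 v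
    - dx 0 3 5 6 v + dx 4 5 6 7 v - dx 1 2 4 7 v - dx 1 2 5 6 v - dx 2 3 4 5 v - dx 2 3 6 7 v
    - dx 3 1 4 6 v - dx 3 1 7 5 v

end Algebra

/-- The basis `T₁, T₂, T₃` of `su(2) = Im ℍ`, with `[T_i, T_j] = 2 ε_{ijk} T_k`. Throughout, `SU(2)`
is the group of unit quaternions and its standard representation `ℂ²` is `ℍ`, on which it acts by
left multiplication. -/
def T : Fin 3 → ℍ[ℝ] := ![⟨0, 1, 0, 0⟩, ⟨0, 0, 1, 0⟩, ⟨0, 0, 0, 1⟩]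

/-- The direction `q / |q|` of a quaternion. -/
def dir (q : ℍ[ℝ]) : ℍ[ℝ] := ‖q‖⁻¹ • q

/-! ### Differential 1-forms on manifolds -/

section Forms

variable {E H M F : Type*} [NormedAddCommGroup E] [NormedSpace ℝ E] [TopologicalSpace H]
  (I : ModelWithCorners ℝ E H) [TopologicalSpace M] [ChartedSpace H M]
  [NormedAddCommGroup F] [NormedSpace ℝ F]

/-- An `F`-valued 1-form is smooth over a set `U` if it is smooth as a function on the tangent
bundle over `U`. -/
def SmoothFormOn [IsManifold I 1 M] (α : ∀ p : M, TangentSpace I p →L[ℝ] F) (U : Set M) : Prop :=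
  ContMDiffOn I.tangent 𝓘(ℝ, F) ∞ (fun w : TangentBundle I M => α w.1 w.2) {w | w.1 ∈ U}

/-- A 1-form in the preferred chart around `p`. -/
def chartForm (α : ∀ p : M, TangentSpace I p →L[ℝ] F) (p : M) (y : E) : E →L[ℝ] F :=
  (α ((extChartAt I p).symm y)).comp (mfderiv 𝓘(ℝ, E) I (extChartAt I p).symm y)

/-- The exterior derivative of a 1-form on a manifold without boundary, computed in the preferred
chart around the point, which is also the chart that identifies `TangentSpace I p` with `E`. -/
def extD (α : ∀ p : M, TangentSpace I p →L[ℝ] F) (p : M) (u v : TangentSpace I p) : F :=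
  fderiv ℝ (chartForm I α p) (extChartAt I p p) u v
    - fderiv ℝ (chartForm I α p) (extChartAt I p p) v u

/-- The curvature `F_A = dA + ½[A ∧ A]` of the connection `d + A` on the trivial `SU(2)`-bundle. -/
def curvature (A : ∀ p : M, TangentSpace I p →L[ℝ] ℍ[ℝ]) (p : M) (u v : TangentSpace I p) :
    ℍ[ℝ] :=
  extD I A p u v + (A p u * A p v - A p v * A p u)

/-- The connection `d + A` is flat over `U`. -/
def IsFlatOn (A : ∀ p : M, TangentSpace I p →L[ℝ] ℍ[ℝ]) (U : Set M) : Prop :=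
  ∀ p ∈ U, ∀ u v : TangentSpace I p, curvature I A p u v = 0

/-- The connection `d + A` is irreducible over `U`: the only parallel section of the adjoint bundle
is `0`; for connected `U` it is equivalent that no complex line subbundle of the associated
`ℂ²`-bundle is parallel. -/
def IsIrreducibleOn (A : ∀ p : M, TangentSpace I p →L[ℝ] ℍ[ℝ]) (U : Set M) : Prop :=
  ∀ ξ : M → ℍ[ℝ],
    (∀ p ∈ U, (ξ p).re = 0 ∧ MDifferentiableAt I 𝓘(ℝ, ℍ[ℝ]) ξ p ∧
      ∀ w : TangentSpace I p, mfderiv I 𝓘(ℝ, ℍ[ℝ]) ξ p w = ξ p * A p w - A p w * ξ p) →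
    ∀ p ∈ U, ξ p = 0

end Forms

/-! ### The geometry of `X` -/

/-- The model of 7-manifolds. -/
abbrev I7 : ModelWithCorners ℝ (EuclideanSpace ℝ (Fin 7)) (EuclideanSpace ℝ (Fin 7)) :=
  𝓘(ℝ, EuclideanSpace ℝ (Fin 7))

/-- The model of `ℝ × X`, which contains `(0, ∞) × X = E ∖ Z`. -/
abbrev I8 : ModelWithCorners ℝ (ℝ × EuclideanSpace ℝ (Fin 7))
    (ModelProd ℝ (EuclideanSpace ℝ (Fin 7))) :=
  𝓘(ℝ, ℝ).prod I7

/-- The model of `X × ℍ`, whose quotient by `SU(2)` is `E`. -/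
abbrev I11 : ModelWithCorners ℝ (EuclideanSpace ℝ (Fin 7) × ℍ[ℝ])
    (ModelProd (EuclideanSpace ℝ (Fin 7)) ℍ[ℝ]) :=
  I7.prod 𝓘(ℝ, ℍ[ℝ])

section Geometry

variable {X : Type*} [TopologicalSpace X] [ChartedSpace (EuclideanSpace ℝ (Fin 7)) X]

/-- The forms `ω_i` of three 1-forms `η_i`, defined by
`F_η = dη + ½[η ∧ η] = -(s/24) ∑ ω_i ⊗ T_i`, that is, by `dη_i + 2 η_j ∧ η_k = -(s/24) ω_i` for
cyclic `(i, j, k)`. -/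
def omegaOf (s : ℝ) (η : Fin 3 → ∀ p : X, TangentSpace I7 p →L[ℝ] ℝ) (i : Fin 3) (p : X)
    (u v : TangentSpace I7 p) : ℝ :=
  -(24 / s) * (extD I7 (η i) p u v + 2 * wedge11 (η (i + 1) p) (η (i + 2) p) u v)

end Geometry

/-- A 3-Sasakian 7-manifold `X`, seen as the principal `SU(2)`-(orbi)bundle over its leaf space `Z`,
an anti-self-dual Einstein 4-orbifold with scalar curvature `s > 0`: a smooth right action of `SU(2)`
and a principal connection `η = ∑ η_i ⊗ T_i` on `X` such that the 2-forms `ω_i` with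
`F_η = -(s/24) ∑ ω_i ⊗ T_i` are horizontal and form the standard orthogonal basis, of vectors of
length `√2`, of the self-dual 2-forms of a horizontal metric `h = π^* g_Z`.

The Bianchi identity `dω_i = 2 (ω_j ∧ η_k - ω_k ∧ η_j)` says that the connection `η` is torsion-free
on the bundle of self-dual 2-forms, so that `η` is induced by the Levi-Civita connection of `g_Z`. -/
structure ThreeSasakian (X : Type*) [TopologicalSpace X]
    [ChartedSpace (EuclideanSpace ℝ (Fin 7)) X] [IsManifold I7 ∞ X] where
  /-- The scalar curvature of `Z`. -/
  s : ℝ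
  s_pos : 0 < s
  /-- The right action of the unit quaternions; the values at other quaternions are irrelevant. -/
  act : X → ℍ[ℝ] → X
  act_one : ∀ p, act p 1 = p
  act_mul : ∀ p u v, ‖u‖ = 1 → ‖v‖ = 1 → act (act p u) v = act p (u * v)
  /-- The action is smooth, jointly in both variables. -/
  act_smooth : ContMDiffOn I11 I7 ∞ (fun z : X × ℍ[ℝ] => act z.1 (dir z.2)) {z | z.2 ≠ 0}
  /-- The components of the connection form. -/
  η : Fin 3 → ∀ p : X, TangentSpace I7 p →L[ℝ] ℝ
  η_smooth : ∀ i, SmoothFormOn I7 (η i) univ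
  /-- The connection form reproduces the generators of the action. -/
  η_fundamental : ∀ (p : X) (i j : Fin 3),
    η i p (mfderiv 𝓘(ℝ, ℝ) I7
      (fun τ : ℝ => act p ((Real.cos τ : ℍ[ℝ]) + Real.sin τ • T j)) 0 (1 : ℝ) :
        EuclideanSpace ℝ (Fin 7)) = if i = j then 1 else 0
  /-- The connection form is equivariant: `R_u^* η = Ad(u⁻¹) η`. -/
  η_equivariant : ∀ (u : ℍ[ℝ]), ‖u‖ = 1 → ∀ (p : X) (v : TangentSpace I7 p),
    ∑ i, η i (act p u) (mfderiv I7 I7 (fun p' => act p' u) p v) • T i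
      = star u * (∑ i, η i p v • T i) * u
  /-- The horizontal metric `π^* g_Z`. -/
  h : ∀ p : X, TangentSpace I7 p →L[ℝ] TangentSpace I7 p →L[ℝ] ℝ
  /-- At every point there is a horizontal `h`-orthonormal coframe `e₀, …, e₃` with
  `ω_i = e₀ ∧ e_i + e_j ∧ e_k`. -/
  adapted : ∀ p : X, ∃ e : Fin 4 → TangentSpace I7 p →L[ℝ] ℝ,
    (∀ v, (∀ i, η i p v = 0) → (∀ a, e a v = 0) → v = 0) ∧
    (∀ u v, h p u v = ∑ a, e a u * e a v) ∧
    ∀ (i : Fin 3) (u v : TangentSpace I7 p),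
      omegaOf s η i p u v
        = wedge11 (e 0) (e i.succ) u v + wedge11 (e (i + 1).succ) (e (i + 2).succ) u v

/-- The profile `(t, ν)` of the complete asymptotically conical Spin(7)-metric with size `ν₀` of the
zero section: the condition `dΘ = 0` for the form `Θ` below amounts to these two differential
equations, and the initial conditions at `r = 0` make the structure close up over `Z`. -/
structure IsProfile (ν₀ : ℝ) (t ν : ℝ → ℝ) : Prop where
  ν₀_pos : 0 < ν₀
  t_pos : ∀ r, 0 < r → 0 < t r
  ν_pos : ∀ r, 0 < r → 0 < ν r
  deriv_ν : ∀ r, 0 < r → HasDerivAt (fun r => ν r ^ 2) (6 * t r) r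
  deriv_t : ∀ r, 0 < r → HasDerivAt t (1 - 2 * t r ^ 2 / ν r ^ 2) r
  t_zero : Tendsto t (𝓝[>] 0) (𝓝 0)
  ν_zero : Tendsto ν (𝓝[>] 0) (𝓝 ν₀)

namespace ThreeSasakian

variable {X : Type*} [TopologicalSpace X] [ChartedSpace (EuclideanSpace ℝ (Fin 7)) X]
  [IsManifold I7 ∞ X] (S : ThreeSasakian X)

/-- The 2-forms `ω_i`. -/
def om (i : Fin 3) (p : X) (u v : TangentSpace I7 p) : ℝ := omegaOf S.s S.η i p u v

/-- The connection `η = ∑ η_i ⊗ T_i`, which on `E = X ×_{SU(2)} ℍ` is the connection induced by the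
Levi-Civita connection of `Z`. -/
def ηT (p : X) : TangentSpace I7 p →L[ℝ] ℍ[ℝ] := ∑ i, (S.η i p).smulRight (T i)

/-! #### The Spin(7)-structure on `(0, ∞) × X` -/

/-- The 3-form `φ = t³ η₁₂₃ - t ν² (s/48) ∑ η_i ∧ ω_i` on `X`. -/
def φ (t ν : ℝ) (p : X) : (Fin 3 → TangentSpace I7 p) → ℝ := fun v =>
  t ^ 3 * wedge1 (S.η 0 p) (wedge1 (S.η 1 p) (form1 (S.η 2 p))) v
    - t * ν ^ 2 * (S.s / 48) * ∑ i, wedge1 (S.η i p) (form2 (S.om i p)) v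

/-- The 4-form `ψ = (ν⁴/6) (s/48)² ∑ ω_i ∧ ω_i - ν² t² (s/48) ∑ η_j ∧ η_k ∧ ω_i` on `X`. -/
def ψ (t ν : ℝ) (p : X) : (Fin 4 → TangentSpace I7 p) → ℝ := fun v =>
  ν ^ 4 / 6 * (S.s / 48) ^ 2 * ∑ i, wedge2 (S.om i p) (form2 (S.om i p)) v
    - ν ^ 2 * t ^ 2 * (S.s / 48) *
      ∑ i, wedge1 (S.η (i + 1) p) (wedge1 (S.η (i + 2) p) (form2 (S.om i p))) v

/-- The 4-form `Θ = dr ∧ φ + ψ`. A tangent vector of `ℝ × X` is a pair `(ρ, v)`, and `dr (ρ, v) = ρ`.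
-/
def Θ (t ν : ℝ → ℝ) (z : ℝ × X) : (Fin 4 → TangentSpace I8 z) → ℝ := fun v =>
  wedge1 (fun w : ℝ × EuclideanSpace ℝ (Fin 7) => w.1)
      (fun w : Fin 3 → ℝ × EuclideanSpace ℝ (Fin 7) =>
        S.φ (t z.1) (ν z.1) z.2 (fun k => (w k).2)) v
    + S.ψ (t z.1) (ν z.1) z.2 (fun k => (v k).2)

/-- The metric `g = dr² + t² ∑ η_i² + (s ν²/48) π^* g_Z`. -/
def g (t ν : ℝ → ℝ) (z : ℝ × X) (u v : TangentSpace I8 z) : ℝ :=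
  u.1 * v.1 + t z.1 ^ 2 * ∑ i, S.η i z.2 u.2 * S.η i z.2 v.2
    + S.s * ν z.1 ^ 2 / 48 * S.h z.2 u.2 v.2

/-- A Spin(7)-frame: an orthonormal frame that identifies `Θ` with the standard Cayley form. -/
def IsSpin7Frame (t ν : ℝ → ℝ) (z : ℝ × X) (e : Fin 8 → TangentSpace I8 z) : Prop :=
  (∀ a b, S.g t ν z (e a) (e b) = if a = b then 1 else 0) ∧
  ∀ k : Fin 4 → Fin 8, S.Θ t ν z (fun j => e (k j)) = cayley0 (fun j => Pi.single (k j) 1)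

/-- The connection `d + A` on the trivial `SU(2)`-bundle over `J × X` is a Spin(7)-instanton:
`*F_A = -F_A ∧ Θ`. The Hodge star is computed in Spin(7)-frames `e`, which are oriented and
orthonormal, by `(*F)(e_{σ 2}, …, e_{σ 7}) = sign σ F(e_{σ 0}, e_{σ 1})`. -/
def IsInstantonOn (t ν : ℝ → ℝ) (A : ∀ z : ℝ × X, TangentSpace I8 z →L[ℝ] ℍ[ℝ]) (J : Set ℝ) :
    Prop :=
  ∀ z : ℝ × X, z.1 ∈ J → ∀ e : Fin 8 → TangentSpace I8 z, S.IsSpin7Frame t ν z e →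
    ∀ σ : Equiv.Perm (Fin 8),
      ((Equiv.Perm.sign σ : ℤ) : ℝ) • curvature I8 A z (e (σ 0)) (e (σ 1))
        = -wedge2 (curvature I8 A z) (S.Θ t ν z) (fun k : Fin 6 => e (σ (k.natAdd 2)))

/-! #### Radial connections -/

/-- The connection `x(r) ∑ η_i ⊗ T_i` on `ℝ × X`. -/
def radial (x : ℝ → ℝ) (z : ℝ × X) : TangentSpace I8 z →L[ℝ] ℍ[ℝ] :=
  x z.1 • (S.ηT z.2).comp
    (ContinuousLinearMap.snd ℝ (TangentSpace 𝓘(ℝ, ℝ) z.1) (TangentSpace I7 z.2))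

/-- `x(r) ∑ η_i ⊗ T_i` is a smooth Spin(7)-instanton on `J × X`. -/
def IsRadialInstanton (t ν : ℝ → ℝ) (J : Set ℝ) (x : ℝ → ℝ) : Prop :=
  ContDiffOn ℝ ∞ x J ∧ S.IsInstantonOn t ν (S.radial x) J

/-- The canonical connection `a_∞ = (3/5) ∑ η_i ⊗ T_i` on `X`. -/
def aInf (p : X) : TangentSpace I7 p →L[ℝ] ℍ[ℝ] := (3 / 5 : ℝ) • S.ηT p

/-- The connection `A` on `(0, ∞) × X` is asymptotic to the connection `a` on `X`: on the slices
`{r} × X`, with the fixed metric `(1/5) ∑ η_i² + π^* g_Z` on `X`, `A` converges uniformly to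
`a`, and its `dr`-component tends to `0` faster than `r⁻¹`. -/
def IsAsymptoticTo (A : ∀ z : ℝ × X, TangentSpace I8 z →L[ℝ] ℍ[ℝ])
    (a : ∀ p : X, TangentSpace I7 p →L[ℝ] ℍ[ℝ]) : Prop :=
  ∀ ε : ℝ, 0 < ε → ∃ R : ℝ, ∀ r, R < r → ∀ (p : X),
    (∀ v : TangentSpace I7 p, ‖A (r, p) ((0, v) : ℝ × EuclideanSpace ℝ (Fin 7)) - a p v‖
      ≤ ε * √(5⁻¹ * ∑ i, S.η i p v ^ 2 + S.h p v v)) ∧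
    r * ‖A (r, p) ((1, 0) : ℝ × EuclideanSpace ℝ (Fin 7))‖ ≤ ε

/-! #### Extension across the zero section

`E` is the quotient of `X × ℍ` by the action `(p, q) · u = (p u, u⁻¹ q)` of `SU(2)`, `Z` is the image
of `q = 0`, and `E ∖ Z` is identified with `(0, ∞) × X` by `[p, q] ↦ (|q|, p (q/|q|))`. Connections
on bundles over `E` are described by their pullbacks to `X × ℍ`; they are smooth if and only if these
are. -/

/-- The projection `X × (ℍ ∖ 0) → E ∖ Z = (0, ∞) × X`. -/
def polar (z : X × ℍ[ℝ]) : ℝ × X := (‖z.2‖, S.act z.1 (dir z.2))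

/-- The pullback to `X × (ℍ ∖ 0)` of a connection on the trivial bundle over `E ∖ Z`, in the trivial
bundle. -/
def trivialGauge (A : ∀ z : ℝ × X, TangentSpace I8 z →L[ℝ] ℍ[ℝ]) (z : X × ℍ[ℝ])
    (w : TangentSpace I11 z) : ℍ[ℝ] :=
  A (S.polar z) (mfderiv I11 I8 S.polar z w)

/-- The pullback to `X × (ℍ ∖ 0)` of the same connection, written in the bundle
`π^*E = (X × ℍ × ℍ) / SU(2)`, `(p, q, ζ) · u = (p u, u⁻¹ q, u⁻¹ ζ)`. Over `E ∖ Z` this bundle is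
trivialized by `[p, q, ζ] ↦ u⁻¹ ζ`, where `u = q/|q|`, so that `A` becomes
`u A u⁻¹ - du u⁻¹`. -/
def pullbackGauge (A : ∀ z : ℝ × X, TangentSpace I8 z →L[ℝ] ℍ[ℝ]) (z : X × ℍ[ℝ])
    (w : TangentSpace I11 z) : ℍ[ℝ] :=
  dir z.2 * S.trivialGauge A z w * (dir z.2)⁻¹ - fderiv ℝ dir z.2 w.2 * (dir z.2)⁻¹

/-- `A`, defined for `r ∈ J`, extends smoothly across `Z` as a connection on the trivial bundle
`E × ℂ²`, and `A|_Z` is the flat product connection on `Z × ℂ²`. -/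
def ExtendsFlat (A : ∀ z : ℝ × X, TangentSpace I8 z →L[ℝ] ℍ[ℝ]) (J : Set ℝ) : Prop :=
  ∃ B : ∀ z : X × ℍ[ℝ], TangentSpace I11 z →L[ℝ] ℍ[ℝ],
    SmoothFormOn I11 B {z | z.2 = 0 ∨ ‖z.2‖ ∈ J} ∧
    (∀ z : X × ℍ[ℝ], z.2 ≠ 0 → ‖z.2‖ ∈ J → ∀ w, B z w = S.trivialGauge A z w) ∧
    ∀ (p : X) (v : TangentSpace I7 p),
      B (p, 0) ((v, 0) : EuclideanSpace ℝ (Fin 7) × ℍ[ℝ]) = 0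

/-- `A`, defined for `r ∈ J`, extends smoothly across `Z` as a connection on the bundle `π^*E`, and
`A|_Z` is the connection on `E → Z` induced by the Levi-Civita connection of `Z`. -/
def ExtendsLeviCivita (A : ∀ z : ℝ × X, TangentSpace I8 z →L[ℝ] ℍ[ℝ]) (J : Set ℝ) : Prop :=
  ∃ B : ∀ z : X × ℍ[ℝ], TangentSpace I11 z →L[ℝ] ℍ[ℝ],
    SmoothFormOn I11 B {z | z.2 = 0 ∨ ‖z.2‖ ∈ J} ∧
    (∀ z : X × ℍ[ℝ], z.2 ≠ 0 → ‖z.2‖ ∈ J → ∀ w, B z w = S.pullbackGauge A z w) ∧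
    ∀ (p : X) (v : TangentSpace I7 p),
      B (p, 0) ((v, 0) : EuclideanSpace ℝ (Fin 7) × ℍ[ℝ]) = S.ηT p v

end ThreeSasakian

/-- `x(r) = r² y(r)` for `r ∈ J`, where `y` is real analytic up to `r = 0` and `y(0) = y₀`. -/
def HasParameter (J : Set ℝ) (x : ℝ → ℝ) (y₀ : ℝ) : Prop :=
  ∃ y : ℝ → ℝ, AnalyticOnNhd ℝ y (insert 0 J) ∧ y 0 = y₀ ∧ ∀ r ∈ J, x r = r ^ 2 * y r

end Spin7

end

/-! # Radial Spin(7)-instantons on the spinor bundle of an anti-self-dual Einstein orbifold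

**The equation.** At a point of `(0, ∞) × X` the forms `dr, t η₁, t η₂, t η₃, c e₀, …, c e₃`, with
`c² = s ν² / 48` and an adapted horizontal coframe `e`, are linear coordinates in which the metric
is standard and `Θ` is the Cayley form (`ThreeSasakian.Θ_eq_cayley`). Since the Cayley form is
self-dual, `*F = -F ∧ Θ` is in each Spin(7)-frame the linear equation `F_ab = -½ Θ_abcd F_cd`
(`star_eq_neg_wedge_iff`), and it suffices to know this equation in one orthonormal frame
(`eq_contraction_of_orthonormal`). The `T_i`-component of the curvature of `x(r) ∑ η_i ⊗ T_i` is
`α dx⁰ⁱ + β dxʲᵏ + γ Ω_i` in the adapted coordinates, with `α = x'/t`, `β = 2 (x² - x)/t²` and `γ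
= -2x/ν²`, and the linear equation for such a form is `α + β = 2γ`. Thus `x` gives an instanton if
and only if

`x' = 2 x (1 - x) / t - 4 x t / ν²` (`ThreeSasakian.isRadialInstanton_iff`).

**Its solutions.** This Riccati equation is solved by quadratures: `z = x / t²` satisfies `z' = -2
t z²`, and `2 t = (ν²)' / 3`, so that `x = 0` or `x = 3 t² / (ν² + c)` with a constant `c`
(`IsProfile.radialODE_cases`). As `ν²` increases from `ν₀²` to `∞`, the solutions on `(0, ∞)` are
those with `c ≥ -ν₀²`: the value `c = -ν₀²` gives `limitSol`, and the others, with `y₀ = 3 / (ν₀²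
+ c)`, give together with `x = 0` the `family` with parameter `y₀ ≥ 0`. For `y₀ < 0` the same
formula defines a solution up to the radius `R` at which the denominator vanishes. Because `t² /
ν² → 1/5`, all solutions other than `0` converge to `3/5`.

**Behaviour at the zero section.** With `v = (ν²)^(1/3)` the quantity `5 t² v² - v⁵` is conserved,
and the profile equations become a single autonomous equation for `√(v - v₀)` with analytic
right-hand side. Hence `ν²` and `t²` are analytic functions of `r²` near `r = 0`
(`IsProfile.exists_analyticAt_zero`), and so are `x / r²` for the family and `(x - 1) / r²` for
`limitSol`. On `X × ℍ` the connection is, in the trivial gauge and in the gauge of `π^*E`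
respectively,

`(x(|q|) / |q|²) (q̄ η q + Im (q̄ dq))` and `x(|q|) η + ((x(|q|) - 1) / |q|²) Im (dq q̄)`,

by the equivariance of `η` and because `η` reproduces the generators of the action. So the family
extends in the first gauge and `limitSol` in the second. Conversely, an extension in the first
gauge forces `x → 0` and an extension in the second forces `x → 1`, as one sees by inserting the
vector fields `q T₁` and `T₁ q` of `ℍ`; hence the two cases exclude each other.

**Irreducibility.** A parallel section of the adjoint bundle does not depend on `r`. Along the
orbit of the one-parameter subgroup generated by `T_j` it has to return to its initial value, so
it commutes with `cos (2π x) + sin (2π x) T_j`; at a radius with `0 < x < 1/2` it therefore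
commutes with all `T_j`, and vanishes.
-/

noncomputable section

namespace Spin7

/-! ### Autonomous equations with analytic right-hand side -/

/-- The singular linear equation `K + c x K' = f` with analytic `f` and `c ≥ 0` has an analytic
solution: divide the `n`-th Taylor coefficient of `f` by `1 + c n`. -/
theorem exists_analyticAt_add_mul_deriv {f : ℝ → ℝ} (hf : AnalyticAt ℝ f 0) {c : ℝ} (hc : 0 ≤ c) :
    ∃ K : ℝ → ℝ, AnalyticAt ℝ K 0 ∧ ∀ᶠ x in 𝓝 0, K x + c * x * deriv K x = f x := by
  obtain ⟨p, r, hp⟩ := hf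
  have hpos : ∀ n : ℕ, 0 < 1 + c * (n : ℝ) := fun n => by positivity
  set q : FormalMultilinearSeries ℝ ℝ ℝ :=
    FormalMultilinearSeries.ofScalars ℝ (fun n => p.coeff n / (1 + c * n)) with hq
  have hcoef : ∀ n, q.coeff n = p.coeff n / (1 + c * n) := fun n => by
    simp [hq, FormalMultilinearSeries.coeff_ofScalars]
  have hrad : p.radius ≤ q.radius := by
    apply FormalMultilinearSeries.radius_le_of_le
    intro n
    rw [FormalMultilinearSeries.norm_apply_eq_norm_coef,
      FormalMultilinearSeries.norm_apply_eq_norm_coef, hcoef, norm_div]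
    refine div_le_self (norm_nonneg _) ?_
    rw [Real.norm_eq_abs, abs_of_pos (hpos n)]
    have : 0 ≤ c * (n : ℝ) := by positivity
    linarith
  have hqpos : 0 < q.radius := lt_of_lt_of_le (lt_of_lt_of_le hp.r_pos hp.r_le) hrad
  have hK := q.hasFPowerSeriesOnBall hqpos
  refine ⟨q.sum, hK.analyticAt, ?_⟩
  have h1 := hasFPowerSeriesAt_iff.1 hK.hasFPowerSeriesAt
  have h2 := hasFPowerSeriesAt_iff.1 hK.fderiv.hasFPowerSeriesAt
  have h3 := hasFPowerSeriesAt_iff.1 hp.hasFPowerSeriesAt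
  filter_upwards [h1, h2, h3] with x h1 h2 h3
  rw [zero_add] at h1 h2 h3
  have h4 : HasSum (fun n => x ^ n • ((n + 1) • q.coeff (n + 1))) (deriv q.sum x) := by
    have := h2.mapL (ContinuousLinearMap.apply ℝ ℝ (1 : ℝ))
    simpa [FormalMultilinearSeries.derivSeries_coeff_one] using this
  have h5 : HasSum (fun n : ℕ => x ^ n * (n * q.coeff n)) (x * deriv q.sum x) := by
    rw [← hasSum_nat_add_iff' 1]
    simp only [Finset.range_one, Finset.sum_singleton, Nat.cast_zero, zero_mul, mul_zero, sub_zero]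
    have h := h4.mul_left x
    simp only [smul_eq_mul, nsmul_eq_mul] at h
    have e : (fun n : ℕ => x ^ (n + 1) * (((n + 1 : ℕ) : ℝ) * q.coeff (n + 1)))
        = fun n : ℕ => x * (x ^ n * (((n + 1 : ℕ) : ℝ) * q.coeff (n + 1))) := by
      funext n
      ring
    rw [e]
    exact h
  have h6 := h1.add (h5.mul_left c)
  have h7 : (fun n => x ^ n • q.coeff n + c * (x ^ n * (n * q.coeff n)))
      = fun n => x ^ n • p.coeff n := by
    funext n
    have := (hpos n).ne'
    rw [hcoef, smul_eq_mul, smul_eq_mul]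
    field_simp
  rw [h7] at h6
  rw [mul_assoc]
  exact h6.unique h3

/-- An analytic function with nonzero derivative has an analytic local left inverse. -/
theorem exists_analyticAt_leftInverse {m : ℝ → ℝ} {a m' : ℝ} (hm : AnalyticAt ℝ m a)
    (hm' : HasDerivAt m m' a) (h0 : m' ≠ 0) :
    ∃ n : ℝ → ℝ, AnalyticAt ℝ n (m a) ∧ HasDerivAt n m'⁻¹ (m a) ∧ ∀ᶠ x in 𝓝 a, n (m x) = x := by
  have h1 : deriv m a ≠ 0 := by rwa [hm'.deriv]
  refine ⟨_, hm.analyticAt_localInverse h1, ?_,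
    HasStrictDerivAt.eventually_left_inverse hm.hasStrictDerivAt h1⟩
  have := (HasStrictDerivAt.to_localInverse hm.hasStrictDerivAt h1).hasDerivAt
  exact this.congr_deriv (by rw [hm'.deriv])

/-- Analytic functions have analytic primitives, by `exists_analyticAt_add_mul_deriv` with `c =
1`. -/
theorem exists_analyticAt_primitive {f : ℝ → ℝ} {a : ℝ} (hf : AnalyticAt ℝ f a) :
    ∃ P : ℝ → ℝ, AnalyticAt ℝ P a ∧ ∀ᶠ x in 𝓝 a, HasDerivAt P (f x) x := by
  have h1 : AnalyticAt ℝ (fun x => f (x + a)) 0 := by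
    refine AnalyticAt.fun_comp (f := fun x => x + a) (by simpa using hf) (by fun_prop)
  -- the primitive is `x K(x)`, because `(x K)' = K + x K'`
  obtain ⟨K, hK, hKe⟩ := exists_analyticAt_add_mul_deriv h1 zero_le_one
  have hs : Tendsto (fun x : ℝ => x - a) (𝓝 a) (𝓝 0) := by
    have : Continuous (fun x : ℝ => x - a) := by fun_prop
    simpa using this.tendsto a
  refine ⟨fun x => (x - a) * K (x - a), ?_, ?_⟩
  · refine AnalyticAt.mul (by fun_prop) ?_
    exact AnalyticAt.fun_comp (f := fun x => x - a) (by simpa using hK) (by fun_prop)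
  · filter_upwards [hs.eventually hKe, hs.eventually hK.eventually_analyticAt] with x hx hKx
    have hd := hKx.differentiableAt.hasDerivAt
    have h2 : HasDerivAt (fun x : ℝ => x - a) 1 x := (hasDerivAt_id x).sub_const a
    have h3 := h2.mul (HasDerivAt.comp x hd h2)
    refine h3.congr_deriv ?_
    have : f x = f (x - a + a) := by ring_nf
    rw [this, ← hx]
    simp only [Function.comp]
    ring

/-- Solutions of `y' = 1 / f(y)` with analytic `f` are analytic. -/
theorem analyticAt_of_hasDerivAt_inv {f y : ℝ → ℝ} {r₁ : ℝ} (hf : AnalyticAt ℝ f (y r₁))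
    (hf0 : f (y r₁) ≠ 0) (hy : ∀ᶠ r in 𝓝 r₁, HasDerivAt y (f (y r))⁻¹ r) :
    AnalyticAt ℝ y r₁ := by
  obtain ⟨P, hP, hPd⟩ := exists_analyticAt_primitive hf
  obtain ⟨n, hn, -, hni⟩ := exists_analyticAt_leftInverse hP hPd.self_of_nhds hf0
  have hyc : ContinuousAt y r₁ := hy.self_of_nhds.continuousAt
  have hfc : ∀ᶠ r in 𝓝 r₁, f (y r) ≠ 0 :=
    (hf.continuousAt.comp hyc).eventually_ne hf0
  have h1 : ∀ᶠ r in 𝓝 r₁, HasDerivAt (fun r => P (y r) - r) 0 r := by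
    filter_upwards [hy, hyc.eventually hPd, hfc] with r h1 h2 h3
    refine ((HasDerivAt.comp r h2 h1).sub (hasDerivAt_id r)).congr_deriv ?_
    simp [h3]
  obtain ⟨ε, hε, hb⟩ := Metric.eventually_nhds_iff_ball.1 h1
  have h2 : ∀ r ∈ Metric.ball r₁ ε, P (y r) = P (y r₁) + (r - r₁) := by
    intro r hr
    have := (Metric.isOpen_ball).is_const_of_deriv_eq_zero (convex_ball r₁ ε).isPreconnected
      (fun x hx => (hb x hx).differentiableAt.differentiableWithinAt)
      (fun x hx => (hb x hx).deriv) hr (Metric.mem_ball_self hε)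
    linarith
  have h3 : AnalyticAt ℝ (fun r => n (P (y r₁) + (r - r₁))) r₁ :=
    AnalyticAt.fun_comp (f := fun r => P (y r₁) + (r - r₁)) (by simpa using hn) (by fun_prop)
  refine h3.congr ?_
  filter_upwards [Metric.ball_mem_nhds r₁ hε, hyc.eventually hni] with r h4 h5
  rw [← h2 r h4, h5]

/-- If `σ > 0` solves `σ' = 1 / f(σ²)` with analytic `f` and starts at `0`, then `σ²` is an analytic
function of `r²`. -/
theorem exists_analyticAt_sq_eq {f σ : ℝ → ℝ} (hf : AnalyticAt ℝ f 0) (hf0 : f 0 ≠ 0)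
    (hσ : ∀ r, 0 < r → HasDerivAt σ (f (σ r ^ 2))⁻¹ r) (hf1 : ∀ r, 0 < r → f (σ r ^ 2) ≠ 0)
    (hσ0 : Tendsto σ (𝓝[>] 0) (𝓝 0)) :
    ∃ n : ℝ → ℝ, AnalyticAt ℝ n 0 ∧ HasDerivAt n (f 0 ^ 2)⁻¹ 0 ∧ n 0 = 0 ∧
      ∀ᶠ r in 𝓝[>] 0, σ r ^ 2 = n (r ^ 2) := by
  -- with `K + 2 τ K' = f` the function `σ K(σ²)` is a primitive of `f(σ²)`
  obtain ⟨K, hK, hKe⟩ := exists_analyticAt_add_mul_deriv hf (zero_le_two (α := ℝ))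
  have hK0 : K 0 = f 0 := by simpa using hKe.self_of_nhds
  have hm : AnalyticAt ℝ (fun x => x * K x ^ 2) 0 := by fun_prop
  have hm' : HasDerivAt (fun x => x * K x ^ 2) (f 0 ^ 2) 0 := by
    refine ((hasDerivAt_id (0 : ℝ)).mul (hK.differentiableAt.hasDerivAt.pow 2)).congr_deriv ?_
    simp [hK0]
  obtain ⟨n, hn, hnd, hni⟩ := exists_analyticAt_leftInverse hm hm' (pow_ne_zero 2 hf0)
  simp only [zero_mul] at hn hnd
  have hσ2 : Tendsto (fun r => σ r ^ 2) (𝓝[>] 0) (𝓝 0) := by simpa using hσ0.pow 2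
  -- the conserved quantity `σ K(σ²) - r`
  have h1 : ∀ᶠ r in 𝓝[>] 0, HasDerivAt (fun r => σ r * K (σ r ^ 2) - r) 0 r := by
    filter_upwards [hσ2.eventually hKe, hσ2.eventually hK.eventually_analyticAt,
      self_mem_nhdsWithin] with r h1 h2 h3
    have h4 := hσ r h3
    have h5 := h4.mul (HasDerivAt.comp r h2.differentiableAt.hasDerivAt (h4.pow 2))
    refine (h5.sub (hasDerivAt_id r)).congr_deriv ?_
    have h6 := hf1 r h3
    have h7 : (f (σ r ^ 2))⁻¹ * (K (σ r ^ 2) + 2 * σ r ^ 2 * deriv K (σ r ^ 2)) = 1 := by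
      rw [h1, inv_mul_cancel₀ h6]
    simp only [Function.comp]
    push_cast
    linear_combination h7
  obtain ⟨ε, hε, hb⟩ := (mem_nhdsGT_iff_exists_Ioo_subset' (zero_lt_one (α := ℝ))).1 h1
  have hlim : Tendsto (fun r => σ r * K (σ r ^ 2) - r) (𝓝[>] 0) (𝓝 0) := by
    have h2 : Tendsto (fun r => K (σ r ^ 2)) (𝓝[>] 0) (𝓝 (K 0)) :=
      hK.continuousAt.tendsto.comp hσ2
    have h3 : Tendsto (fun r : ℝ => r) (𝓝[>] 0) (𝓝 0) :=
      tendsto_nhdsWithin_of_tendsto_nhds tendsto_id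
    simpa using (hσ0.mul h2).sub h3
  have hconst : ∀ r ∈ Ioo 0 ε, σ r * K (σ r ^ 2) = r := by
    intro r hr
    have h3 : ∀ᶠ r' in 𝓝[>] 0, σ r' * K (σ r' ^ 2) - r' = σ r * K (σ r ^ 2) - r := by
      filter_upwards [Ioo_mem_nhdsGT hε] with r' hr'
      exact isOpen_Ioo.is_const_of_deriv_eq_zero isPreconnected_Ioo
        (fun x hx => (hb hx : HasDerivAt _ _ _).differentiableAt.differentiableWithinAt)
        (fun x hx => (hb hx : HasDerivAt _ _ _).deriv) hr' hr
    have h4 := tendsto_nhds_unique (tendsto_const_nhds.congr' (h3.mono fun _ h => h.symm)) hlim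
    linarith
  refine ⟨n, hn, hnd, by simpa using hni.self_of_nhds, ?_⟩
  filter_upwards [Ioo_mem_nhdsGT hε, hσ2.eventually hni] with r h2 h3
  rw [← h3]
  congr 1
  nth_rewrite 3 [← hconst r h2]
  ring

/-! ### The profile of the metric -/

/-- The cube root `v` of `ν²`. In terms of `v` the profile equations become algebraic:
`v' = 2 t / v²`, and `5 t² v² - v⁵` is conserved. -/
def cbrtSq (ν : ℝ → ℝ) (r : ℝ) : ℝ := (ν r ^ 2) ^ (3⁻¹ : ℝ)

/-- The polynomial `(v⁵ - v₀⁵) / (v - v₀)`. -/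
def quot5 (v₀ v : ℝ) : ℝ := v ^ 4 + v ^ 3 * v₀ + v ^ 2 * v₀ ^ 2 + v * v₀ ^ 3 + v₀ ^ 4

theorem sub_mul_quot5 (v₀ v : ℝ) : (v - v₀) * quot5 v₀ v = v ^ 5 - v₀ ^ 5 := by
  simp only [quot5]; ring

theorem quot5_pos {v₀ v : ℝ} (h₀ : 0 < v₀) (h : 0 < v) : 0 < quot5 v₀ v := by
  simp only [quot5]; positivity

/-- The function `√5 v³ / √((v⁵ - v₀⁵) / (v - v₀))` of `τ = v - v₀`, whose inverse is the derivative
of `√τ`. -/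
def profileSpeed (v₀ τ : ℝ) : ℝ := √5 * (v₀ + τ) ^ 3 / √(quot5 v₀ (v₀ + τ))

theorem profileSpeed_pos {v₀ τ : ℝ} (h₀ : 0 < v₀) (h : 0 < v₀ + τ) : 0 < profileSpeed v₀ τ := by
  have := quot5_pos h₀ h
  simp only [profileSpeed]; positivity

theorem analyticAt_sqrt {x : ℝ} (hx : x ≠ 0) : AnalyticAt ℝ Real.sqrt x :=
  (Real.contDiffAt_sqrt hx).analyticAt

theorem analyticAt_profileSpeed {v₀ τ : ℝ} (h₀ : 0 < v₀) (h : 0 < v₀ + τ) :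
    AnalyticAt ℝ (profileSpeed v₀) τ := by
  have hQ := quot5_pos h₀ h
  unfold profileSpeed
  refine AnalyticAt.div (by fun_prop) ?_ (Real.sqrt_pos.2 hQ).ne'
  refine AnalyticAt.fun_comp (f := fun τ => quot5 v₀ (v₀ + τ)) (analyticAt_sqrt hQ.ne') ?_
  unfold quot5
  fun_prop

theorem profileSpeed_zero {v₀ : ℝ} (h₀ : 0 < v₀) : profileSpeed v₀ 0 = v₀ := by
  have h1 : quot5 v₀ (v₀ + 0) = 5 * (v₀ ^ 2) ^ 2 := by simp only [quot5]; ring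
  rw [profileSpeed, h1, Real.sqrt_mul (by norm_num), Real.sqrt_sq (by positivity)]
  have : √(5 : ℝ) ≠ 0 := by positivity
  field_simp
  ring

namespace IsProfile

variable {ν₀ : ℝ} {t ν : ℝ → ℝ}

theorem sq_pos (hp : IsProfile ν₀ t ν) {r : ℝ} (hr : 0 < r) :
    0 < ν r ^ 2 :=
  pow_pos (hp.ν_pos r hr) 2

theorem tendsto_sq (hp : IsProfile ν₀ t ν) :
    Tendsto (fun r => ν r ^ 2) (𝓝[>] 0) (𝓝 (ν₀ ^ 2)) :=
  hp.ν_zero.pow 2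

theorem sq₀_pos (hp : IsProfile ν₀ t ν) : 0 < ν₀ ^ 2 := pow_pos hp.ν₀_pos 2

theorem strictMonoOn_sq (hp : IsProfile ν₀ t ν) : StrictMonoOn (fun r => ν r ^ 2) (Ioi 0) := by
  refine strictMonoOn_of_deriv_pos (convex_Ioi 0)
    (fun r hr => (hp.deriv_ν r hr).continuousAt.continuousWithinAt) ?_
  intro r hr
  rw [interior_Ioi] at hr
  rw [(hp.deriv_ν r hr).deriv]
  have := hp.t_pos r hr
  positivity

theorem sq₀_lt (hp : IsProfile ν₀ t ν) {r : ℝ} (hr : 0 < r) : ν₀ ^ 2 < ν r ^ 2 := by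
  have h2 : (0 : ℝ) < r / 2 := by linarith
  refine lt_of_le_of_lt ?_ (hp.strictMonoOn_sq h2 hr (by linarith : r / 2 < r))
  refine le_of_tendsto hp.tendsto_sq ?_
  filter_upwards [Ioo_mem_nhdsGT h2] with x hx
  exact (hp.strictMonoOn_sq hx.1 h2 hx.2).le

theorem cbrtSq_pos (hp : IsProfile ν₀ t ν) {r : ℝ} (hr : 0 < r) :
    0 < cbrtSq ν r :=
  Real.rpow_pos_of_pos (hp.sq_pos hr) _

theorem cbrtSq_pow (hp : IsProfile ν₀ t ν) {r : ℝ} (hr : 0 < r) : cbrtSq ν r ^ 3 = ν r ^ 2 := by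
  rw [cbrtSq, ← Real.rpow_natCast, ← Real.rpow_mul (hp.sq_pos hr).le]
  norm_num

theorem cbrtSq₀_pos (hp : IsProfile ν₀ t ν) :
    0 < (ν₀ ^ 2) ^ (3⁻¹ : ℝ) :=
  Real.rpow_pos_of_pos hp.sq₀_pos _

theorem cbrtSq₀_pow (hp : IsProfile ν₀ t ν) : ((ν₀ ^ 2) ^ (3⁻¹ : ℝ)) ^ 3 = ν₀ ^ 2 := by
  rw [← Real.rpow_natCast, ← Real.rpow_mul hp.sq₀_pos.le]
  norm_num

theorem tendsto_cbrtSq (hp : IsProfile ν₀ t ν) :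
    Tendsto (cbrtSq ν) (𝓝[>] 0) (𝓝 ((ν₀ ^ 2) ^ (3⁻¹ : ℝ))) :=
  hp.tendsto_sq.rpow_const (Or.inl hp.sq₀_pos.ne')

theorem hasDerivAt_cbrtSq (hp : IsProfile ν₀ t ν) {r : ℝ} (hr : 0 < r) :
    HasDerivAt (cbrtSq ν) (2 * t r / cbrtSq ν r ^ 2) r := by
  have hu := hp.sq_pos hr
  refine ((hp.deriv_ν r hr).rpow_const (p := 3⁻¹) (Or.inl hu.ne')).congr_deriv ?_
  have hv := hp.cbrtSq_pos hr
  have h1 : (ν r ^ 2) ^ ((3⁻¹ : ℝ) - 1) = cbrtSq ν r / cbrtSq ν r ^ 3 := by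
    rw [Real.rpow_sub_one hu.ne', hp.cbrtSq_pow hr, cbrtSq]
  rw [h1]
  field_simp
  ring

theorem hasDerivAt_sq_t (hp : IsProfile ν₀ t ν) {r : ℝ} (hr : 0 < r) :
    HasDerivAt (fun r => t r ^ 2) (2 * t r * (1 - 2 * t r ^ 2 / ν r ^ 2)) r := by
  refine ((hp.deriv_t r hr).pow 2).congr_deriv ?_
  push_cast
  ring

/-- The conserved quantity of the profile equations. -/
theorem conserved (hp : IsProfile ν₀ t ν) {r : ℝ} (hr : 0 < r) :
    5 * t r ^ 2 * cbrtSq ν r ^ 2 = cbrtSq ν r ^ 5 - ((ν₀ ^ 2) ^ (3⁻¹ : ℝ)) ^ 5 := by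
  have hd : ∀ r ∈ Ioi (0 : ℝ),
      HasDerivAt (fun r => 5 * t r ^ 2 * cbrtSq ν r ^ 2 - cbrtSq ν r ^ 5) 0 r := by
    intro r hr
    have hv := hp.hasDerivAt_cbrtSq hr
    refine ((((hp.hasDerivAt_sq_t hr).const_mul 5).mul (hv.pow 2)).sub (hv.pow 5)).congr_deriv ?_
    have := hp.cbrtSq_pos hr
    rw [← hp.cbrtSq_pow hr, Pi.pow_apply]
    push_cast
    field_simp
    ring
  have hlim : Tendsto (fun r => 5 * t r ^ 2 * cbrtSq ν r ^ 2 - cbrtSq ν r ^ 5) (𝓝[>] 0)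
      (𝓝 (-((ν₀ ^ 2) ^ (3⁻¹ : ℝ)) ^ 5)) := by
    have := (((hp.t_zero.pow 2).const_mul 5).mul (hp.tendsto_cbrtSq.pow 2)).sub
      (hp.tendsto_cbrtSq.pow 5)
    simpa using this
  have hc : ∀ᶠ x in 𝓝[>] 0, 5 * t r ^ 2 * cbrtSq ν r ^ 2 - cbrtSq ν r ^ 5
      = 5 * t x ^ 2 * cbrtSq ν x ^ 2 - cbrtSq ν x ^ 5 := by
    filter_upwards [self_mem_nhdsWithin] with x hx
    exact isOpen_Ioi.is_const_of_deriv_eq_zero isPreconnected_Ioi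
      (fun x hx => (hd x hx).differentiableAt.differentiableWithinAt)
      (fun x hx => (hd x hx).deriv) hr hx
  have := tendsto_nhds_unique (tendsto_const_nhds.congr' hc) hlim
  linarith

theorem sq_t_eq (hp : IsProfile ν₀ t ν) {r : ℝ} (hr : 0 < r) :
    t r ^ 2 = (cbrtSq ν r ^ 5 - ((ν₀ ^ 2) ^ (3⁻¹ : ℝ)) ^ 5) / (5 * cbrtSq ν r ^ 2) := by
  have := hp.cbrtSq_pos hr
  rw [← hp.conserved hr]
  field_simp

theorem cbrtSq₀_lt (hp : IsProfile ν₀ t ν) {r : ℝ} (hr : 0 < r) :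
    (ν₀ ^ 2) ^ (3⁻¹ : ℝ) < cbrtSq ν r :=
  Real.rpow_lt_rpow hp.sq₀_pos.le (hp.sq₀_lt hr) (by norm_num)

/-- The equation `(√τ)' = 1 / profileSpeed τ` for `τ = v - v₀`. -/
theorem hasDerivAt_sqrt_cbrtSq (hp : IsProfile ν₀ t ν) {r : ℝ} (hr : 0 < r) :
    HasDerivAt (fun r => √(cbrtSq ν r - (ν₀ ^ 2) ^ (3⁻¹ : ℝ)))
      (profileSpeed ((ν₀ ^ 2) ^ (3⁻¹ : ℝ))
        (√(cbrtSq ν r - (ν₀ ^ 2) ^ (3⁻¹ : ℝ)) ^ 2))⁻¹ r := by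
  have hτ := sub_pos.2 (hp.cbrtSq₀_lt hr)
  have hv := hp.cbrtSq_pos hr
  have hv₀ := hp.cbrtSq₀_pos
  have hc := hp.conserved hr
  have ht := hp.t_pos r hr
  have hd := hp.hasDerivAt_cbrtSq hr
  generalize (ν₀ ^ 2) ^ (3⁻¹ : ℝ) = v₀ at *
  refine ((hd.sub_const v₀).sqrt hτ.ne').congr_deriv ?_
  rw [Real.sq_sqrt hτ.le, profileSpeed, add_sub_cancel]
  have hQ := quot5_pos hv₀ hv
  have h1 : √(cbrtSq ν r - v₀) * √(quot5 v₀ (cbrtSq ν r)) = √5 * t r * cbrtSq ν r := by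
    rw [← Real.sqrt_mul hτ.le, sub_mul_quot5, ← hc,
      show 5 * t r ^ 2 * cbrtSq ν r ^ 2 = 5 * (t r * cbrtSq ν r) ^ 2 by ring,
      Real.sqrt_mul (by norm_num), Real.sqrt_sq (by positivity), mul_assoc]
  have h5 : √(5 : ℝ) ≠ 0 := by positivity
  have hs := Real.sqrt_pos.2 hτ
  have hsQ := Real.sqrt_pos.2 hQ
  field_simp
  linear_combination (-1) * h1

/-- Near the zero section, `ν²` and `t²` are analytic functions of `r²`. -/
theorem exists_analyticAt_zero (hp : IsProfile ν₀ t ν) :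
    ∃ U T' : ℝ → ℝ, AnalyticAt ℝ U 0 ∧ AnalyticAt ℝ T' 0 ∧ U 0 = 3 ∧ T' 0 = 1 ∧
      ∀ᶠ r in 𝓝[>] 0, ν r ^ 2 - ν₀ ^ 2 = r ^ 2 * U (r ^ 2) ∧ t r ^ 2 = r ^ 2 * T' (r ^ 2) := by
  have hv₀ := hp.cbrtSq₀_pos
  have hlim := hp.tendsto_cbrtSq
  obtain ⟨n, hn, hnd, hn0, hne⟩ := exists_analyticAt_sq_eq
    (analyticAt_profileSpeed (τ := 0) hv₀ (by simpa using hv₀))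
    (profileSpeed_pos (τ := 0) hv₀ (by simpa using hv₀)).ne'
    (fun r hr => hp.hasDerivAt_sqrt_cbrtSq hr)
    (fun r hr => (profileSpeed_pos hv₀ (by positivity)).ne') (by
      have h1 := (hlim.sub_const ((ν₀ ^ 2) ^ (3⁻¹ : ℝ))).sqrt
      simpa using h1)
  rw [profileSpeed_zero hv₀] at hnd
  have hev : ∀ᶠ r in 𝓝[>] 0, cbrtSq ν r = (ν₀ ^ 2) ^ (3⁻¹ : ℝ) + n (r ^ 2) := by
    filter_upwards [hne, self_mem_nhdsWithin] with r h1 h2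
    rw [← h1, Real.sq_sqrt (sub_pos.2 (hp.cbrtSq₀_lt h2)).le]
    ring
  have hu := hp.cbrtSq₀_pow
  have ht : ∀ r, 0 < r → t r ^ 2 = _ := fun r hr => hp.sq_t_eq hr
  generalize (ν₀ ^ 2) ^ (3⁻¹ : ℝ) = v₀ at *
  have hUa : AnalyticAt ℝ (fun ρ => (v₀ + n ρ) ^ 3 - v₀ ^ 3) 0 := by fun_prop
  have hTa : AnalyticAt ℝ (fun ρ => ((v₀ + n ρ) ^ 5 - v₀ ^ 5) / (5 * (v₀ + n ρ) ^ 2)) 0 := by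
    refine AnalyticAt.div (by fun_prop) (by fun_prop) ?_
    rw [hn0]
    positivity
  have hnd' := hnd.const_add v₀
  have hUd : HasDerivAt (fun ρ => (v₀ + n ρ) ^ 3 - v₀ ^ 3) 3 0 := by
    refine ((hnd'.pow 3).sub_const _).congr_deriv ?_
    rw [hn0]
    push_cast
    field_simp
    ring
  have hTd : HasDerivAt (fun ρ => ((v₀ + n ρ) ^ 5 - v₀ ^ 5) / (5 * (v₀ + n ρ) ^ 2)) 1 0 := by
    refine (((hnd'.pow 5).sub_const (v₀ ^ 5)).div ((hnd'.pow 2).const_mul 5) ?_).congr_deriv ?_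
    · rw [Pi.pow_apply, hn0]; positivity
    simp only [Pi.pow_apply, hn0]
    push_cast
    field_simp
    ring
  have hdiv : ∀ {F : ℝ → ℝ}, F 0 = 0 → ∀ ρ, ρ ≠ 0 → F ρ = ρ * dslope F 0 ρ := by
    intro F hF ρ hρ
    rw [dslope_of_ne _ hρ, slope_def_field, hF]
    field_simp
    ring
  obtain ⟨pU, hpU⟩ := hUa
  obtain ⟨pT, hpT⟩ := hTa
  refine ⟨dslope _ 0, dslope _ 0, hpU.has_fpower_series_dslope_fslope.analyticAt,
    hpT.has_fpower_series_dslope_fslope.analyticAt, ?_, ?_, ?_⟩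
  · rw [dslope_same, hUd.deriv]
  · rw [dslope_same, hTd.deriv]
  · filter_upwards [hev, self_mem_nhdsWithin] with r h1 h2
    have h3 : r ^ 2 ≠ 0 := pow_ne_zero 2 (ne_of_gt h2)
    rw [← hdiv (by simp [hn0]) _ h3, ← hdiv (by simp [hn0]) _ h3, ← h1, hu, hp.cbrtSq_pow h2,
      ht r h2]
    exact ⟨rfl, rfl⟩

theorem analyticAt_cbrtSq (hp : IsProfile ν₀ t ν) {r : ℝ} (hr : 0 < r) :
    AnalyticAt ℝ (cbrtSq ν) r := by
  have hv₀ := hp.cbrtSq₀_pos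
  set v₀ := (ν₀ ^ 2) ^ (3⁻¹ : ℝ) with hv
  have h1 : AnalyticAt ℝ (fun r => √(cbrtSq ν r - v₀)) r := by
    refine analyticAt_of_hasDerivAt_inv (f := fun σ => profileSpeed v₀ (σ ^ 2)) ?_ ?_ ?_
    · exact AnalyticAt.fun_comp (f := fun σ : ℝ => σ ^ 2)
        (analyticAt_profileSpeed hv₀ (by positivity)) (by fun_prop)
    · exact (profileSpeed_pos hv₀ (by positivity)).ne'
    · filter_upwards [Ioi_mem_nhds hr] with x hx
      exact hp.hasDerivAt_sqrt_cbrtSq hx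
  have h2 : AnalyticAt ℝ (fun r => √(cbrtSq ν r - v₀) ^ 2 + v₀) r := by fun_prop
  refine h2.congr ?_
  filter_upwards [Ioi_mem_nhds hr] with x hx
  rw [Real.sq_sqrt (sub_pos.2 (hp.cbrtSq₀_lt hx)).le]
  ring

theorem analyticAt_sq (hp : IsProfile ν₀ t ν) {r : ℝ} (hr : 0 < r) :
    AnalyticAt ℝ (fun r => ν r ^ 2) r := by
  refine ((hp.analyticAt_cbrtSq hr).pow 3).congr ?_
  filter_upwards [Ioi_mem_nhds hr] with x hx
  exact hp.cbrtSq_pow hx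

theorem analyticAt_sq_t (hp : IsProfile ν₀ t ν) {r : ℝ} (hr : 0 < r) :
    AnalyticAt ℝ (fun r => t r ^ 2) r := by
  have hv := hp.analyticAt_cbrtSq hr
  have h1 : AnalyticAt ℝ (fun r => (cbrtSq ν r ^ 5 - ((ν₀ ^ 2) ^ (3⁻¹ : ℝ)) ^ 5)
      / (5 * cbrtSq ν r ^ 2)) r := by
    refine AnalyticAt.div (by fun_prop) (by fun_prop) ?_
    have := hp.cbrtSq_pos hr
    positivity
  refine h1.congr ?_
  filter_upwards [Ioi_mem_nhds hr] with x hx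
  exact (hp.sq_t_eq hx).symm

theorem monotoneOn_sq_t (hp : IsProfile ν₀ t ν) : MonotoneOn (fun r => t r ^ 2) (Ioi 0) := by
  intro a ha b hb hab
  have hva := hp.cbrtSq_pos ha
  have hv₀ := hp.cbrtSq₀_pos
  have hv : cbrtSq ν a ≤ cbrtSq ν b :=
    Real.rpow_le_rpow (hp.sq_pos ha).le (hp.strictMonoOn_sq.monotoneOn ha hb hab) (by norm_num)
  simp only
  rw [hp.sq_t_eq ha, hp.sq_t_eq hb]
  generalize (ν₀ ^ 2) ^ (3⁻¹ : ℝ) = v₀ at *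
  have key : ∀ v : ℝ, 0 < v → (v ^ 5 - v₀ ^ 5) / (5 * v ^ 2) = (v ^ 3 - v₀ ^ 5 / v ^ 2) / 5 := by
    intro v hv
    field_simp
  rw [key _ hva, key _ (hva.trans_le hv)]
  gcongr

theorem tendsto_sq_atTop (hp : IsProfile ν₀ t ν) : Tendsto (fun r => ν r ^ 2) atTop atTop := by
  have ht1 := hp.t_pos 1 one_pos
  have h1 : ∀ r, 1 ≤ r → ν 1 ^ 2 + 6 * t 1 * (r - 1) ≤ ν r ^ 2 := by
    intro r hr
    have := (convex_Ici (1 : ℝ)).mul_sub_le_image_sub_of_le_deriv (f := fun r => ν r ^ 2)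
      (C := 6 * t 1)
      (fun x hx => (hp.deriv_ν x (one_pos.trans_le hx)).continuousAt.continuousWithinAt)
      (fun x hx => (hp.deriv_ν x (one_pos.trans_le
        (interior_subset hx))).differentiableAt.differentiableWithinAt)
      (fun x hx => by
        have hx1 : (1 : ℝ) ≤ x := interior_subset hx
        have hx0 : (0 : ℝ) < x := one_pos.trans_le hx1
        rw [(hp.deriv_ν x hx0).deriv]
        have h2 := hp.monotoneOn_sq_t (mem_Ioi.2 one_pos) hx0 hx1
        have h3 := (pow_le_pow_iff_left₀ ht1.le (hp.t_pos x hx0).le two_ne_zero).1 h2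
        linarith)
      1 self_mem_Ici r hr hr
    linarith
  refine tendsto_atTop_mono' atTop (eventually_atTop.2 ⟨1, h1⟩) ?_
  refine tendsto_atTop_add_const_left _ _ ?_
  exact (tendsto_atTop_add_const_right atTop (-1) tendsto_id).const_mul_atTop (by positivity)

theorem tendsto_sq_t_div (hp : IsProfile ν₀ t ν) :
    Tendsto (fun r => t r ^ 2 / ν r ^ 2) atTop (𝓝 5⁻¹) := by
  have hv : Tendsto (cbrtSq ν) atTop atTop :=
    (tendsto_rpow_atTop (by norm_num : (0 : ℝ) < 3⁻¹)).comp hp.tendsto_sq_atTop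
  have h1 : Tendsto (fun r => 5⁻¹ * (1 - (((ν₀ ^ 2) ^ (3⁻¹ : ℝ)) / cbrtSq ν r) ^ 5)) atTop
      (𝓝 (5⁻¹ * (1 - 0 ^ 5))) :=
    ((((tendsto_const_nhds (x := (ν₀ ^ 2) ^ (3⁻¹ : ℝ))).div_atTop hv).pow 5).const_sub 1).const_mul _
  norm_num at h1
  norm_num
  refine h1.congr' ?_
  filter_upwards [eventually_gt_atTop 0] with r hr
  have := hp.cbrtSq_pos hr
  rw [hp.sq_t_eq hr, ← hp.cbrtSq_pow hr]
  field_simp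

/-- `ν²` takes all values above `ν₀²`. -/
theorem exists_sq_eq (hp : IsProfile ν₀ t ν) {w : ℝ} (hw : ν₀ ^ 2 < w) :
    ∃ r, 0 < r ∧ ν r ^ 2 = w := by
  have hc : ContinuousOn (fun r => ν r ^ 2) (Ioi 0) :=
    fun r hr => (hp.deriv_ν r hr).continuousAt.continuousWithinAt
  obtain ⟨a, ha1, ha2⟩ := ((hp.tendsto_sq.eventually_lt_const hw).and self_mem_nhdsWithin).exists
  obtain ⟨b, hb1, hb2⟩ := ((hp.tendsto_sq_atTop.eventually_gt_atTop w).and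
    (eventually_gt_atTop 0)).exists
  obtain ⟨r, hr, h⟩ := isPreconnected_Ioi.intermediate_value ha2 hb2 hc ⟨ha1.le, hb1.le⟩
  exact ⟨r, hr, h⟩

end IsProfile

/-! ### The radial instanton equation -/

/-- The ordinary differential equation to which the instanton equation reduces for the connection
`x(r) ∑ η_i ⊗ T_i`. -/
def RadialODE (t ν : ℝ → ℝ) (J : Set ℝ) (x : ℝ → ℝ) : Prop :=
  ∀ r ∈ J, HasDerivAt x (2 * x r * (1 - x r) / t r - 4 * x r * t r / ν r ^ 2) r

/-- The solution `3 t² / (ν² - ν₀² + 3 / y₀)`, written so that it makes sense for `y₀ = 0`. -/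
def family (ν₀ : ℝ) (t ν : ℝ → ℝ) (y₀ r : ℝ) : ℝ :=
  3 * y₀ * t r ^ 2 / (3 + y₀ * (ν r ^ 2 - ν₀ ^ 2))

/-- The solution `3 t² / (ν² - ν₀²)`, the limit of the family as `y₀ → ∞`. -/
def limitSol (ν₀ : ℝ) (t ν : ℝ → ℝ) (r : ℝ) : ℝ := 3 * t r ^ 2 / (ν r ^ 2 - ν₀ ^ 2)

/-- A solution of a linear equation that vanishes at one point vanishes identically. -/
theorem eqOn_zero_of_hasDerivAt_mul {z a : ℝ → ℝ} {J : Set ℝ} (hJ : IsOpen J)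
    (hJc : J.OrdConnected) (ha : ContinuousOn a J) (hz : ∀ r ∈ J, HasDerivAt z (a r * z r) r)
    {r₀ : ℝ} (hr₀ : r₀ ∈ J) (h0 : z r₀ = 0) : ∀ r ∈ J, z r = 0 := by
  have hP : ∀ r ∈ J, HasDerivAt (fun r => ∫ s in r₀..r, a s) (a r) r := by
    intro r hr
    have hsub := hJc.uIcc_subset hr₀ hr
    exact intervalIntegral.integral_hasDerivAt_right
      ((ha.mono hsub).intervalIntegrable)
      (ha.stronglyMeasurableAtFilter hJ r hr) (ha.continuousAt (hJ.mem_nhds hr))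
  have hd : ∀ r ∈ J, HasDerivAt (fun r => z r * Real.exp (-∫ s in r₀..r, a s)) 0 r := by
    intro r hr
    refine ((hz r hr).mul (hP r hr).neg.exp).congr_deriv ?_
    ring
  intro r hr
  have := hJ.is_const_of_deriv_eq_zero hJc.isPreconnected
    (fun x hx => (hd x hx).differentiableAt.differentiableWithinAt)
    (fun x hx => (hd x hx).deriv) hr hr₀
  simp only [h0, zero_mul, mul_eq_zero, Real.exp_ne_zero, or_false] at this
  exact this

/-- The function `x(r) / r²`, completed by an even analytic germ at `r = 0`, is analytic. -/
theorem hasParameter_of_analyticAt {J : Set ℝ} (hJ : J ⊆ Ioi 0) {x Y : ℝ → ℝ}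
    (hx : ∀ r ∈ J, AnalyticAt ℝ x r) (hY : AnalyticAt ℝ Y 0)
    (h : ∀ᶠ r in 𝓝[>] 0, x r = r ^ 2 * Y (r ^ 2)) : HasParameter J x (Y 0) := by
  refine ⟨fun r => if 0 < r then x r / r ^ 2 else Y (r ^ 2), ?_, by simp, fun r hr => ?_⟩
  · rintro r (rfl | hr)
    · have h1 : AnalyticAt ℝ (fun r : ℝ => Y (r ^ 2)) 0 :=
        AnalyticAt.fun_comp (f := fun r : ℝ => r ^ 2) (by simpa using hY) (by fun_prop)
      refine h1.congr ?_
      filter_upwards [eventually_nhdsWithin_iff.1 h] with r hr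
      split_ifs with h0
      · rw [hr h0]
        field_simp
      · rfl
    · have hr0 : 0 < r := hJ hr
      have h1 : AnalyticAt ℝ (fun r => x r / r ^ 2) r :=
        AnalyticAt.div (hx r hr) (by fun_prop) (pow_ne_zero 2 hr0.ne')
      refine h1.congr ?_
      filter_upwards [Ioi_mem_nhds hr0] with s hs
      rw [if_pos (mem_Ioi.1 hs)]
  · have hr0 : 0 < r := hJ hr
    simp only [if_pos hr0]
    field_simp

namespace IsProfile

variable {ν₀ : ℝ} {t ν : ℝ → ℝ}

/-- The solution `3 t² / (ν² + c)` with `c = a / b`, written so that `b = 0` is allowed. -/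
theorem radialODE_div (hp : IsProfile ν₀ t ν) {J : Set ℝ} (hJ : J ⊆ Ioi 0) {a b : ℝ}
    (h : ∀ r ∈ J, a + b * ν r ^ 2 ≠ 0) :
    RadialODE t ν J (fun r => 3 * b * t r ^ 2 / (a + b * ν r ^ 2)) := by
  intro r hr
  have hr0 := hJ hr
  have ht := hp.t_pos r hr0
  have hu := hp.sq_pos hr0
  have h0 := h r hr
  beta_reduce
  refine (((hp.hasDerivAt_sq_t hr0).const_mul (3 * b)).div
    (((hp.deriv_ν r hr0).const_mul b).const_add a) h0).congr_deriv ?_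
  generalize ν r ^ 2 = u at *
  field_simp
  ring

theorem family_denom_pos (hp : IsProfile ν₀ t ν) {y₀ : ℝ} (hy : 0 ≤ y₀) {r : ℝ} (hr : 0 < r) :
    0 < 3 + y₀ * (ν r ^ 2 - ν₀ ^ 2) := by
  have := sub_pos.2 (hp.sq₀_lt hr)
  positivity

theorem radialODE_family (hp : IsProfile ν₀ t ν) {J : Set ℝ} (hJ : J ⊆ Ioi 0) {y₀ : ℝ}
    (h : ∀ r ∈ J, 3 + y₀ * (ν r ^ 2 - ν₀ ^ 2) ≠ 0) : RadialODE t ν J (family ν₀ t ν y₀) := by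
  have e : family ν₀ t ν y₀
      = fun r => 3 * y₀ * t r ^ 2 / ((3 - y₀ * ν₀ ^ 2) + y₀ * ν r ^ 2) := by
    funext r
    rw [family]
    ring_nf
  rw [e]
  refine hp.radialODE_div hJ fun r hr h0 => h r hr ?_
  linarith

theorem radialODE_limitSol (hp : IsProfile ν₀ t ν) : RadialODE t ν (Ioi 0) (limitSol ν₀ t ν) := by
  have e : limitSol ν₀ t ν = fun r => 3 * 1 * t r ^ 2 / (-ν₀ ^ 2 + 1 * ν r ^ 2) := by
    funext r
    rw [limitSol]
    ring_nf
  rw [e]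
  refine hp.radialODE_div Subset.rfl fun r hr h0 => ?_
  have := hp.sq₀_lt hr
  linarith

/-- The equation is solved by quadratures: `z = x / t²` satisfies `z' = -2 t z²`, and
`2 t = (ν²)' / 3`. -/
theorem radialODE_cases (hp : IsProfile ν₀ t ν) {J : Set ℝ} (hJo : IsOpen J) (hJc : J.OrdConnected)
    (hJ : J ⊆ Ioi 0) {x : ℝ → ℝ} (hx : RadialODE t ν J x) :
    (∀ r ∈ J, x r = 0) ∨
      ∃ c : ℝ, ∀ r ∈ J, x r ≠ 0 ∧ ν r ^ 2 + c ≠ 0 ∧ x r = 3 * t r ^ 2 / (ν r ^ 2 + c) := by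
  have hz : ∀ r ∈ J, HasDerivAt (fun r => x r / t r ^ 2)
      (-2 * t r * (x r / t r ^ 2) * (x r / t r ^ 2)) r := by
    intro r hr
    have ht := hp.t_pos r (hJ hr)
    have hu := hp.sq_pos (hJ hr)
    refine ((hx r hr).div (hp.hasDerivAt_sq_t (hJ hr)) (by positivity)).congr_deriv ?_
    generalize ν r ^ 2 = u at *
    field_simp
    ring
  by_cases h0 : ∃ r₀ ∈ J, x r₀ = 0
  · left
    obtain ⟨r₀, hr₀, h0⟩ := h0
    have hzero := eqOn_zero_of_hasDerivAt_mul hJo hJc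
      (a := fun r => -2 * t r * (x r / t r ^ 2)) (fun r hr => by
        refine ContinuousAt.continuousWithinAt ?_
        exact ((hp.deriv_t r (hJ hr)).continuousAt.const_mul (-2)).mul (hz r hr).continuousAt)
      hz hr₀ (by rw [h0, zero_div])
    intro r hr
    have ht := hp.t_pos r (hJ hr)
    simpa [ht.ne'] using hzero r hr
  · right
    push Not at h0
    have hd : ∀ r ∈ J, HasDerivAt (fun r => 3 * (x r / t r ^ 2)⁻¹ - ν r ^ 2) 0 r := by
      intro r hr
      have ht := hp.t_pos r (hJ hr)
      have hx0 := h0 r hr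
      refine ((((hz r hr).inv (by positivity)).const_mul 3).sub
        (hp.deriv_ν r (hJ hr))).congr_deriv ?_
      field_simp
      ring
    rcases J.eq_empty_or_nonempty with rfl | ⟨r₀, hr₀⟩
    · exact ⟨0, by simp⟩
    refine ⟨3 * (x r₀ / t r₀ ^ 2)⁻¹ - ν r₀ ^ 2, fun r hr => ?_⟩
    have hc := hJo.is_const_of_deriv_eq_zero hJc.isPreconnected
      (fun x hx => (hd x hx).differentiableAt.differentiableWithinAt)
      (fun x hx => (hd x hx).deriv) hr hr₀
    rw [← hc]
    have ht := hp.t_pos r (hJ hr)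
    have hx0 := h0 r hr
    refine ⟨hx0, ?_, ?_⟩
    · rw [add_sub_cancel]
      positivity
    · rw [add_sub_cancel]
      field_simp

/-- The solutions on the whole half-line. -/
theorem radialODE_Ioi_cases (hp : IsProfile ν₀ t ν) {x : ℝ → ℝ} (hx : RadialODE t ν (Ioi 0) x) :
    EqOn x (limitSol ν₀ t ν) (Ioi 0) ∨ ∃ y₀, 0 ≤ y₀ ∧ EqOn x (family ν₀ t ν y₀) (Ioi 0) := by
  rcases hp.radialODE_cases isOpen_Ioi ordConnected_Ioi Subset.rfl hx with h | ⟨c, h⟩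
  · exact Or.inr ⟨0, le_rfl, fun r hr => by simp [h r hr, family]⟩
  · rcases lt_trichotomy (-c) (ν₀ ^ 2) with hc | hc | hc
    · right
      have hc' : 0 < ν₀ ^ 2 + c := by linarith
      refine ⟨3 / (ν₀ ^ 2 + c), by positivity, fun r hr => ?_⟩
      have h1 := hp.sq₀_lt hr
      have h2 : 0 < ν r ^ 2 + c := by linarith
      have h3 : 3 + 3 / (ν₀ ^ 2 + c) * (ν r ^ 2 - ν₀ ^ 2) = 3 * (ν r ^ 2 + c) / (ν₀ ^ 2 + c) := by
        field_simp
        ring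
      rw [(h r hr).2.2, family, h3]
      field_simp
    · left
      intro r hr
      rw [(h r hr).2.2, limitSol, ← hc, sub_neg_eq_add]
    · obtain ⟨r, hr, h1⟩ := hp.exists_sq_eq hc
      exact absurd (by rw [h1]; ring) (h r hr).2.1

theorem analyticAt_family (hp : IsProfile ν₀ t ν) {J : Set ℝ} (hJ : J ⊆ Ioi 0) {y₀ : ℝ}
    (h : ∀ r ∈ J, 3 + y₀ * (ν r ^ 2 - ν₀ ^ 2) ≠ 0) {r : ℝ} (hr : r ∈ J) :
    AnalyticAt ℝ (family ν₀ t ν y₀) r := by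
  have h1 := hp.analyticAt_sq (hJ hr)
  have h2 := hp.analyticAt_sq_t (hJ hr)
  unfold family
  exact AnalyticAt.div (by fun_prop) (by fun_prop) (h r hr)

theorem analyticAt_limitSol (hp : IsProfile ν₀ t ν) {r : ℝ} (hr : 0 < r) :
    AnalyticAt ℝ (limitSol ν₀ t ν) r := by
  have h1 := hp.analyticAt_sq hr
  have h2 := hp.analyticAt_sq_t hr
  unfold limitSol
  exact AnalyticAt.div (by fun_prop) (by fun_prop) (sub_pos.2 (hp.sq₀_lt hr)).ne'

theorem exists_family_eq (hp : IsProfile ν₀ t ν) (y₀ : ℝ) :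
    ∃ Y : ℝ → ℝ, AnalyticAt ℝ Y 0 ∧ Y 0 = y₀ ∧
      ∀ᶠ r in 𝓝[>] 0, family ν₀ t ν y₀ r = r ^ 2 * Y (r ^ 2) := by
  obtain ⟨U, T', hU, hT, hU0, hT0, h⟩ := hp.exists_analyticAt_zero
  refine ⟨fun ρ => 3 * y₀ * T' ρ / (3 + y₀ * (ρ * U ρ)), ?_, ?_, ?_⟩
  · refine AnalyticAt.div (by fun_prop) (by fun_prop) ?_
    norm_num
  · simp [hT0]
  · filter_upwards [h] with r h
    rw [family, h.1, h.2]
    ring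

theorem exists_limitSol_eq (hp : IsProfile ν₀ t ν) :
    ∃ W : ℝ → ℝ, AnalyticAt ℝ W 0 ∧
      ∀ᶠ r in 𝓝[>] 0, limitSol ν₀ t ν r = 1 + r ^ 2 * W (r ^ 2) := by
  obtain ⟨U, T', hU, hT, hU0, hT0, h⟩ := hp.exists_analyticAt_zero
  -- `3 T' / U` takes the value `1` at `0`
  have hF : AnalyticAt ℝ (fun ρ => 3 * T' ρ / U ρ) 0 :=
    AnalyticAt.div (by fun_prop) hU (by rw [hU0]; norm_num)
  obtain ⟨p, hF⟩ := hF
  refine ⟨dslope (fun ρ => 3 * T' ρ / U ρ) 0, hF.has_fpower_series_dslope_fslope.analyticAt, ?_⟩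
  filter_upwards [h, self_mem_nhdsWithin] with r h hr
  have hr0 : r ≠ 0 := ne_of_gt hr
  have h3 : r ^ 2 ≠ 0 := pow_ne_zero 2 hr0
  have hU1 : r ^ 2 * U (r ^ 2) ≠ 0 := by
    rw [← h.1]
    exact (sub_pos.2 (hp.sq₀_lt hr)).ne'
  have hU2 := right_ne_zero_of_mul hU1
  rw [limitSol, h.1, h.2, dslope_of_ne _ h3, slope_def_field, hU0, hT0]
  field_simp
  ring

theorem hasParameter_family (hp : IsProfile ν₀ t ν) {J : Set ℝ} (hJ : J ⊆ Ioi 0) {y₀ : ℝ}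
    (h : ∀ r ∈ J, 3 + y₀ * (ν r ^ 2 - ν₀ ^ 2) ≠ 0) : HasParameter J (family ν₀ t ν y₀) y₀ := by
  obtain ⟨Y, hY, hY0, hYe⟩ := hp.exists_family_eq y₀
  rw [← hY0] at hYe ⊢
  exact hasParameter_of_analyticAt hJ (fun r hr => hp.analyticAt_family hJ (by rwa [hY0]) hr) hY
    hYe

theorem tendsto_family_zero (hp : IsProfile ν₀ t ν) (y₀ : ℝ) :
    Tendsto (family ν₀ t ν y₀) (𝓝[>] 0) (𝓝 0) := by
  obtain ⟨Y, hY, hY0, hYe⟩ := hp.exists_family_eq y₀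
  have h1 : ContinuousAt (fun r : ℝ => r ^ 2 * Y (r ^ 2)) 0 := by
    have : ContinuousAt (fun r : ℝ => Y (r ^ 2)) 0 :=
      ContinuousAt.comp (f := fun r : ℝ => r ^ 2) (by simpa using hY.continuousAt) (by fun_prop)
    exact ContinuousAt.mul (by fun_prop) this
  have h2 := h1.tendsto.mono_left (nhdsWithin_le_nhds (s := Ioi 0))
  simp only [ne_eq, OfNat.ofNat_ne_zero, not_false_eq_true, zero_pow, zero_mul] at h2
  exact h2.congr' (hYe.mono fun _ h => h.symm)

theorem tendsto_limitSol_one (hp : IsProfile ν₀ t ν) :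
    Tendsto (limitSol ν₀ t ν) (𝓝[>] 0) (𝓝 1) := by
  obtain ⟨Y, hY, hYe⟩ := hp.exists_limitSol_eq
  have h1 : ContinuousAt (fun r : ℝ => 1 + r ^ 2 * Y (r ^ 2)) 0 := by
    have : ContinuousAt (fun r : ℝ => Y (r ^ 2)) 0 :=
      ContinuousAt.comp (f := fun r : ℝ => r ^ 2) (by simpa using hY.continuousAt) (by fun_prop)
    exact (ContinuousAt.mul (by fun_prop) this).const_add 1
  have h2 := h1.tendsto.mono_left (nhdsWithin_le_nhds (s := Ioi 0))
  simp only [ne_eq, OfNat.ofNat_ne_zero, not_false_eq_true, zero_pow, zero_mul, add_zero] at h2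
  exact h2.congr' (hYe.mono fun _ h => h.symm)

theorem family_injective (hp : IsProfile ν₀ t ν) {y₀ y₁ : ℝ} (h₀ : 0 ≤ y₀) (h₁ : 0 ≤ y₁)
    (h : EqOn (family ν₀ t ν y₀) (family ν₀ t ν y₁) (Ioi 0)) : y₀ = y₁ := by
  have h1 := h (mem_Ioi.2 one_pos)
  have ht := hp.t_pos 1 one_pos
  have hd₀ := hp.family_denom_pos h₀ one_pos
  have hd₁ := hp.family_denom_pos h₁ one_pos
  simp only [family] at h1
  rw [div_eq_div_iff hd₀.ne' hd₁.ne'] at h1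
  have h2 : 9 * t 1 ^ 2 * (y₀ - y₁) = 0 := by linear_combination h1
  have h3 : 9 * t 1 ^ 2 ≠ 0 := by positivity
  linarith [(mul_eq_zero.1 h2).resolve_left h3]

/-- All solutions other than `0` converge to `3 / 5`. -/
theorem tendsto_atTop_of_radialODE (hp : IsProfile ν₀ t ν) {x : ℝ → ℝ}
    (hx : RadialODE t ν (Ioi 0) x) :
    (∀ r ∈ Ioi (0 : ℝ), x r = 0) ∨ Tendsto x atTop (𝓝 (3 / 5)) := by
  refine (hp.radialODE_cases isOpen_Ioi ordConnected_Ioi Subset.rfl hx).imp_right ?_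
  rintro ⟨c, h⟩
  have h1 : Tendsto (fun r => 3 * (t r ^ 2 / ν r ^ 2) / (1 + c / ν r ^ 2)) atTop
      (𝓝 (3 * 5⁻¹ / (1 + 0))) :=
    (hp.tendsto_sq_t_div.const_mul 3).div
      ((tendsto_const_nhds.div_atTop hp.tendsto_sq_atTop).const_add 1) (by norm_num)
  have e : (3 : ℝ) * 5⁻¹ / (1 + 0) = 3 / 5 := by norm_num
  rw [e] at h1
  refine h1.congr' ?_
  filter_upwards [eventually_gt_atTop 0] with r hr
  have h2 := h r hr
  have h3 := hp.sq_pos hr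
  have h4 := h2.2.1
  have e : 1 + c / ν r ^ 2 = (ν r ^ 2 + c) / ν r ^ 2 := by rw [add_div, div_self h3.ne']
  rw [h2.2.2, e]
  generalize ν r ^ 2 = u at *
  field_simp

/-- A solution near the zero section is determined by its parameter. -/
theorem eqOn_family_of_hasParameter (hp : IsProfile ν₀ t ν) {R y₀ : ℝ} (hR : 0 < R) (hy : y₀ ≠ 0)
    {x : ℝ → ℝ} (hx : RadialODE t ν (Ioo 0 R) x) (hpar : HasParameter (Ioo 0 R) x y₀) :
    (∀ r ∈ Ioo 0 R, 3 + y₀ * (ν r ^ 2 - ν₀ ^ 2) ≠ 0) ∧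
      EqOn x (family ν₀ t ν y₀) (Ioo 0 R) := by
  obtain ⟨y, hya, hy0, hxy⟩ := hpar
  have hyc : Tendsto y (𝓝[>] 0) (𝓝 y₀) := by
    have := (hya 0 (mem_insert _ _)).continuousAt.tendsto
    rw [hy0] at this
    exact this.mono_left nhdsWithin_le_nhds
  have hev : ∀ᶠ r in 𝓝[>] 0, r ∈ Ioo 0 R := Ioo_mem_nhdsGT hR
  rcases hp.radialODE_cases isOpen_Ioo ordConnected_Ioo Ioo_subset_Ioi_self hx with h | ⟨c, h⟩
  · obtain ⟨r, h1, h2⟩ := ((hyc.eventually_ne hy).and hev).exists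
    have h3 := hxy r h2
    rw [h r h2] at h3
    have h4 : r ^ 2 ≠ 0 := pow_ne_zero 2 h2.1.ne'
    exact absurd h3.symm (mul_ne_zero h4 h1)
  · obtain ⟨U, T', -, hT, -, hT0, he⟩ := hp.exists_analyticAt_zero
    have hsq : Tendsto (fun r : ℝ => r ^ 2) (𝓝[>] 0) (𝓝 0) := by
      have : Continuous (fun r : ℝ => r ^ 2) := by fun_prop
      simpa using (this.tendsto 0).mono_left (nhdsWithin_le_nhds (s := Ioi 0))
    have hTc : Tendsto (fun r : ℝ => 3 * T' (r ^ 2)) (𝓝[>] 0) (𝓝 (3 * 1)) := by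
      rw [← hT0]
      exact (hT.continuousAt.tendsto.comp hsq).const_mul 3
    have h1 : Tendsto (fun r => y r * (ν r ^ 2 + c)) (𝓝[>] 0) (𝓝 (y₀ * (ν₀ ^ 2 + c))) :=
      hyc.mul (hp.tendsto_sq.add_const c)
    have h2 : ∀ᶠ r in 𝓝[>] 0, 3 * T' (r ^ 2) = y r * (ν r ^ 2 + c) := by
      filter_upwards [he, hev] with r h3 h4
      have h5 := (h r h4).2.2
      have h6 := (h r h4).2.1
      have h7 : r ^ 2 ≠ 0 := pow_ne_zero 2 h4.1.ne'
      rw [hxy r h4, eq_div_iff h6, h3.2] at h5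
      have : r ^ 2 * (3 * T' (r ^ 2)) = r ^ 2 * (y r * (ν r ^ 2 + c)) := by
        linear_combination -h5
      exact mul_left_cancel₀ h7 this
    have h3 : y₀ * (ν₀ ^ 2 + c) = 3 * 1 :=
      tendsto_nhds_unique (h1.congr' (h2.mono fun _ h => h.symm)) hTc
    have h4 : ∀ r, 3 + y₀ * (ν r ^ 2 - ν₀ ^ 2) = y₀ * (ν r ^ 2 + c) := by
      intro r
      linear_combination -h3
    refine ⟨fun r hr => ?_, fun r hr => ?_⟩
    · rw [h4]
      exact mul_ne_zero hy (h r hr).2.1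
    · have h5 := (h r hr).2.1
      rw [(h r hr).2.2, family, h4]
      field_simp

end IsProfile

/-! ### The Cayley form -/

theorem dx_eq (a b c d : Fin 8) (v : Fin 4 → Fin 8 → ℝ) :
    dx a b c d v =
      v 0 a * (v 1 b * (v 2 c * v 3 d - v 2 d * v 3 c) - v 1 c * (v 2 b * v 3 d - v 2 d * v 3 b)
        + v 1 d * (v 2 b * v 3 c - v 2 c * v 3 b))
      - v 0 b * (v 1 a * (v 2 c * v 3 d - v 2 d * v 3 c) - v 1 c * (v 2 a * v 3 d - v 2 d * v 3 a)
        + v 1 d * (v 2 a * v 3 c - v 2 c * v 3 a))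
      + v 0 c * (v 1 a * (v 2 b * v 3 d - v 2 d * v 3 b) - v 1 b * (v 2 a * v 3 d - v 2 d * v 3 a)
        + v 1 d * (v 2 a * v 3 b - v 2 b * v 3 a))
      - v 0 d * (v 1 a * (v 2 b * v 3 c - v 2 c * v 3 b) - v 1 b * (v 2 a * v 3 c - v 2 c * v 3 a)
        + v 1 c * (v 2 a * v 3 b - v 2 b * v 3 a)) := by
  rw [dx, Matrix.det_succ_row_zero]
  simp only [Fin.sum_univ_succ, Matrix.det_fin_three]
  simp [Fin.succAbove, Fin.lt_def]
  ring

/-- The form `dx^{abcd}` as an alternating map. -/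
def dxAlt (a b c d : Fin 8) : (Fin 8 → ℝ) [⋀^Fin 4]→ₗ[ℝ] ℝ :=
  Matrix.detRowAlternating.compLinearMap (LinearMap.funLeft ℝ ℝ ![a, b, c, d])

theorem dxAlt_apply (a b c d : Fin 8) (v : Fin 4 → Fin 8 → ℝ) : dxAlt a b c d v = dx a b c d v := by
  rw [dx, ← Matrix.det_transpose]
  rfl

/-- The standard Cayley form as an alternating map. -/
def cayleyAlt : (Fin 8 → ℝ) [⋀^Fin 4]→ₗ[ℝ] ℝ :=
  dxAlt 0 1 2 3 - dxAlt 0 1 4 5 - dxAlt 0 1 6 7 - dxAlt 0 2 4 6 - dxAlt 0 2 7 5 - dxAlt 0 3 4 7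
    - dxAlt 0 3 5 6 + dxAlt 4 5 6 7 - dxAlt 1 2 4 7 - dxAlt 1 2 5 6 - dxAlt 2 3 4 5 - dxAlt 2 3 6 7
    - dxAlt 3 1 4 6 - dxAlt 3 1 7 5

theorem cayleyAlt_apply (v : Fin 4 → Fin 8 → ℝ) : cayleyAlt v = cayley0 v := by
  simp only [cayleyAlt, AlternatingMap.sub_apply, AlternatingMap.add_apply, dxAlt_apply, cayley0]

/-- The components of the Cayley form in the standard basis. -/
def cayleyComp (k : Fin 4 → Fin 8) : ℝ := cayley0 (fun j => Pi.single (k j) 1)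

theorem cayleyComp_comp_perm (k : Fin 4 → Fin 8) (ρ : Equiv.Perm (Fin 4)) :
    cayleyComp (k ∘ ρ) = ((Equiv.Perm.sign ρ : ℤ) : ℝ) * cayleyComp k := by
  simp only [cayleyComp, ← cayleyAlt_apply]
  have := cayleyAlt.map_perm (fun j => Pi.single (k j) (1 : ℝ)) ρ
  rw [Units.smul_def, zsmul_eq_mul] at this
  exact this

theorem cayleyComp_eq_zero {k : Fin 4 → Fin 8} {i j : Fin 4} (h : k i = k j) (hij : i ≠ j) :
    cayleyComp k = 0 := by
  rw [cayleyComp, ← cayleyAlt_apply]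
  exact cayleyAlt.map_eq_zero_of_eq _ (by rw [h]) hij

/-- The value of `dx^{rs}` on the basis vectors with indices `c, d`, as an integer. -/
def minor2 (r s c d : Fin 8) : ℤ :=
  (if c = r then if d = s then 1 else 0 else 0) - (if c = s then if d = r then 1 else 0 else 0)

/-- The value of `dx^{qrs}` on the basis vectors with indices `b, c, d`, as an integer. -/
def minor3 (q r s b c d : Fin 8) : ℤ :=
  (if b = q then minor2 r s c d else 0) - (if b = r then minor2 q s c d else 0)
    + (if b = s then minor2 q r c d else 0)

/-- The value of `dx^{pqrs}` on the basis vectors with indices `a, b, c, d`, in a form that can be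
evaluated by computation. -/
def minor4 (p q r s a b c d : Fin 8) : ℤ :=
  (if a = p then minor3 q r s b c d else 0) - (if a = q then minor3 p r s b c d else 0)
    + (if a = r then minor3 p q s b c d else 0) - (if a = s then minor3 p q r b c d else 0)

/-- The components of the Cayley form, in a form that can be evaluated by computation. -/
def cayleyInt (a b c d : Fin 8) : ℤ :=
  minor4 0 1 2 3 a b c d - minor4 0 1 4 5 a b c d - minor4 0 1 6 7 a b c d - minor4 0 2 4 6 a b c d
    - minor4 0 2 7 5 a b c d - minor4 0 3 4 7 a b c d - minor4 0 3 5 6 a b c d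
    + minor4 4 5 6 7 a b c d - minor4 1 2 4 7 a b c d - minor4 1 2 5 6 a b c d
    - minor4 2 3 4 5 a b c d - minor4 2 3 6 7 a b c d - minor4 3 1 4 6 a b c d
    - minor4 3 1 7 5 a b c d

theorem dx_single (p q r s a b c d : Fin 8) :
    dx p q r s (fun j => Pi.single (![a, b, c, d] j) 1) = (minor4 p q r s a b c d : ℝ) := by
  obtain ⟨δ, h, h'⟩ : ∃ δ : Fin 8 → Fin 8 → ℝ, (∀ i j, (Pi.single i 1 : Fin 8 → ℝ) j = δ i j) ∧
      ∀ (i j) (x : ℝ), (if i = j then x else 0) = δ i j * x := by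
    refine ⟨fun i j => if i = j then 1 else 0, fun i j => ?_, fun i j x => ?_⟩
    · rw [Pi.single_apply]
      simp only [eq_comm]
    · by_cases hij : i = j <;> simp [hij]
  rw [dx_eq]
  simp only [minor4, minor3, minor2]
  push_cast
  simp only [h, h']
  ring

theorem cayleyComp_eq (a b c d : Fin 8) : cayleyComp ![a, b, c, d] = cayleyInt a b c d := by
  simp only [cayleyComp, cayley0, dx_single, cayleyInt]
  push_cast
  rfl

/-- The sign `(-1)^k`, where `k` of the indices `a, b, c, d` are not smaller than `e`. For the
sorted blocks `{a, b, c, d}` and its complement, the product of these signs over the complement is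
the sign of the permutation that lists first the one and then the other block. -/
def crossSign (a b c d e : Fin 8) : ℤ :=
  (if a < e then 1 else -1) * (if b < e then 1 else -1) * (if c < e then 1 else -1)
    * (if d < e then 1 else -1)

set_option synthInstance.maxSize 2000 in
set_option synthInstance.maxHeartbeats 400000 in
/-- The self-duality of the Cayley form for sorted index blocks. The conditions that restrict the
indices are interleaved with the quantifiers to keep the enumeration short. -/
theorem cayleyInt_selfDual : ∀ a b : Fin 8, a < b → ∀ c, b < c → ∀ d, c < d →
    ∀ e, e ≠ a → e ≠ b → e ≠ c → e ≠ d → ∀ f, f ≠ a → f ≠ b → f ≠ c → f ≠ d → e < f →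
    ∀ g, g ≠ a → g ≠ b → g ≠ c → g ≠ d → f < g → ∀ h, h ≠ a → h ≠ b → h ≠ c → h ≠ d → g < h →
    cayleyInt a b c d = crossSign a b c d e * crossSign a b c d f * crossSign a b c d g
      * crossSign a b c d h * cayleyInt e f g h := by
  decide +kernel

/-- The permutation of `Fin 8` that acts by `ρ` on the first four and by `ρ'` on the last four
indices. -/
def blockPerm (ρ ρ' : Equiv.Perm (Fin 4)) : Equiv.Perm (Fin 8) :=
  finSumFinEquiv.permCongr (Equiv.Perm.sumCongr ρ ρ')

theorem sign_blockPerm (ρ ρ' : Equiv.Perm (Fin 4)) :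
    Equiv.Perm.sign (blockPerm ρ ρ') = Equiv.Perm.sign ρ * Equiv.Perm.sign ρ' := by
  rw [blockPerm, Equiv.Perm.sign_permCongr, Equiv.Perm.sign_sumCongr]

theorem blockPerm_castAdd (ρ ρ' : Equiv.Perm (Fin 4)) (k : Fin 4) :
    blockPerm ρ ρ' (Fin.castAdd 4 k) = Fin.castAdd 4 (ρ k) := by
  exact congrArg (fun x => finSumFinEquiv (Sum.map ρ ρ' x)) (finSumFinEquiv_symm_apply_castAdd k)

theorem blockPerm_natAdd (ρ ρ' : Equiv.Perm (Fin 4)) (k : Fin 4) :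
    blockPerm ρ ρ' (Fin.natAdd 4 k) = Fin.natAdd 4 (ρ' k) := by
  exact congrArg (fun x => finSumFinEquiv (Sum.map ρ ρ' x)) (finSumFinEquiv_symm_apply_natAdd k)

theorem exists_strictMono_comp_perm {α : Fin 4 → Fin 8} (hα : Function.Injective α) :
    ∃ ρ : Equiv.Perm (Fin 4), StrictMono (α ∘ ρ) :=
  ⟨Tuple.sort α, (Tuple.monotone_sort α).strictMono_of_injective
    (hα.comp (Tuple.sort α).injective)⟩

theorem sign_eq_crossSign (π : Equiv.Perm (Fin 8))
    (h1 : StrictMono fun k : Fin 4 => π (Fin.castAdd 4 k))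
    (h2 : StrictMono fun k : Fin 4 => π (Fin.natAdd 4 k)) :
    ((Equiv.Perm.sign π : ℤˣ) : ℤ) = crossSign (π 0) (π 1) (π 2) (π 3) (π 4)
      * crossSign (π 0) (π 1) (π 2) (π 3) (π 5) * crossSign (π 0) (π 1) (π 2) (π 3) (π 6)
      * crossSign (π 0) (π 1) (π 2) (π 3) (π 7) := by
  have a1 : π 0 < π 1 := h1 (by decide : (0 : Fin 4) < 1)
  have a2 : π 1 < π 2 := h1 (by decide : (1 : Fin 4) < 2)
  have a3 : π 2 < π 3 := h1 (by decide : (2 : Fin 4) < 3)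
  have b1 : π 4 < π 5 := h2 (by decide : (0 : Fin 4) < 1)
  have b2 : π 5 < π 6 := h2 (by decide : (1 : Fin 4) < 2)
  have b3 : π 6 < π 7 := h2 (by decide : (2 : Fin 4) < 3)
  have i1 : Finset.Iio (1 : Fin 8) = {0} := by decide
  have i2 : Finset.Iio (2 : Fin 8) = {0, 1} := by decide
  have i3 : Finset.Iio (3 : Fin 8) = {0, 1, 2} := by decide
  have i4 : Finset.Iio (4 : Fin 8) = {0, 1, 2, 3} := by decide
  have i5 : Finset.Iio (5 : Fin 8) = {0, 1, 2, 3, 4} := by decide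
  have i6 : Finset.Iio (6 : Fin 8) = {0, 1, 2, 3, 4, 5} := by decide
  have i7 : Finset.Iio (7 : Fin 8) = {0, 1, 2, 3, 4, 5, 6} := by decide
  have i0 : Finset.Iio (0 : Fin 8) = ∅ := by decide
  rw [Equiv.Perm.sign_eq_prod_prod_Iio]
  obtain ⟨s, hs, hs', h1⟩ : ∃ s : Fin 8 → Fin 8 → ℤˣ,
      (∀ i j, (if π i < π j then (1 : ℤˣ) else -1) = s i j) ∧
      (∀ i j, (if π i < π j then (1 : ℤ) else -1) = s i j) ∧ ∀ i j, π i < π j → s i j = 1 := by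
    refine ⟨_, fun _ _ => rfl, fun i j => ?_, fun i j h => if_pos h⟩
    split_ifs <;> rfl
  simp only [Fin.prod_univ_eight, i0, i1, i2, i3, i4, i5, i6, i7, hs, crossSign, hs']
  simp only [Finset.prod_empty, Finset.prod_singleton, Finset.prod_insert, Finset.mem_insert,
    Finset.mem_singleton, Fin.reduceEq, or_false, not_false_eq_true, h1 _ _ a1, h1 _ _ a2, h1 _ _ a3,
    h1 _ _ b1, h1 _ _ b2, h1 _ _ b3, h1 _ _ (a1.trans a2), h1 _ _ (a2.trans a3),
    h1 _ _ ((a1.trans a2).trans a3), h1 _ _ (b1.trans b2), h1 _ _ (b2.trans b3),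
    h1 _ _ ((b1.trans b2).trans b3)]
  push_cast
  ring

/-- The standard Cayley form is self-dual. -/
theorem cayleyComp_selfDual (π : Equiv.Perm (Fin 8)) :
    cayleyComp (fun k => π (Fin.castAdd 4 k))
      = ((Equiv.Perm.sign π : ℤ) : ℝ) * cayleyComp (fun k => π (Fin.natAdd 4 k)) := by
  -- the sorted case is a finite computation
  have key : ∀ π : Equiv.Perm (Fin 8), StrictMono (fun k : Fin 4 => π (Fin.castAdd 4 k)) →
      StrictMono (fun k : Fin 4 => π (Fin.natAdd 4 k)) →
      cayleyComp (fun k => π (Fin.castAdd 4 k))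
        = ((Equiv.Perm.sign π : ℤ) : ℝ) * cayleyComp (fun k => π (Fin.natAdd 4 k)) := by
    intro π h1 h2
    have e1 : (fun k => π (Fin.castAdd 4 k)) = ![π 0, π 1, π 2, π 3] := by
      funext k; fin_cases k <;> rfl
    have e2 : (fun k => π (Fin.natAdd 4 k)) = ![π 4, π 5, π 6, π 7] := by
      funext k; fin_cases k <;> rfl
    rw [sign_eq_crossSign π h1 h2, e1, e2, cayleyComp_eq, cayleyComp_eq]
    have hne : ∀ i j : Fin 8, i ≠ j → π i ≠ π j := fun i j h => π.injective.ne h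
    rw [cayleyInt_selfDual (π 0) (π 1) (h1 (by decide : (0 : Fin 4) < 1)) (π 2)
      (h1 (by decide : (1 : Fin 4) < 2)) (π 3) (h1 (by decide : (2 : Fin 4) < 3))
      (π 4) (hne _ _ (by decide)) (hne _ _ (by decide)) (hne _ _ (by decide)) (hne _ _ (by decide))
      (π 5) (hne _ _ (by decide)) (hne _ _ (by decide)) (hne _ _ (by decide)) (hne _ _ (by decide))
      (h2 (by decide : (0 : Fin 4) < 1))
      (π 6) (hne _ _ (by decide)) (hne _ _ (by decide)) (hne _ _ (by decide)) (hne _ _ (by decide))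
      (h2 (by decide : (1 : Fin 4) < 2))
      (π 7) (hne _ _ (by decide)) (hne _ _ (by decide)) (hne _ _ (by decide)) (hne _ _ (by decide))
      (h2 (by decide : (2 : Fin 4) < 3))]
    push_cast
    rfl
  obtain ⟨ρ, hρ⟩ := exists_strictMono_comp_perm (α := fun k => π (Fin.castAdd 4 k))
    (π.injective.comp (Fin.castAdd_injective 4 4))
  obtain ⟨ρ', hρ'⟩ := exists_strictMono_comp_perm (α := fun k => π (Fin.natAdd 4 k))
    (π.injective.comp (Fin.natAdd_injective 4 4))
  have h1 : (fun k => (π * blockPerm ρ ρ') (Fin.castAdd 4 k))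
      = (fun k => π (Fin.castAdd 4 k)) ∘ ρ := by
    funext k
    exact congrArg π (blockPerm_castAdd ρ ρ' k)
  have h2 : (fun k => (π * blockPerm ρ ρ') (Fin.natAdd 4 k))
      = (fun k => π (Fin.natAdd 4 k)) ∘ ρ' := by
    funext k
    exact congrArg π (blockPerm_natAdd ρ ρ' k)
  have h3 := key (π * blockPerm ρ ρ') (by rwa [h1]) (by rwa [h2])
  rw [h1, h2, cayleyComp_comp_perm, cayleyComp_comp_perm, Equiv.Perm.sign_mul, sign_blockPerm] at h3
  rcases Int.units_eq_one_or (Equiv.Perm.sign ρ) with h | h <;>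
  rcases Int.units_eq_one_or (Equiv.Perm.sign ρ') with h' | h' <;>
  · rw [h, h'] at h3
    simp only [mul_one, one_mul, mul_neg, neg_mul, neg_neg, Units.val_neg, Units.val_one,
      Int.cast_neg, Int.cast_one] at h3
    linarith

/-- The permutation of `Fin 8` that lists first the complement of the positions `0`, `1`, `i + 2`
and `i.succAbove j + 2`, and then these positions. -/
theorem exists_perm_complement (i : Fin 6) (j : Fin 5) : ∃ π : Equiv.Perm (Fin 8),
    (∀ k, π (Fin.castAdd 4 k) = (i.succAbove (j.succAbove k)).natAdd 2) ∧
    (∀ k, π (Fin.natAdd 4 k) = ![0, 1, i.natAdd 2, (i.succAbove j).natAdd 2] k) ∧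
    ((Equiv.Perm.sign π : ℤ)) = (-1) ^ ((i : ℕ) + (j : ℕ)) := by
  revert i j
  have hinj : ∀ (i : Fin 6) (j : Fin 5), Function.Injective
      (Fin.append (fun k => ((i.succAbove (j.succAbove k)).natAdd 2 : Fin 8))
        (![0, 1, i.natAdd 2, (i.succAbove j).natAdd 2] : Fin 4 → Fin 8)) := by
    decide +kernel
  have hsign : ∀ (i : Fin 6) (j : Fin 5), (∏ b : Fin 8, ∏ a ∈ Finset.Iio b,
      if (Fin.append (fun k => ((i.succAbove (j.succAbove k)).natAdd 2 : Fin 8))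
        (![0, 1, i.natAdd 2, (i.succAbove j).natAdd 2] : Fin 4 → Fin 8)) a
        < (Fin.append (fun k => ((i.succAbove (j.succAbove k)).natAdd 2 : Fin 8))
        (![0, 1, i.natAdd 2, (i.succAbove j).natAdd 2] : Fin 4 → Fin 8)) b then (1 : ℤ) else -1)
        = (-1) ^ ((i : ℕ) + (j : ℕ)) := by
    decide +kernel
  intro i j
  refine ⟨Equiv.ofBijective _ (Finite.injective_iff_bijective.1 (hinj i j)), fun k => ?_,
    fun k => ?_, ?_⟩
  · rw [Equiv.ofBijective_apply]
    exact Fin.append_left (m := 4) (n := 4) _ _ k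
  · rw [Equiv.ofBijective_apply]
    exact Fin.append_right (m := 4) (n := 4) _ _ k
  · rw [Equiv.Perm.sign_eq_prod_prod_Iio, ← hsign i j]
    simp only [Units.coe_prod]
    refine Finset.prod_congr rfl fun b _ => Finset.prod_congr rfl fun a _ => ?_
    simp only [Equiv.ofBijective_apply]
    split_ifs <;> rfl

/-- Drop the first two terms of a double sum over `Fin 8` that do not contribute. -/
theorem sum_sum_eq_sum_succAbove {Y : Type*} [AddCommMonoid Y] (G : Fin 8 → Fin 8 → Y)
    (hd : ∀ a, G a a = 0) (h0 : ∀ a, G 0 a = 0) (h1 : ∀ a, G 1 a = 0) (h0' : ∀ a, G a 0 = 0)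
    (h1' : ∀ a, G a 1 = 0) :
    ∑ a, ∑ b, G a b = ∑ i : Fin 6, ∑ j : Fin 5, G (i.natAdd 2) ((i.succAbove j).natAdd 2) := by
  have hs : ∀ i : Fin 6, (i.natAdd 2 : Fin 8) = i.succ.succ := by decide
  have h1s : ∀ b, G (Fin.succ 0) b = 0 := h1
  have h1s' : ∀ a, G a (Fin.succ 0) = 0 := h1'
  simp only [hs]
  rw [Fin.sum_univ_succ (n := 7), Fin.sum_univ_succ (n := 6)]
  simp only [h0, h1s, Finset.sum_const_zero, zero_add]
  refine Finset.sum_congr rfl fun i _ => ?_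
  rw [Fin.sum_univ_succ, Fin.sum_univ_succ, h0', h1s', zero_add, zero_add,
    Fin.sum_univ_succAbove _ i, hd, zero_add]

/-- The equation `*F = -F ∧ Θ` in an oriented orthonormal frame in which `Θ` is the standard Cayley
form: by the self-duality of `Θ` it is the linear equation `F_ab = -½ Θ_abcd F_cd`. -/
theorem star_eq_neg_wedge_iff {V : Type*} {Y : Type*} [AddCommGroup Y] [Module ℝ Y]
    (F : V → V → Y) (Θ : (Fin 4 → V) → ℝ) (e : Fin 8 → V)
    (hF : ∀ a, F (e a) (e a) = 0) (hΘ : ∀ k : Fin 4 → Fin 8, Θ (fun j => e (k j)) = cayleyComp k)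
    (σ : Equiv.Perm (Fin 8)) :
    ((Equiv.Perm.sign σ : ℤ) : ℝ) • F (e (σ 0)) (e (σ 1))
        = -wedge2 F Θ (fun k : Fin 6 => e (σ (k.natAdd 2))) ↔
      F (e (σ 0)) (e (σ 1))
        = -((2⁻¹ : ℝ) • ∑ c, ∑ d, cayleyComp ![σ 0, σ 1, c, d] • F (e c) (e d)) := by
  set s : ℝ := ((Equiv.Perm.sign σ : ℤ) : ℝ) with hs
  have hs2 : s * s = 1 := by
    rcases Int.units_eq_one_or (Equiv.Perm.sign σ) with h | h <;> simp [hs, h]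
  have h1 : wedge2 F Θ (fun k : Fin 6 => e (σ (k.natAdd 2)))
      = s • ((2⁻¹ : ℝ) • ∑ c, ∑ d, cayleyComp ![σ 0, σ 1, c, d] • F (e c) (e d)) := by
    rw [wedge2, smul_comm s]
    congr 1
    rw [← Equiv.sum_comp σ]
    simp_rw [← Equiv.sum_comp σ (fun d => cayleyComp ![σ 0, σ 1, _, d] • F (e _) (e d))]
    rw [sum_sum_eq_sum_succAbove
      (fun a b => cayleyComp ![σ 0, σ 1, σ a, σ b] • F (e (σ a)) (e (σ b)))
      (fun a => by simp [hF])
      (fun a => by rw [cayleyComp_eq_zero (i := 0) (j := 2) rfl (by decide), zero_smul])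
      (fun a => by rw [cayleyComp_eq_zero (i := 1) (j := 2) rfl (by decide), zero_smul])
      (fun a => by rw [cayleyComp_eq_zero (i := 0) (j := 3) rfl (by decide), zero_smul])
      (fun a => by rw [cayleyComp_eq_zero (i := 1) (j := 3) rfl (by decide), zero_smul])]
    rw [Finset.smul_sum]
    refine Finset.sum_congr rfl fun i _ => ?_
    rw [Finset.smul_sum]
    refine Finset.sum_congr rfl fun j _ => ?_
    obtain ⟨π, hπ1, hπ2, hπ3⟩ := exists_perm_complement i j
    have h2 := cayleyComp_selfDual (σ * π)
    simp only [Equiv.Perm.coe_mul, Function.comp, hπ1, hπ2, Equiv.Perm.sign_mul, Units.val_mul,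
      hπ3] at h2
    have h3 : (fun k => σ (![0, 1, i.natAdd 2, (i.succAbove j).natAdd 2] k))
        = ![σ 0, σ 1, σ (i.natAdd 2), σ ((i.succAbove j).natAdd 2)] := by
      funext k; fin_cases k <;> rfl
    rw [h3] at h2
    rw [hΘ (fun k => σ ((i.succAbove (j.succAbove k)).natAdd 2)), h2, smul_smul]
    congr 1
    push_cast
    rw [← hs]
    have h4 : ((-1 : ℝ) ^ ((i : ℕ) + (j : ℕ))) * (-1) ^ ((i : ℕ) + (j : ℕ)) = 1 := by
      rw [← mul_pow]; norm_num
    linear_combination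
      (s * cayleyComp ![σ 0, σ 1, σ (i.natAdd 2), σ ((i.succAbove j).natAdd 2)]) * h4
  rw [h1]
  constructor
  · intro h
    have := congrArg (s • ·) h
    simpa only [smul_neg, smul_smul s s, hs2, one_smul] using this
  · intro h
    rw [h, smul_neg]

/-! ### The instanton equation in adapted coordinates -/

theorem cayleyAlt_swap (u v x y : Fin 8 → ℝ) :
    cayleyAlt ![u, v, x, y] = cayleyAlt ![x, y, u, v] := by
  have h := cayleyAlt.map_perm ![u, v, x, y] (Equiv.swap 0 2 * Equiv.swap 1 3)
  have e : (![u, v, x, y] ∘ (Equiv.swap 0 2 * Equiv.swap 1 3 : Equiv.Perm (Fin 4)))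
      = ![x, y, u, v] := by
    funext k; fin_cases k <;> rfl
  rw [e, Equiv.Perm.sign_mul, Equiv.Perm.sign_swap (by decide),
    Equiv.Perm.sign_swap (by decide)] at h
  simpa using h.symm

/-- The Cayley form as a bilinear form in its last two arguments. -/
def cayleyBilin (u v : Fin 8 → ℝ) : (Fin 8 → ℝ) →ₗ[ℝ] (Fin 8 → ℝ) →ₗ[ℝ] ℝ :=
  have h2 : ∀ x y, Function.update ![u, v, 0, y] 2 x = ![u, v, x, y] := fun x y => by
    funext k; fin_cases k <;> rfl
  have h3 : ∀ x y, Function.update ![u, v, x, 0] 3 y = ![u, v, x, y] := fun x y => by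
    funext k; fin_cases k <;> rfl
  LinearMap.mk₂ ℝ (fun x y => cayleyAlt ![u, v, x, y])
    (fun x x' y => by
      have := cayleyAlt.map_update_add ![u, v, 0, y] 2 x x'
      rwa [h2, h2, h2] at this)
    (fun a x y => by
      have := cayleyAlt.map_update_smul ![u, v, 0, y] 2 a x
      rwa [h2, h2] at this)
    (fun x y y' => by
      have := cayleyAlt.map_update_add ![u, v, x, 0] 3 y y'
      rwa [h3, h3, h3] at this)
    (fun a x y => by
      have := cayleyAlt.map_update_smul ![u, v, x, 0] 3 a y
      rwa [h3, h3] at this)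

theorem cayleyBilin_apply (u v x y : Fin 8 → ℝ) :
    cayleyBilin u v x y = cayley0 ![u, v, x, y] := by
  rw [← cayleyAlt_apply]; rfl

theorem cayleyBilin_swap (u v x y : Fin 8 → ℝ) : cayleyBilin u v x y = cayleyBilin x y u v := by
  rw [cayleyBilin_apply, cayleyBilin_apply, ← cayleyAlt_apply, ← cayleyAlt_apply, cayleyAlt_swap]

section Frames

variable {Y : Type*} [AddCommGroup Y] [Module ℝ Y]

/-- The trace of a bilinear map is the same in all orthonormal frames. -/
theorem sum_bilin_orthonormal (P : (Fin 8 → ℝ) →ₗ[ℝ] (Fin 8 → ℝ) →ₗ[ℝ] Y) (m : Fin 8 → Fin 8 → ℝ)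
    (hm : ∀ a b, m a ⬝ᵥ m b = if a = b then 1 else 0) :
    ∑ c, P (m c) (m c) = ∑ k, P (Pi.single k 1) (Pi.single k 1) := by
  have h1 : (Matrix.of m).transpose * Matrix.of m = 1 := by
    rw [mul_eq_one_comm]
    ext a b
    rw [Matrix.one_apply, ← hm a b]
    rfl
  have h2 : ∀ k l, ∑ c, m c k * m c l = if k = l then 1 else 0 := by
    intro k l
    have := congrFun (congrFun h1 k) l
    rw [Matrix.one_apply] at this
    rw [← this]
    rfl
  have h3 : ∀ c, P (m c) (m c)
      = ∑ k, ∑ l, (m c k * m c l) • P (Pi.single k 1) (Pi.single l 1) := by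
    intro c
    conv_lhs => rw [pi_eq_sum_univ' (m c)]
    simp only [map_sum, map_smul, LinearMap.sum_apply, LinearMap.smul_apply, Finset.smul_sum,
      smul_smul]
    rw [Finset.sum_comm]
    exact Finset.sum_congr rfl fun k _ => Finset.sum_congr rfl fun l _ => by rw [mul_comm]
  simp_rw [h3]
  rw [Finset.sum_comm]
  refine Finset.sum_congr rfl fun k _ => ?_
  rw [Finset.sum_comm]
  simp_rw [← Finset.sum_smul, h2, ite_smul, one_smul, zero_smul]
  simp

/-- If the linear equation `F_ab = -½ Θ_abcd F_cd` holds in the standard frame, then it holds in all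
orthonormal frames in which `Θ` has its standard form. -/
theorem eq_contraction_of_orthonormal (F : (Fin 8 → ℝ) →ₗ[ℝ] (Fin 8 → ℝ) →ₗ[ℝ] Y)
    (hF : ∀ a b, F (Pi.single a 1) (Pi.single b 1)
      = -((2⁻¹ : ℝ) • ∑ c, ∑ d, cayleyComp ![a, b, c, d] • F (Pi.single c 1) (Pi.single d 1)))
    (m : Fin 8 → Fin 8 → ℝ) (hm : ∀ a b, m a ⬝ᵥ m b = if a = b then 1 else 0)
    (hc : ∀ k : Fin 4 → Fin 8, cayley0 (fun j => m (k j)) = cayleyComp k) (a b : Fin 8) :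
    F (m a) (m b) = -((2⁻¹ : ℝ) • ∑ c, ∑ d, cayleyComp ![a, b, c, d] • F (m c) (m d)) := by
  set E : Fin 8 → Fin 8 → ℝ := fun k => Pi.single k 1 with hE
  have hvec : ∀ (w : Fin 8 → Fin 8 → ℝ) (a b c d : Fin 8),
      (fun j => w (![a, b, c, d] j)) = ![w a, w b, w c, w d] := by
    intro w a b c d
    funext k; fin_cases k <;> rfl
  have hcm : ∀ c d, cayleyComp ![a, b, c, d] = cayleyBilin (m a) (m b) (m c) (m d) := by
    intro c d
    rw [cayleyBilin_apply, ← hc, hvec]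
  have hcE : ∀ a b c d, cayleyComp ![a, b, c, d] = cayleyBilin (E c) (E d) (E a) (E b) := by
    intro a b c d
    rw [cayleyBilin_swap, cayleyBilin_apply, ← hvec E]
    rfl
  -- the contraction is independent of the frame
  have h1 : ∑ c, ∑ d, cayleyComp ![a, b, c, d] • F (m c) (m d)
      = ∑ k, ∑ l, cayleyBilin (E k) (E l) (m a) (m b) • F (E k) (E l) := by
    have e1 : ∀ c, ∑ d, cayleyComp ![a, b, c, d] • F (m c) (m d)
        = ∑ l, cayleyBilin (m a) (m b) (m c) (E l) • F (m c) (E l) := by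
      intro c
      simp_rw [hcm]
      have := sum_bilin_orthonormal
        ((cayleyBilin (m a) (m b) (m c)).smulRight (F (m c))) m hm
      simpa using this
    simp_rw [e1]
    rw [Finset.sum_comm]
    rw [Finset.sum_comm (f := fun k l => cayleyBilin (E k) (E l) (m a) (m b) • F (E k) (E l))]
    refine Finset.sum_congr rfl fun l _ => ?_
    have := sum_bilin_orthonormal
      (((cayleyBilin (m a) (m b)).flip (E l)).smulRight (F.flip (E l))) m hm
    simp only [LinearMap.smulRight_apply, LinearMap.smul_apply, LinearMap.flip_apply] at this
    rw [this]
    refine Finset.sum_congr rfl fun k _ => ?_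
    rw [cayleyBilin_swap]
  -- both sides are bilinear in the first two arguments
  have h2 : F = -((2⁻¹ : ℝ) • ∑ k, ∑ l,
      (cayleyBilin (E k) (E l)).compr₂ (LinearMap.toSpanSingleton ℝ Y (F (E k) (E l)))) := by
    refine LinearMap.ext_basis (Pi.basisFun ℝ (Fin 8)) (Pi.basisFun ℝ (Fin 8)) fun i j => ?_
    simp only [Pi.basisFun_apply, LinearMap.neg_apply, LinearMap.smul_apply, LinearMap.sum_apply,
      LinearMap.compr₂_apply, LinearMap.toSpanSingleton_apply]
    rw [hF i j]
    simp_rw [hcE]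
    rfl
  rw [h1]
  conv_lhs => rw [h2]
  simp only [LinearMap.neg_apply, LinearMap.smul_apply, LinearMap.sum_apply,
    LinearMap.compr₂_apply, LinearMap.toSpanSingleton_apply]

end Frames

/-- The 2-form `dx^p ∧ dx^q` on `ℝ⁸`. -/
def pairForm (p q : Fin 8) : (Fin 8 → ℝ) →ₗ[ℝ] (Fin 8 → ℝ) →ₗ[ℝ] ℝ :=
  LinearMap.mk₂ ℝ (fun w w' => w p * w' q - w' p * w q)
    (fun _ _ _ => by simp only [Pi.add_apply]; ring)
    (fun _ _ _ => by simp only [Pi.smul_apply, smul_eq_mul]; ring)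
    (fun _ _ _ => by simp only [Pi.add_apply]; ring)
    (fun _ _ _ => by simp only [Pi.smul_apply, smul_eq_mul]; ring)

theorem pairForm_apply (p q : Fin 8) (w w' : Fin 8 → ℝ) :
    pairForm p q w w' = w p * w' q - w' p * w q := rfl

theorem sum_cayleyComp_mul_pairForm (a b p q : Fin 8) :
    ∑ c, ∑ d, cayleyComp ![a, b, c, d] * pairForm p q (Pi.single c 1) (Pi.single d 1)
      = 2 * cayleyComp ![a, b, p, q] := by
  have h : cayleyComp ![a, b, q, p] = -cayleyComp ![a, b, p, q] := by
    have := cayleyComp_comp_perm ![a, b, p, q] (Equiv.swap 2 3)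
    rw [Equiv.Perm.sign_swap (by decide)] at this
    have e : (![a, b, p, q] ∘ (Equiv.swap 2 3 : Equiv.Perm (Fin 4))) = ![a, b, q, p] := by
      funext k; fin_cases k <;> rfl
    rw [e] at this
    simpa using this
  simp only [pairForm_apply, Pi.single_apply, mul_sub, Finset.sum_sub_distrib]
  simp [h]
  ring

/-- The curvature of a radial connection in adapted coordinates: the `T_i`-component is
`α dx^0 ∧ dx^i + β dx^j ∧ dx^k + γ Ω_i`, where `Ω_i` are the self-dual forms on the last four
coordinates. -/
def radialForm (α β γ : ℝ) : (Fin 8 → ℝ) →ₗ[ℝ] (Fin 8 → ℝ) →ₗ[ℝ] ℍ[ℝ] :=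
  (α • pairForm 0 1 + β • pairForm 2 3 + γ • (pairForm 4 5 + pairForm 6 7)).compr₂
      (LinearMap.toSpanSingleton ℝ ℍ[ℝ] (T 0))
    + (α • pairForm 0 2 + β • pairForm 3 1 + γ • (pairForm 4 6 + pairForm 7 5)).compr₂
      (LinearMap.toSpanSingleton ℝ ℍ[ℝ] (T 1))
    + (α • pairForm 0 3 + β • pairForm 1 2 + γ • (pairForm 4 7 + pairForm 5 6)).compr₂
      (LinearMap.toSpanSingleton ℝ ℍ[ℝ] (T 2))

theorem radialForm_apply (α β γ : ℝ) (w w' : Fin 8 → ℝ) : radialForm α β γ w w' =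
    (α * pairForm 0 1 w w' + β * pairForm 2 3 w w' + γ * (pairForm 4 5 w w' + pairForm 6 7 w w'))
        • T 0
    + (α * pairForm 0 2 w w' + β * pairForm 3 1 w w'
        + γ * (pairForm 4 6 w w' + pairForm 7 5 w w')) • T 1
    + (α * pairForm 0 3 w w' + β * pairForm 1 2 w w'
        + γ * (pairForm 4 7 w w' + pairForm 5 6 w w')) • T 2 := by
  simp only [radialForm, LinearMap.add_apply, LinearMap.smul_apply, LinearMap.compr₂_apply,
    LinearMap.toSpanSingleton_apply, smul_eq_mul]

theorem radialForm_self (α β γ : ℝ) (w : Fin 8 → ℝ) : radialForm α β γ w w = 0 := by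
  have h : ∀ p q, pairForm p q w w = 0 := fun p q => by rw [pairForm_apply]; ring
  simp [radialForm_apply, h]

theorem sum_cayleyComp_smul_radialForm (α β γ : ℝ) (a b : Fin 8) :
    (2⁻¹ : ℝ) • ∑ c, ∑ d, cayleyComp ![a, b, c, d]
        • radialForm α β γ (Pi.single c 1) (Pi.single d 1)
      = (α * cayleyComp ![a, b, 0, 1] + β * cayleyComp ![a, b, 2, 3]
          + γ * (cayleyComp ![a, b, 4, 5] + cayleyComp ![a, b, 6, 7])) • T 0
      + (α * cayleyComp ![a, b, 0, 2] + β * cayleyComp ![a, b, 3, 1]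
          + γ * (cayleyComp ![a, b, 4, 6] + cayleyComp ![a, b, 7, 5])) • T 1
      + (α * cayleyComp ![a, b, 0, 3] + β * cayleyComp ![a, b, 1, 2]
          + γ * (cayleyComp ![a, b, 4, 7] + cayleyComp ![a, b, 5, 6])) • T 2 := by
  have key : ∀ (p q p' q' p'' q'' p₃ q₃ : Fin 8) (τ : ℍ[ℝ]),
      (2⁻¹ : ℝ) • ∑ c, ∑ d, cayleyComp ![a, b, c, d]
        • ((α * pairForm p q (Pi.single c 1) (Pi.single d 1)
          + β * pairForm p' q' (Pi.single c 1) (Pi.single d 1)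
          + γ * (pairForm p'' q'' (Pi.single c 1) (Pi.single d 1)
            + pairForm p₃ q₃ (Pi.single c 1) (Pi.single d 1))) • τ)
      = (α * cayleyComp ![a, b, p, q] + β * cayleyComp ![a, b, p', q']
          + γ * (cayleyComp ![a, b, p'', q''] + cayleyComp ![a, b, p₃, q₃])) • τ := by
    intro p q p' q' p'' q'' p₃ q₃ τ
    simp_rw [smul_smul, ← Finset.sum_smul, smul_smul]
    congr 1
    simp_rw [mul_add, mul_left_comm _ α, mul_left_comm _ β, mul_left_comm _ γ,
      Finset.sum_add_distrib, ← Finset.mul_sum, sum_cayleyComp_mul_pairForm]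
    ring
  simp_rw [radialForm_apply, smul_add, Finset.sum_add_distrib, smul_add]
  rw [key, key, key]

/-- The components of `dx^p ∧ dx^q`, in a form that can be evaluated by computation. -/
def pairInt (p q a b : Fin 8) : ℤ :=
  (if a = p then if b = q then 1 else 0 else 0) - (if b = p then if a = q then 1 else 0 else 0)

theorem pairForm_single (p q a b : Fin 8) :
    pairForm p q (Pi.single a 1) (Pi.single b 1) = pairInt p q a b := by
  simp only [pairForm_apply, Pi.single_apply, pairInt]
  push_cast
  simp only [eq_comm (a := p), eq_comm (a := q)]
  split_ifs <;> simp

/-- In the standard frame the linear equation holds for the curvature of a radial connection if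
`α + β = 2 γ`. -/
theorem radialForm_single_eq {α β γ : ℝ} (h : α + β = 2 * γ) (a b : Fin 8) :
    radialForm α β γ (Pi.single a 1) (Pi.single b 1)
      = -((2⁻¹ : ℝ) • ∑ c, ∑ d, cayleyComp ![a, b, c, d]
        • radialForm α β γ (Pi.single c 1) (Pi.single d 1)) := by
  have hα : α = 2 * γ - β := by linarith
  -- the coefficients of `β` and of `γ` in the three components of the equation
  have key : ∀ p q p' q' p'' q'' p₃ q₃ : Fin 8, ((pairInt p' q' a b - pairInt p q a b
        = -(cayleyInt a b p' q' - cayleyInt a b p q)) ∧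
      (2 * pairInt p q a b + (pairInt p'' q'' a b + pairInt p₃ q₃ a b)
        = -(2 * cayleyInt a b p q + (cayleyInt a b p'' q'' + cayleyInt a b p₃ q₃)))) →
      α * pairForm p q (Pi.single a 1) (Pi.single b 1)
        + β * pairForm p' q' (Pi.single a 1) (Pi.single b 1)
        + γ * (pairForm p'' q'' (Pi.single a 1) (Pi.single b 1)
          + pairForm p₃ q₃ (Pi.single a 1) (Pi.single b 1))
      = -(α * cayleyComp ![a, b, p, q] + β * cayleyComp ![a, b, p', q']
          + γ * (cayleyComp ![a, b, p'', q''] + cayleyComp ![a, b, p₃, q₃])) := by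
    intro p q p' q' p'' q'' p₃ q₃ ⟨h1, h2⟩
    have h1' := congrArg (Int.cast : ℤ → ℝ) h1
    have h2' := congrArg (Int.cast : ℤ → ℝ) h2
    push_cast at h1' h2'
    simp only [pairForm_single, cayleyComp_eq, hα]
    linear_combination β * h1' + γ * h2'
  have c0 : ∀ a b : Fin 8, (pairInt 2 3 a b - pairInt 0 1 a b
        = -(cayleyInt a b 2 3 - cayleyInt a b 0 1)) ∧
      (2 * pairInt 0 1 a b + (pairInt 4 5 a b + pairInt 6 7 a b)
        = -(2 * cayleyInt a b 0 1 + (cayleyInt a b 4 5 + cayleyInt a b 6 7))) := by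
    decide +kernel
  have c1 : ∀ a b : Fin 8, (pairInt 3 1 a b - pairInt 0 2 a b
        = -(cayleyInt a b 3 1 - cayleyInt a b 0 2)) ∧
      (2 * pairInt 0 2 a b + (pairInt 4 6 a b + pairInt 7 5 a b)
        = -(2 * cayleyInt a b 0 2 + (cayleyInt a b 4 6 + cayleyInt a b 7 5))) := by
    decide +kernel
  have c2 : ∀ a b : Fin 8, (pairInt 1 2 a b - pairInt 0 3 a b
        = -(cayleyInt a b 1 2 - cayleyInt a b 0 3)) ∧
      (2 * pairInt 0 3 a b + (pairInt 4 7 a b + pairInt 5 6 a b)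
        = -(2 * cayleyInt a b 0 3 + (cayleyInt a b 4 7 + cayleyInt a b 5 6))) := by
    decide +kernel
  rw [sum_cayleyComp_smul_radialForm, radialForm_apply, key _ _ _ _ _ _ _ _ (c0 a b),
    key _ _ _ _ _ _ _ _ (c1 a b), key _ _ _ _ _ _ _ _ (c2 a b)]
  module

/-- The components with indices `0`, `1` of the linear equation give back `α + β = 2 γ`. -/
theorem add_eq_of_radialForm_single {α β γ : ℝ}
    (h : radialForm α β γ (Pi.single 0 1) (Pi.single 1 1)
      = -((2⁻¹ : ℝ) • ∑ c, ∑ d, cayleyComp ![0, 1, c, d]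
        • radialForm α β γ (Pi.single c 1) (Pi.single d 1))) : α + β = 2 * γ := by
  rw [sum_cayleyComp_smul_radialForm, radialForm_apply] at h
  have h1 := congrArg (fun q : ℍ[ℝ] => q.imI) h
  have e1 : pairInt 0 1 0 1 = 1 := by decide
  have e2 : pairInt 2 3 0 1 = 0 := by decide
  have e3 : pairInt 4 5 0 1 = 0 := by decide
  have e4 : pairInt 6 7 0 1 = 0 := by decide
  have f1 : cayleyInt 0 1 0 1 = 0 := by decide
  have f2 : cayleyInt 0 1 2 3 = 1 := by decide
  have f3 : cayleyInt 0 1 4 5 = -1 := by decide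
  have f4 : cayleyInt 0 1 6 7 = -1 := by decide
  have t0 : (T 0).imI = 1 := rfl
  have t1 : (T 1).imI = 0 := rfl
  have t2 : (T 2).imI = 0 := rfl
  simp only [Quaternion.imI_add, Quaternion.imI_neg, Quaternion.imI_smul, t0, t1, t2,
    pairForm_single, cayleyComp_eq, e1, e2, e3, e4, f1, f2, f3, f4, smul_eq_mul] at h1
  norm_num at h1
  linarith

/-! ### Exterior derivatives and curvature in charts -/

section Charts

variable {E H M F : Type*} [NormedAddCommGroup E] [NormedSpace ℝ E] [TopologicalSpace H]
  {I : ModelWithCorners ℝ E H} [TopologicalSpace M] [ChartedSpace H M]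
  [NormedAddCommGroup F] [NormedSpace ℝ F]

theorem mdifferentiableAt_extChartAt_symm [I.Boundaryless] [IsManifold I 1 M] (p : M) {y : E}
    (hy : y ∈ (extChartAt I p).target) : MDifferentiableAt 𝓘(ℝ, E) I (extChartAt I p).symm y := by
  have := mdifferentiableWithinAt_extChartAt_symm (I := I) hy
  rwa [I.range_eq_univ, mdifferentiableWithinAt_univ] at this

theorem chartForm_apply (α : ∀ p : M, TangentSpace I p →L[ℝ] F) (p : M) (y v : E) :
    chartForm I α p y v
      = α ((extChartAt I p).symm y) (mfderiv 𝓘(ℝ, E) I (extChartAt I p).symm y v) := rfl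

/-- At the base point of the preferred chart the chart is the identity on the tangent space. -/
theorem chartForm_self [I.Boundaryless] [IsManifold I 1 M] (α : ∀ p : M, TangentSpace I p →L[ℝ] F)
    (p : M) (v : E) : chartForm I α p (extChartAt I p p) v = α p v := by
  have h := mfderivWithin_range_extChartAt_symm (I := I) (x := p)
  rw [I.range_eq_univ, mfderivWithin_univ] at h
  have h1 : mfderiv 𝓘(ℝ, E) I (extChartAt I p).symm (extChartAt I p p) v = v :=
    congrArg (fun f : E →L[ℝ] E => f v) h
  have h2 : ∀ q : M, q = p → α q (v : E) = α p (v : E) := by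
    rintro q rfl; rfl
  rw [chartForm_apply]
  exact (congrArg _ h1).trans (h2 _ (extChartAt_to_inv p))

/-- A smooth 1-form is smooth in charts. -/
theorem contDiffOn_chartForm [I.Boundaryless] [IsManifold I ∞ M] [IsManifold I 1 M]
    [FiniteDimensional ℝ E]
    {α : ∀ p : M, TangentSpace I p →L[ℝ] F} (hα : SmoothFormOn I α univ) (p : M) :
    ContDiffOn ℝ ∞ (chartForm I α p) (extChartAt I p).target := by
  have ho : IsOpen (extChartAt I p).target := isOpen_extChartAt_target p
  rw [contDiffOn_clm_apply]
  intro v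
  have h1 : ContMDiffOn 𝓘(ℝ, E).tangent I.tangent ∞
      (tangentMapWithin 𝓘(ℝ, E) I (extChartAt I p).symm (extChartAt I p).target)
      (Bundle.TotalSpace.proj ⁻¹' (extChartAt I p).target) :=
    (contMDiffOn_extChartAt_symm (I := I) (n := ∞) p).contMDiffOn_tangentMapWithin le_rfl
      ho.uniqueMDiffOn
  have h2 : ContMDiff 𝓘(ℝ, E) 𝓘(ℝ, E).tangent ∞
      (fun y : E => (⟨y, v⟩ : TangentBundle 𝓘(ℝ, E) E)) :=
    contMDiff_vectorSpace_iff_contDiff.2 contDiff_const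
  have hα' : ContMDiff I.tangent 𝓘(ℝ, F) ∞ (fun w : TangentBundle I M => α w.1 w.2) := by
    rw [← contMDiffOn_univ]
    simpa [SmoothFormOn] using hα
  have h3 := hα'.comp_contMDiffOn (h1.comp h2.contMDiffOn (s := (extChartAt I p).target)
    (fun y hy => hy))
  rw [← contMDiffOn_iff_contDiffOn]
  refine h3.congr fun y hy => ?_
  have hd := mdifferentiableAt_extChartAt_symm (I := I) p hy
  simp only [Function.comp, tangentMapWithin, chartForm_apply]
  rw [mfderivWithin_of_mem_nhds (ho.mem_nhds hy)]
  rfl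

theorem differentiableAt_chartForm [I.Boundaryless] [IsManifold I ∞ M] [IsManifold I 1 M]
    [FiniteDimensional ℝ E]
    {α : ∀ p : M, TangentSpace I p →L[ℝ] F} (hα : SmoothFormOn I α univ) (p : M) :
    DifferentiableAt ℝ (chartForm I α p) (extChartAt I p p) :=
  ((contDiffOn_chartForm hα p).contDiffAt
    ((isOpen_extChartAt_target p).mem_nhds (mem_extChartAt_target p))).differentiableAt (by simp)

end Charts

section Radial

variable {X : Type*} [TopologicalSpace X] [ChartedSpace (EuclideanSpace ℝ (Fin 7)) X]
  [IsManifold I7 ∞ X]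

instance : IsManifold I7 1 X := IsManifold.of_le (n := ∞) (by simp)

namespace ThreeSasakian

variable (S : ThreeSasakian X)

theorem ηT_apply (p : X) (v : TangentSpace I7 p) : S.ηT p v = ∑ i, S.η i p v • T i := by
  simp [ηT]

theorem chartForm_ηT (p : X) : chartForm I7 S.ηT p
    = fun y => ∑ i, (chartForm I7 (S.η i) p y).smulRight (T i) := by
  funext y
  ext1 v
  rw [chartForm_apply, ηT_apply, sum_apply]
  rfl

theorem hasFDerivAt_chartForm_ηT (p : X) :
    HasFDerivAt (chartForm I7 S.ηT p)
      (∑ i, ((ContinuousLinearMap.smulRightL ℝ (EuclideanSpace ℝ (Fin 7)) ℍ[ℝ]).flip (T i)).comp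
        (fderiv ℝ (chartForm I7 (S.η i) p) (extChartAt I7 p p))) (extChartAt I7 p p) := by
  rw [chartForm_ηT]
  exact HasFDerivAt.fun_sum (u := Finset.univ) fun i _ =>
    ((ContinuousLinearMap.smulRightL ℝ (EuclideanSpace ℝ (Fin 7)) ℍ[ℝ]).flip
      (T i)).hasFDerivAt.comp _ (differentiableAt_chartForm (S.η_smooth i) p).hasFDerivAt

theorem fderiv_chartForm_ηT (p : X) (u v : EuclideanSpace ℝ (Fin 7)) :
    fderiv ℝ (chartForm I7 S.ηT p) (extChartAt I7 p p) u v
      = ∑ i, fderiv ℝ (chartForm I7 (S.η i) p) (extChartAt I7 p p) u v • T i := by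
  rw [(S.hasFDerivAt_chartForm_ηT p).fderiv, sum_apply, sum_apply]
  rfl

theorem extD_ηT (p : X) (u v : TangentSpace I7 p) :
    extD I7 S.ηT p u v = ∑ i, extD I7 (S.η i) p u v • T i := by
  simp only [extD, sub_smul, Finset.sum_sub_distrib]
  exact congrArg₂ (· - ·) (S.fderiv_chartForm_ηT p u v) (S.fderiv_chartForm_ηT p v u)

theorem chartForm_radial (x : ℝ → ℝ) (z : ℝ × X) {y : ℝ × EuclideanSpace ℝ (Fin 7)}
    (hy : y ∈ (extChartAt I8 z).target) :
    chartForm I8 (S.radial x) z y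
      = x y.1 • (chartForm I7 S.ηT z.2 y.2).comp
          (ContinuousLinearMap.snd ℝ ℝ (EuclideanSpace ℝ (Fin 7))) := by
  have hd := mdifferentiableAt_extChartAt_symm (I := I8) z hy
  have hy' := hy
  rw [extChartAt_prod] at hy'
  have hd7 := mdifferentiableAt_extChartAt_symm (I := I7) z.2 hy'.2
  have e : ∀ y, (extChartAt I8 z).symm y = (y.1, (extChartAt I7 z.2).symm y.2) := by
    intro y
    rw [extChartAt_prod]
    rfl
  -- the chain rule for `snd ∘ chart⁻¹ = chart⁻¹ ∘ snd`
  have h1 : mfderiv 𝓘(ℝ, ℝ × EuclideanSpace ℝ (Fin 7)) I7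
      (Prod.snd ∘ (extChartAt I8 z).symm) y = _ :=
    mfderiv_comp (I' := I8) (I'' := I7) y (g := Prod.snd) mdifferentiableAt_snd hd
  have h2 : mfderiv 𝓘(ℝ, ℝ × EuclideanSpace ℝ (Fin 7)) I7
      ((extChartAt I7 z.2).symm ∘ Prod.snd) y = _ :=
    mfderiv_comp (I' := I7) (I'' := I7) y (f := Prod.snd) hd7
      differentiableAt_snd.mdifferentiableAt
  have h3 : (Prod.snd ∘ (extChartAt I8 z).symm : ℝ × EuclideanSpace ℝ (Fin 7) → X)
      = (extChartAt I7 z.2).symm ∘ Prod.snd := by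
    funext y
    simp only [Function.comp, e]
  rw [h3, h2] at h1
  refine ContinuousLinearMap.ext fun w => ?_
  have h5 : mfderiv I8 I7 (Prod.snd : ℝ × X → X) ((extChartAt I8 z).symm y)
      = ContinuousLinearMap.snd ℝ ℝ (EuclideanSpace ℝ (Fin 7)) := mfderiv_snd
  have h6 : mfderiv 𝓘(ℝ, ℝ × EuclideanSpace ℝ (Fin 7)) I7
      (Prod.snd : ℝ × EuclideanSpace ℝ (Fin 7) → EuclideanSpace ℝ (Fin 7)) y
      = ContinuousLinearMap.snd ℝ ℝ (EuclideanSpace ℝ (Fin 7)) := by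
    rw [mfderiv_eq_fderiv]
    exact fderiv_snd
  rw [h5, h6] at h1
  have h4 : mfderiv 𝓘(ℝ, EuclideanSpace ℝ (Fin 7)) I7 (extChartAt I7 z.2).symm y.2 w.2
      = (mfderiv 𝓘(ℝ, ℝ × EuclideanSpace ℝ (Fin 7)) I8 (extChartAt I8 z).symm y w :
        ℝ × EuclideanSpace ℝ (Fin 7)).2 :=
    congrArg (fun f : ℝ × EuclideanSpace ℝ (Fin 7) →L[ℝ] EuclideanSpace ℝ (Fin 7) => f w) h1
  have h7 : ∀ q : ℝ × X, q = (y.1, (extChartAt I7 z.2).symm y.2) →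
      ∀ v : EuclideanSpace ℝ (Fin 7), x q.1 • S.ηT q.2 v
        = x y.1 • S.ηT ((extChartAt I7 z.2).symm y.2) v := by
    rintro q rfl v
    rfl
  refine (h7 _ (e y) _).trans ?_
  exact congrArg (fun v : EuclideanSpace ℝ (Fin 7) =>
    x y.1 • S.ηT ((extChartAt I7 z.2).symm y.2) v) h4.symm

/-- The curvature of the radial connection `x(r) ∑ η_i ⊗ T_i`. -/
theorem curvature_radial {x : ℝ → ℝ} {x' : ℝ} {z : ℝ × X} (hx : HasDerivAt x x' z.1)
    (u v : ℝ × EuclideanSpace ℝ (Fin 7)) :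
    curvature I8 (S.radial x) z u v
      = x' • (u.1 • S.ηT z.2 v.2 - v.1 • S.ηT z.2 u.2) + x z.1 • extD I7 S.ηT z.2 u.2 v.2
        + x z.1 ^ 2 • (S.ηT z.2 u.2 * S.ηT z.2 v.2 - S.ηT z.2 v.2 * S.ηT z.2 u.2) := by
  set y₀ : ℝ × EuclideanSpace ℝ (Fin 7) := extChartAt I8 z z with hy₀
  have hy1 : y₀ = (z.1, extChartAt I7 z.2 z.2) := by
    rw [hy₀, extChartAt_prod]
    rfl
  have hev : chartForm I8 (S.radial x) z =ᶠ[𝓝 y₀] fun y => x y.1 • (chartForm I7 S.ηT z.2 y.2).comp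
      (ContinuousLinearMap.snd ℝ ℝ (EuclideanSpace ℝ (Fin 7))) := by
    filter_upwards [(isOpen_extChartAt_target z).mem_nhds (mem_extChartAt_target (I := I8) z)]
      with y hy
    exact S.chartForm_radial x z hy
  have h1 : HasFDerivAt (fun y : ℝ × EuclideanSpace ℝ (Fin 7) => x y.1)
      (x' • ContinuousLinearMap.fst ℝ ℝ (EuclideanSpace ℝ (Fin 7))) y₀ := by
    rw [hy1]
    exact HasDerivAt.comp_hasFDerivAt
      (f := (Prod.fst : ℝ × EuclideanSpace ℝ (Fin 7) → ℝ)) (z.1, extChartAt I7 z.2 z.2) hx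
      hasFDerivAt_fst
  have h2 : HasFDerivAt (fun y : ℝ × EuclideanSpace ℝ (Fin 7) =>
      (chartForm I7 S.ηT z.2 y.2).comp (ContinuousLinearMap.snd ℝ ℝ (EuclideanSpace ℝ (Fin 7))))
      (((ContinuousLinearMap.compL ℝ (ℝ × EuclideanSpace ℝ (Fin 7)) (EuclideanSpace ℝ (Fin 7))
        ℍ[ℝ]).flip (ContinuousLinearMap.snd ℝ ℝ (EuclideanSpace ℝ (Fin 7)))).comp
        ((fderiv ℝ (chartForm I7 S.ηT z.2) (extChartAt I7 z.2 z.2)).comp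
          (ContinuousLinearMap.snd ℝ ℝ (EuclideanSpace ℝ (Fin 7))))) y₀ := by
    have h3 : HasFDerivAt (fun y : ℝ × EuclideanSpace ℝ (Fin 7) => chartForm I7 S.ηT z.2 y.2)
        ((fderiv ℝ (chartForm I7 S.ηT z.2) (extChartAt I7 z.2 z.2)).comp
          (ContinuousLinearMap.snd ℝ ℝ (EuclideanSpace ℝ (Fin 7)))) y₀ := by
      rw [hy1]
      exact HasFDerivAt.comp (g := chartForm I7 S.ηT z.2)
        (f := (Prod.snd : ℝ × EuclideanSpace ℝ (Fin 7) → EuclideanSpace ℝ (Fin 7)))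
        (z.1, extChartAt I7 z.2 z.2) (S.hasFDerivAt_chartForm_ηT z.2).differentiableAt.hasFDerivAt
        hasFDerivAt_snd
    exact ((ContinuousLinearMap.compL ℝ (ℝ × EuclideanSpace ℝ (Fin 7))
      (EuclideanSpace ℝ (Fin 7)) ℍ[ℝ]).flip
        (ContinuousLinearMap.snd ℝ ℝ (EuclideanSpace ℝ (Fin 7)))).hasFDerivAt.comp y₀ h3
  have h4 : ∀ u v : ℝ × EuclideanSpace ℝ (Fin 7),
      fderiv ℝ (chartForm I8 (S.radial x) z) y₀ u v
        = x z.1 • fderiv ℝ (chartForm I7 S.ηT z.2) (extChartAt I7 z.2 z.2) u.2 v.2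
          + (x' * u.1) • S.ηT z.2 v.2 := by
    intro u v
    rw [hev.fderiv_eq, (h1.fun_smul h2).fderiv]
    have h5 := chartForm_self S.ηT z.2 v.2
    have e1 : y₀.1 = z.1 := by rw [hy1]
    have e2 : y₀.2 = extChartAt I7 z.2 z.2 := by rw [hy1]
    rw [← h5, ← e1, ← e2]
    rfl
  have h5 : curvature I8 (S.radial x) z u v
      = (fderiv ℝ (chartForm I8 (S.radial x) z) y₀ u v
        - fderiv ℝ (chartForm I8 (S.radial x) z) y₀ v u)
        + ((x z.1 • S.ηT z.2 u.2) * (x z.1 • S.ηT z.2 v.2)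
          - (x z.1 • S.ηT z.2 v.2) * (x z.1 • S.ηT z.2 u.2)) := rfl
  have h6 : extD I7 S.ηT z.2 u.2 v.2
      = fderiv ℝ (chartForm I7 S.ηT z.2) (extChartAt I7 z.2 z.2) u.2 v.2
        - fderiv ℝ (chartForm I7 S.ηT z.2) (extChartAt I7 z.2 z.2) v.2 u.2 := rfl
  rw [h5, h6, h4, h4]
  simp only [smul_mul_smul_comm]
  module

end ThreeSasakian
end Radial

/-! ### The instanton equation for radial connections -/

section Wedge

variable {V : Type*}

theorem wedge1_form1 (α β : V → ℝ) (v : Fin 2 → V) :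
    wedge1 α (form1 β) v = wedge11 α β (v 0) (v 1) := by
  simp [wedge1, form1, wedge11, Fin.sum_univ_succ, Fin.succAbove]
  ring

theorem wedge1_fin_two (α : V → ℝ) (β : (Fin 2 → V) → ℝ) (v : Fin 3 → V) :
    wedge1 α β v = α (v 0) * β ![v 1, v 2] - α (v 1) * β ![v 0, v 2]
      + α (v 2) * β ![v 0, v 1] := by
  have h : ∀ i : Fin 3, (fun k : Fin 2 => v (i.succAbove k))
      = ![v (i.succAbove 0), v (i.succAbove 1)] := by
    intro i; funext k; fin_cases k <;> rfl
  refine (Fin.sum_univ_three (fun i : Fin 3 =>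
    (-1 : ℝ) ^ (i : ℕ) * (α (v i) * β (fun k => v (i.succAbove k))))).trans ?_
  simp only [h]
  change (-1) ^ 0 * (_ * β ![v 1, v 2]) + (-1) ^ 1 * (_ * β ![v 0, v 2])
    + (-1) ^ 2 * (_ * β ![v 0, v 1]) = _
  ring

theorem wedge1_fin_three (α : V → ℝ) (β : (Fin 3 → V) → ℝ) (v : Fin 4 → V) :
    wedge1 α β v = α (v 0) * β ![v 1, v 2, v 3] - α (v 1) * β ![v 0, v 2, v 3]
      + α (v 2) * β ![v 0, v 1, v 3] - α (v 3) * β ![v 0, v 1, v 2] := by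
  have h : ∀ i : Fin 4, (fun k : Fin 3 => v (i.succAbove k))
      = ![v (i.succAbove 0), v (i.succAbove 1), v (i.succAbove 2)] := by
    intro i; funext k; fin_cases k <;> rfl
  refine (Fin.sum_univ_four (fun i : Fin 4 =>
    (-1 : ℝ) ^ (i : ℕ) * (α (v i) * β (fun k => v (i.succAbove k))))).trans ?_
  simp only [h]
  change (-1) ^ 0 * (_ * β ![v 1, v 2, v 3]) + (-1) ^ 1 * (_ * β ![v 0, v 2, v 3])
    + (-1) ^ 2 * (_ * β ![v 0, v 1, v 3]) + (-1) ^ 3 * (_ * β ![v 0, v 1, v 2]) = _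
  ring

theorem wedge2_self_form2 (o : V → V → ℝ) (ho : ∀ u v, o u v = -o v u) (v : Fin 4 → V) :
    wedge2 o (form2 o) v
      = 2 * (o (v 0) (v 1) * o (v 2) (v 3) - o (v 0) (v 2) * o (v 1) (v 3)
        + o (v 0) (v 3) * o (v 1) (v 2)) := by
  have key : wedge2 o (form2 o) v = (2⁻¹ : ℝ) • ∑ i : Fin 4, ∑ j : Fin 3,
      ((-1 : ℝ) ^ ((i : ℕ) + (j : ℕ)) * o (v (i.succAbove (j.succAbove (0 : Fin 2))))
        (v (i.succAbove (j.succAbove (1 : Fin 2))))) • o (v i) (v (i.succAbove j)) := rfl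
  rw [key, Fin.sum_univ_four]
  simp only [Fin.sum_univ_three]
  change (2⁻¹ : ℝ) • (((-1 : ℝ) ^ 0 * o (v 2) (v 3)) • o (v 0) (v 1)
      + ((-1 : ℝ) ^ 1 * o (v 1) (v 3)) • o (v 0) (v 2)
      + ((-1 : ℝ) ^ 2 * o (v 1) (v 2)) • o (v 0) (v 3)
    + (((-1 : ℝ) ^ 1 * o (v 2) (v 3)) • o (v 1) (v 0)
      + ((-1 : ℝ) ^ 2 * o (v 0) (v 3)) • o (v 1) (v 2)
      + ((-1 : ℝ) ^ 3 * o (v 0) (v 2)) • o (v 1) (v 3))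
    + (((-1 : ℝ) ^ 2 * o (v 1) (v 3)) • o (v 2) (v 0)
      + ((-1 : ℝ) ^ 3 * o (v 0) (v 3)) • o (v 2) (v 1)
      + ((-1 : ℝ) ^ 4 * o (v 0) (v 1)) • o (v 2) (v 3))
    + (((-1 : ℝ) ^ 3 * o (v 1) (v 2)) • o (v 3) (v 0)
      + ((-1 : ℝ) ^ 4 * o (v 0) (v 2)) • o (v 3) (v 1)
      + ((-1 : ℝ) ^ 5 * o (v 0) (v 1)) • o (v 3) (v 2))) = _
  rw [ho (v 1) (v 0), ho (v 2) (v 0), ho (v 3) (v 0), ho (v 2) (v 1), ho (v 3) (v 1),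
    ho (v 3) (v 2)]
  simp only [smul_eq_mul]
  ring

/-- The Spin(7)-form of a cohomogeneity-one metric is the Cayley form in adapted coordinates. -/
theorem cayley0_eq_wedge (ρ h₁ h₂ h₃ e₀ e₁ e₂ e₃ : V → ℝ) (o₁ o₂ o₃ : V → V → ℝ)
    (ho₁ : ∀ u v, o₁ u v = e₀ u * e₁ v - e₀ v * e₁ u + (e₂ u * e₃ v - e₂ v * e₃ u))
    (ho₂ : ∀ u v, o₂ u v = e₀ u * e₂ v - e₀ v * e₂ u + (e₃ u * e₁ v - e₃ v * e₁ u))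
    (ho₃ : ∀ u v, o₃ u v = e₀ u * e₃ v - e₀ v * e₃ u + (e₁ u * e₂ v - e₁ v * e₂ u))
    (t c : ℝ) (v : Fin 4 → V) :
    wedge1 ρ (fun w => t ^ 3 * wedge1 h₁ (wedge1 h₂ (form1 h₃)) w
        - t * c ^ 2 * (wedge1 h₁ (form2 o₁) w + wedge1 h₂ (form2 o₂) w + wedge1 h₃ (form2 o₃) w)) v
      + (c ^ 4 / 6 * (wedge2 o₁ (form2 o₁) v + wedge2 o₂ (form2 o₂) v + wedge2 o₃ (form2 o₃) v)
        - t ^ 2 * c ^ 2 * (wedge1 h₂ (wedge1 h₃ (form2 o₁)) v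
          + wedge1 h₃ (wedge1 h₁ (form2 o₂)) v + wedge1 h₁ (wedge1 h₂ (form2 o₃)) v))
      = cayley0 (fun l => ![ρ (v l), t * h₁ (v l), t * h₂ (v l), t * h₃ (v l),
          c * e₀ (v l), c * e₁ (v l), c * e₂ (v l), c * e₃ (v l)]) := by
  have a₁ : ∀ u v, o₁ u v = -o₁ v u := fun u v => by rw [ho₁, ho₁]; ring
  have a₂ : ∀ u v, o₂ u v = -o₂ v u := fun u v => by rw [ho₂, ho₂]; ring
  have a₃ : ∀ u v, o₃ u v = -o₃ v u := fun u v => by rw [ho₃, ho₃]; ring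
  rw [wedge2_self_form2 o₁ a₁, wedge2_self_form2 o₂ a₂, wedge2_self_form2 o₃ a₃]
  simp only [wedge1_fin_three, wedge1_fin_two, wedge1_form1, wedge11, form2, cayley0, dx_eq,
    ho₁, ho₂, ho₃, Matrix.cons_val]
  ring

end Wedge

namespace ThreeSasakian

variable {X : Type*} [TopologicalSpace X] [ChartedSpace (EuclideanSpace ℝ (Fin 7)) X]
  [IsManifold I7 ∞ X] (S : ThreeSasakian X)

/-- The adapted coframe `dr, t η₁, t η₂, t η₃, c e₀, …, c e₃` at a point of `ℝ × X`. -/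
def coords (p : X) (e : Fin 4 → TangentSpace I7 p →L[ℝ] ℝ) (t c : ℝ)
    (w : ℝ × EuclideanSpace ℝ (Fin 7)) : Fin 8 → ℝ :=
  ![w.1, t * S.η 0 p w.2, t * S.η 1 p w.2, t * S.η 2 p w.2,
    c * e 0 w.2, c * e 1 w.2, c * e 2 w.2, c * e 3 w.2]

theorem Θ_eq_cayley {z : ℝ × X} {e : Fin 4 → TangentSpace I7 z.2 →L[ℝ] ℝ} {t ν : ℝ → ℝ} {c : ℝ}
    (hc : c ^ 2 = S.s * ν z.1 ^ 2 / 48)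
    (he : ∀ (i : Fin 3) (u v : TangentSpace I7 z.2), omegaOf S.s S.η i z.2 u v
        = wedge11 (e 0) (e i.succ) u v + wedge11 (e (i + 1).succ) (e (i + 2).succ) u v)
    (v : Fin 4 → TangentSpace I8 z) :
    S.Θ t ν z v = cayley0 (fun l => S.coords z.2 e (t z.1) c (v l)) := by
  have h1 : t z.1 * ν z.1 ^ 2 * (S.s / 48) = t z.1 * c ^ 2 := by rw [hc]; ring
  have h2 : ν z.1 ^ 4 / 6 * (S.s / 48) ^ 2 = c ^ 4 / 6 := by
    rw [show c ^ 4 = (c ^ 2) ^ 2 by ring, hc]; ring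
  have h3 : ν z.1 ^ 2 * t z.1 ^ 2 * (S.s / 48) = t z.1 ^ 2 * c ^ 2 := by rw [hc]; ring
  have key := cayley0_eq_wedge (V := ℝ × EuclideanSpace ℝ (Fin 7)) (fun w => w.1)
    (fun w => S.η 0 z.2 w.2) (fun w => S.η 1 z.2 w.2) (fun w => S.η 2 z.2 w.2)
    (fun w => e 0 w.2) (fun w => e 1 w.2) (fun w => e 2 w.2) (fun w => e 3 w.2)
    (fun u v => S.om 0 z.2 u.2 v.2) (fun u v => S.om 1 z.2 u.2 v.2) (fun u v => S.om 2 z.2 u.2 v.2)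
    (fun u v => he 0 u.2 v.2) (fun u v => he 1 u.2 v.2) (fun u v => he 2 u.2 v.2) (t z.1) c v
  refine Eq.trans ?_ key
  simp only [Θ, φ, ψ, h1, h2, h3, Fin.sum_univ_three]
  rfl

end ThreeSasakian

theorem T_re (i : Fin 3) : (T i).re = 0 := by fin_cases i <;> rfl

theorem T_imI (i : Fin 3) : (T i).imI = ![1, 0, 0] i := by fin_cases i <;> rfl

theorem T_imJ (i : Fin 3) : (T i).imJ = ![0, 1, 0] i := by fin_cases i <;> rfl

theorem T_imK (i : Fin 3) : (T i).imK = ![0, 0, 1] i := by fin_cases i <;> rfl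

namespace ThreeSasakian

variable {X : Type*} [TopologicalSpace X] [ChartedSpace (EuclideanSpace ℝ (Fin 7)) X]
  [IsManifold I7 ∞ X] (S : ThreeSasakian X)

/-- The adapted coframe as a linear map. -/
def coordsL (p : X) (e : Fin 4 → TangentSpace I7 p →L[ℝ] ℝ) (t c : ℝ) :
    (ℝ × EuclideanSpace ℝ (Fin 7)) →ₗ[ℝ] Fin 8 → ℝ where
  toFun := S.coords p e t c
  map_add' u v := by
    have h : ∀ (f : EuclideanSpace ℝ (Fin 7) →L[ℝ] ℝ), f (u + v).2 = f u.2 + f v.2 :=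
      fun f => f.map_add _ _
    have h1 : ∀ i, S.η i p (u + v).2 = S.η i p u.2 + S.η i p v.2 := fun i => h _
    have h2 : ∀ i, e i (u + v).2 = e i u.2 + e i v.2 := fun i => h _
    simp only [coords, h1, h2]
    funext k
    fin_cases k <;> simp [mul_add]
  map_smul' a u := by
    have h : ∀ (f : EuclideanSpace ℝ (Fin 7) →L[ℝ] ℝ), f (a • u).2 = a * f u.2 :=
      fun f => f.map_smul _ _
    have h1 : ∀ i, S.η i p (a • u).2 = a * S.η i p u.2 := fun i => h _
    have h2 : ∀ i, e i (a • u).2 = a * e i u.2 := fun i => h _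
    simp only [coords, h1, h2]
    funext k
    fin_cases k <;> simp [mul_left_comm]

theorem coordsL_apply (p : X) (e : Fin 4 → TangentSpace I7 p →L[ℝ] ℝ) (t c : ℝ)
    (w : ℝ × EuclideanSpace ℝ (Fin 7)) : S.coordsL p e t c w = S.coords p e t c w := rfl

/-- The adapted coframe has a dual frame: the coframe is injective by the nondegeneracy of `η` and
`e`, and the dimensions agree. -/
theorem coordsL_bijective {p : X} {e : Fin 4 → TangentSpace I7 p →L[ℝ] ℝ} {t c : ℝ}
    (he : ∀ v, (∀ i, S.η i p v = 0) → (∀ a, e a v = 0) → v = 0) (ht : t ≠ 0) (hc : c ≠ 0) :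
    Function.Bijective (S.coordsL p e t c) := by
  have hinj : Function.Injective (S.coordsL p e t c) := by
    rw [injective_iff_map_eq_zero]
    intro w hw
    rw [coordsL_apply, coords] at hw
    have hk : ∀ k, _ = (0 : ℝ) := fun k => congrFun hw k
    have h0 := hk 0
    have h1 := hk 1
    have h2 := hk 2
    have h3 := hk 3
    have h4 := hk 4
    have h5 := hk 5
    have h6 := hk 6
    have h7 := hk 7
    simp only [Matrix.cons_val, mul_eq_zero, ht, hc, false_or] at h0 h1 h2 h3 h4 h5 h6 h7
    have hv : w.2 = 0 := by
      refine he w.2 (fun i => ?_) (fun a => ?_)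
      · fin_cases i <;> assumption
      · fin_cases a <;> assumption
    exact Prod.ext h0 hv
  refine ⟨hinj, (LinearMap.injective_iff_surjective_of_finrank_eq_finrank ?_).1 hinj⟩
  simp

/-- The metric is standard in the adapted coframe. -/
theorem g_eq_dotProduct {z : ℝ × X} {e : Fin 4 → TangentSpace I7 z.2 →L[ℝ] ℝ} {t ν : ℝ → ℝ}
    {c : ℝ} (hc : c ^ 2 = S.s * ν z.1 ^ 2 / 48)
    (he : ∀ u v, S.h z.2 u v = ∑ a, e a u * e a v) (u v : ℝ × EuclideanSpace ℝ (Fin 7)) :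
    S.g t ν z u v = S.coords z.2 e (t z.1) c u ⬝ᵥ S.coords z.2 e (t z.1) c v := by
  have h1 : S.g t ν z u v = u.1 * v.1 + t z.1 ^ 2 * ∑ i, S.η i z.2 u.2 * S.η i z.2 v.2
    + c ^ 2 * ∑ a, e a u.2 * e a v.2 := by
    rw [hc]
    exact congrArg (fun y => u.1 * v.1 + t z.1 ^ 2 * (∑ i, S.η i z.2 u.2 * S.η i z.2 v.2)
      + S.s * ν z.1 ^ 2 / 48 * y) (he u.2 v.2)
  rw [h1]
  simp only [coords, dotProduct, Fin.sum_univ_three, Fin.sum_univ_four, Fin.sum_univ_eight,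
    Matrix.cons_val]
  ring

/-- `[η, η] = 2 ∑ η_j ∧ η_k ⊗ T_i`, from the brackets of the basis of `su(2)`. -/
theorem ηT_commutator (p : X) (u v : TangentSpace I7 p) :
    S.ηT p u * S.ηT p v - S.ηT p v * S.ηT p u
      = ∑ i : Fin 3, (2 * wedge11 (S.η (i + 1) p) (S.η (i + 2) p) u v) • T i := by
  simp only [ηT_apply, Fin.sum_univ_three]
  change _ = (2 * wedge11 (S.η 1 p) (S.η 2 p) u v) • T 0
    + (2 * wedge11 (S.η 2 p) (S.η 0 p) u v) • T 1 + (2 * wedge11 (S.η 0 p) (S.η 1 p) u v) • T 2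
  simp only [wedge11]
  ext <;> simp only [Quaternion.re_sub, Quaternion.re_mul, Quaternion.re_add, Quaternion.re_smul,
    Quaternion.imI_sub, Quaternion.imI_mul, Quaternion.imI_add, Quaternion.imI_smul,
    Quaternion.imJ_sub, Quaternion.imJ_mul, Quaternion.imJ_add, Quaternion.imJ_smul,
    Quaternion.imK_sub, Quaternion.imK_mul, Quaternion.imK_add, Quaternion.imK_smul,
    T_re, T_imI, T_imJ, T_imK, Matrix.cons_val, smul_eq_mul] <;> ring

/-- The structure equation, which is the definition of the forms `ω_i`. -/
theorem extD_η (i : Fin 3) (p : X) (u v : TangentSpace I7 p) :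
    extD I7 (S.η i) p u v = -(S.s / 24) * omegaOf S.s S.η i p u v
      - 2 * wedge11 (S.η (i + 1) p) (S.η (i + 2) p) u v := by
  have := S.s_pos.ne'
  rw [omegaOf]
  field_simp
  ring

/-- The curvature of a radial connection in the adapted coframe. -/
theorem curvature_radial_eq_radialForm {x : ℝ → ℝ} {x' : ℝ} {z : ℝ × X}
    (hx : HasDerivAt x x' z.1) {e : Fin 4 → TangentSpace I7 z.2 →L[ℝ] ℝ} {t ν : ℝ → ℝ} {c : ℝ}
    (ht : t z.1 ≠ 0) (hν : ν z.1 ≠ 0) (hc : c ^ 2 = S.s * ν z.1 ^ 2 / 48)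
    (he : ∀ (i : Fin 3) (u v : TangentSpace I7 z.2), omegaOf S.s S.η i z.2 u v
        = wedge11 (e 0) (e i.succ) u v + wedge11 (e (i + 1).succ) (e (i + 2).succ) u v)
    (u v : ℝ × EuclideanSpace ℝ (Fin 7)) :
    curvature I8 (S.radial x) z u v
      = radialForm (x' / t z.1) (2 * (x z.1 ^ 2 - x z.1) / t z.1 ^ 2) (-2 * x z.1 / ν z.1 ^ 2)
          (S.coords z.2 e (t z.1) c u) (S.coords z.2 e (t z.1) c v) := by
  have hc' : S.s = 48 * c ^ 2 / ν z.1 ^ 2 := by rw [hc]; field_simp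
  rw [S.curvature_radial hx, S.extD_ηT z.2 u.2 v.2, S.ηT_commutator z.2 u.2 v.2,
    S.ηT_apply z.2 u.2, S.ηT_apply z.2 v.2, radialForm_apply]
  have o : ∀ i, extD I7 (S.η i) z.2 u.2 v.2 = -(2 * c ^ 2 / ν z.1 ^ 2) *
      (wedge11 (e 0) (e i.succ) u.2 v.2 + wedge11 (e (i + 1).succ) (e (i + 2).succ) u.2 v.2)
      - 2 * wedge11 (S.η (i + 1) z.2) (S.η (i + 2) z.2) u.2 v.2 := by
    intro i
    rw [S.extD_η i z.2 u.2 v.2, he i u.2 v.2, hc']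
    ring
  simp only [o, Fin.sum_univ_three]
  simp only [pairForm_apply, coords, Matrix.cons_val]
  change x' • (u.1 • (S.η 0 z.2 v.2 • T 0 + S.η 1 z.2 v.2 • T 1 + S.η 2 z.2 v.2 • T 2)
      - v.1 • (S.η 0 z.2 u.2 • T 0 + S.η 1 z.2 u.2 • T 1 + S.η 2 z.2 u.2 • T 2))
    + x z.1 • ((-(2 * c ^ 2 / ν z.1 ^ 2) *
        (e 0 u.2 * e 1 v.2 - e 0 v.2 * e 1 u.2 + (e 2 u.2 * e 3 v.2 - e 2 v.2 * e 3 u.2))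
        - 2 * (S.η 1 z.2 u.2 * S.η 2 z.2 v.2 - S.η 1 z.2 v.2 * S.η 2 z.2 u.2)) • T 0
      + (-(2 * c ^ 2 / ν z.1 ^ 2) *
        (e 0 u.2 * e 2 v.2 - e 0 v.2 * e 2 u.2 + (e 3 u.2 * e 1 v.2 - e 3 v.2 * e 1 u.2))
        - 2 * (S.η 2 z.2 u.2 * S.η 0 z.2 v.2 - S.η 2 z.2 v.2 * S.η 0 z.2 u.2)) • T 1
      + (-(2 * c ^ 2 / ν z.1 ^ 2) *
        (e 0 u.2 * e 3 v.2 - e 0 v.2 * e 3 u.2 + (e 1 u.2 * e 2 v.2 - e 1 v.2 * e 2 u.2))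
        - 2 * (S.η 0 z.2 u.2 * S.η 1 z.2 v.2 - S.η 0 z.2 v.2 * S.η 1 z.2 u.2)) • T 2)
    + x z.1 ^ 2 • ((2 * (S.η 1 z.2 u.2 * S.η 2 z.2 v.2 - S.η 1 z.2 v.2 * S.η 2 z.2 u.2)) • T 0
      + (2 * (S.η 2 z.2 u.2 * S.η 0 z.2 v.2 - S.η 2 z.2 v.2 * S.η 0 z.2 u.2)) • T 1
      + (2 * (S.η 0 z.2 u.2 * S.η 1 z.2 v.2 - S.η 0 z.2 v.2 * S.η 1 z.2 u.2)) • T 2) = _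
  match_scalars <;> field_simp <;> ring

/-- For a radial connection the instanton equation amounts to an ordinary differential equation for
`x` at the points of `J`. -/
theorem isInstantonOn_radial_iff [Nonempty X] {t ν x x' : ℝ → ℝ} {J : Set ℝ}
    (ht : ∀ r ∈ J, 0 < t r) (hν : ∀ r ∈ J, 0 < ν r) (hx : ∀ r ∈ J, HasDerivAt x (x' r) r) :
    S.IsInstantonOn t ν (S.radial x) J
      ↔ ∀ r ∈ J, x' r = 2 * x r * (1 - x r) / t r - 4 * x r * t r / ν r ^ 2 := by
  have hode : ∀ r ∈ J, (x' r = 2 * x r * (1 - x r) / t r - 4 * x r * t r / ν r ^ 2 ↔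
      x' r / t r + 2 * (x r ^ 2 - x r) / t r ^ 2 = 2 * (-2 * x r / ν r ^ 2)) := by
    intro r hr
    have h1 := (ht r hr).ne'
    have h2 := (hν r hr).ne'
    have e : x' r / t r + 2 * (x r ^ 2 - x r) / t r ^ 2 - 2 * (-2 * x r / ν r ^ 2)
        = (x' r - (2 * x r * (1 - x r) / t r - 4 * x r * t r / ν r ^ 2)) / t r := by
      field_simp
      ring
    rw [← sub_eq_zero, ← sub_eq_zero (b := 2 * (-2 * x r / ν r ^ 2)), e, div_eq_zero_iff]
    simp [h1]
  constructor
  · intro hI r hr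
    rw [hode r hr]
    obtain ⟨p⟩ := ‹Nonempty X›
    obtain ⟨e, he0, he1, he2⟩ := S.adapted p
    have hcpos : 0 < S.s * ν r ^ 2 / 48 := by
      have := S.s_pos
      have := hν r hr
      positivity
    have hc : √(S.s * ν r ^ 2 / 48) ^ 2 = S.s * ν r ^ 2 / 48 := Real.sq_sqrt hcpos.le
    set c := √(S.s * ν r ^ 2 / 48)
    have hc0 : c ≠ 0 := by
      rintro h; rw [h] at hc; norm_num at hc; linarith [hc, hcpos]
    have hbij := S.coordsL_bijective he0 (ht r hr).ne' hc0
    choose f hf using fun k : Fin 8 => hbij.2 (Pi.single k 1)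
    have hf' : ∀ k, S.coords p e (t r) c (f k) = Pi.single k 1 := hf
    have hΘ : ∀ k : Fin 4 → Fin 8, S.Θ t ν (r, p) (fun j => f (k j)) = cayleyComp k := by
      intro k
      refine (S.Θ_eq_cayley (z := (r, p)) hc he2 _).trans ?_
      exact congrArg cayley0 (funext fun j => hf' (k j))
    have hframe : S.IsSpin7Frame t ν (r, p) f := by
      refine ⟨fun a b => ?_, hΘ⟩
      refine (S.g_eq_dotProduct (z := (r, p)) hc he1 (f a) (f b)).trans ?_
      change S.coords p e (t r) c (f a) ⬝ᵥ S.coords p e (t r) c (f b) = _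
      rw [hf', hf', single_dotProduct, one_mul, Pi.single_apply]
    have h1 := hI (r, p) hr f hframe 1
    have hF : ∀ u v : ℝ × EuclideanSpace ℝ (Fin 7), curvature I8 (S.radial x) (r, p) u v = _ :=
      S.curvature_radial_eq_radialForm (z := (r, p)) (hx r hr) (ht r hr).ne' (hν r hr).ne' hc he2
    have h2 := (star_eq_neg_wedge_iff (curvature I8 (S.radial x) (r, p)) (S.Θ t ν (r, p)) f
      (fun a => (hF _ _).trans (radialForm_self _ _ _ _)) hΘ 1).1 h1
    have h3 : ∀ a b, curvature I8 (S.radial x) (r, p) (f a) (f b) = radialForm (x' r / t r)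
        (2 * (x r ^ 2 - x r) / t r ^ 2) (-2 * x r / ν r ^ 2) (Pi.single a 1) (Pi.single b 1) := by
      intro a b
      rw [← hf' a, ← hf' b]
      exact hF _ _
    simp only [h3] at h2
    exact add_eq_of_radialForm_single h2
  · rintro hI ⟨r, p⟩ hr f ⟨hg, hΘ⟩ σ
    have hr' : r ∈ J := hr
    have hlin := (hode r hr').1 (hI r hr')
    obtain ⟨e, he0, he1, he2⟩ := S.adapted p
    have hcpos : 0 < S.s * ν r ^ 2 / 48 := by
      have := S.s_pos
      have := hν r hr'
      positivity
    have hc : √(S.s * ν r ^ 2 / 48) ^ 2 = S.s * ν r ^ 2 / 48 := Real.sq_sqrt hcpos.le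
    set c := √(S.s * ν r ^ 2 / 48)
    have hF : ∀ u v : ℝ × EuclideanSpace ℝ (Fin 7), curvature I8 (S.radial x) (r, p) u v = _ :=
      S.curvature_radial_eq_radialForm (z := (r, p)) (hx r hr') (ht r hr').ne' (hν r hr').ne' hc he2
    refine (star_eq_neg_wedge_iff (curvature I8 (S.radial x) (r, p)) (S.Θ t ν (r, p)) f
      (fun a => (hF _ _).trans (radialForm_self _ _ _ _)) hΘ σ).2 ?_
    have h3 : ∀ a b, curvature I8 (S.radial x) (r, p) (f a) (f b) = radialForm (x' r / t r)
        (2 * (x r ^ 2 - x r) / t r ^ 2) (-2 * x r / ν r ^ 2) (S.coords p e (t r) c (f a))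
        (S.coords p e (t r) c (f b)) := fun a b => hF _ _
    simp only [h3]
    refine eq_contraction_of_orthonormal _ (radialForm_single_eq hlin)
      (fun a => S.coords p e (t r) c (f a)) (fun a b => ?_) (fun k => ?_) _ _
    · rw [← hg a b]
      exact (S.g_eq_dotProduct (z := (r, p)) hc he1 _ _).symm
    · rw [cayleyComp, ← hΘ k]
      exact (S.Θ_eq_cayley (z := (r, p)) hc he2 _).symm

/-- A radial connection is an instanton if and only if its coefficient solves the radial equation.
-/
theorem isRadialInstanton_iff [Nonempty X] {t ν x : ℝ → ℝ} {J : Set ℝ} (hJ : IsOpen J)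
    (ht : ∀ r ∈ J, 0 < t r) (hν : ∀ r ∈ J, 0 < ν r) :
    S.IsRadialInstanton t ν J x ↔ ContDiffOn ℝ ∞ x J ∧ RadialODE t ν J x := by
  refine and_congr_right fun hx => ?_
  have hd : ∀ r ∈ J, HasDerivAt x (deriv x r) r := fun r hr =>
    ((hx.contDiffAt (hJ.mem_nhds hr)).differentiableAt (by simp)).hasDerivAt
  rw [S.isInstantonOn_radial_iff ht hν hd]
  refine forall₂_congr fun r hr => ⟨fun h => ?_, fun h => (hd r hr).unique h⟩
  rw [← h]
  exact hd r hr

/-- The trivial connection is flat. -/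
theorem curvature_radial_zero {x : ℝ → ℝ} {z : ℝ × X} (hx : x =ᶠ[𝓝 z.1] 0)
    (u v : TangentSpace I8 z) : curvature I8 (S.radial x) z u v = 0 := by
  have hd : HasDerivAt x 0 z.1 := (hasDerivAt_const z.1 (0 : ℝ)).congr_of_eventuallyEq hx
  have h0 : x z.1 = 0 := hx.self_of_nhds
  refine (S.curvature_radial hd u v).trans ?_
  rw [h0]
  simp

end ThreeSasakian

/-! ### Radial connections in the gauges over `X × ℍ` -/

theorem norm_dir {q : ℍ[ℝ]} (hq : q ≠ 0) : ‖dir q‖ = 1 := by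
  rw [dir, norm_smul, norm_inv, norm_norm, inv_mul_cancel₀ (norm_ne_zero_iff.2 hq)]

theorem dir_ne_zero {q : ℍ[ℝ]} (hq : q ≠ 0) : dir q ≠ 0 := by
  rw [← norm_ne_zero_iff, norm_dir hq]
  exact one_ne_zero

theorem dir_mul_of_norm_eq_one (q : ℍ[ℝ]) {u : ℍ[ℝ]} (hu : ‖u‖ = 1) : dir (q * u) = dir q * u := by
  rw [dir, dir, norm_mul, hu, mul_one, smul_mul_assoc]

theorem dir_mul_of_norm_eq_one_left (q : ℍ[ℝ]) {u : ℍ[ℝ]} (hu : ‖u‖ = 1) :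
    dir (u * q) = u * dir q := by
  rw [dir, dir, norm_mul, hu, one_mul, mul_smul_comm]

theorem dir_smul {c : ℝ} (hc : 0 < c) (q : ℍ[ℝ]) : dir (c • q) = dir q := by
  rw [dir, dir, norm_smul, Real.norm_of_nonneg hc.le, smul_smul]
  congr 1
  field_simp

theorem eq_re_add_smul_T (ξ : ℍ[ℝ]) :
    ξ = ξ.re • (1 : ℍ[ℝ]) + ξ.imI • T 0 + ξ.imJ • T 1 + ξ.imK • T 2 := by
  ext <;> simp only [Quaternion.re_add, Quaternion.imI_add, Quaternion.imJ_add,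
    Quaternion.imK_add, Quaternion.re_smul, Quaternion.imI_smul, Quaternion.imJ_smul,
    Quaternion.imK_smul, T_re, T_imI, T_imJ, T_imK, Matrix.cons_val, smul_eq_mul,
    Quaternion.re_one, Quaternion.imI_one, Quaternion.imJ_one, Quaternion.imK_one] <;> ring

theorem im_eq_smul_T (ξ : ℍ[ℝ]) : ξ.im = ξ.imI • T 0 + ξ.imJ • T 1 + ξ.imK • T 2 := by
  ext <;> simp only [Quaternion.re_add, Quaternion.imI_add, Quaternion.imJ_add,
    Quaternion.imK_add, Quaternion.re_smul, Quaternion.imI_smul, Quaternion.imJ_smul,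
    Quaternion.imK_smul, T_re, T_imI, T_imJ, T_imK, Matrix.cons_val, smul_eq_mul,
    Quaternion.re_im, Quaternion.imI_im, Quaternion.imJ_im, Quaternion.imK_im] <;> ring

/-- The one-parameter subgroup of `SU(2)` generated by `T j`. -/
def rot (j : Fin 3) (τ : ℝ) : ℍ[ℝ] := (Real.cos τ : ℍ[ℝ]) + Real.sin τ • T j

theorem T_mul_self (j : Fin 3) : T j * T j = -1 := by
  fin_cases j <;> ext <;> simp only [Quaternion.re_mul, Quaternion.imI_mul, Quaternion.imJ_mul,
    Quaternion.imK_mul, T_re, T_imI, T_imJ, T_imK, Matrix.cons_val, Quaternion.re_neg,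
    Quaternion.imI_neg, Quaternion.imJ_neg, Quaternion.imK_neg, Quaternion.re_one,
    Quaternion.imI_one, Quaternion.imJ_one, Quaternion.imK_one, Fin.reduceFinMk] <;> norm_num

theorem star_T (j : Fin 3) : star (T j) = -T j := by
  rw [Quaternion.star_eq_neg, T_re]

theorem rot_zero (j : Fin 3) : rot j 0 = 1 := by simp [rot]

theorem rot_mul_T (j : Fin 3) (τ : ℝ) :
    rot j τ * T j = -(Real.sin τ : ℍ[ℝ]) + Real.cos τ • T j := by
  rw [rot, add_mul, Quaternion.coe_mul_eq_smul, smul_mul_assoc, T_mul_self, smul_neg, add_comm,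
    ← Quaternion.coe_mul_eq_smul (Real.sin τ) 1, mul_one]

theorem T_mul_rot (j : Fin 3) (τ : ℝ) : T j * rot j τ = rot j τ * T j := by
  rw [rot, add_mul, mul_add, Quaternion.coe_commutes, smul_mul_assoc, mul_smul_comm]

theorem hasDerivAt_rot (j : Fin 3) (τ : ℝ) : HasDerivAt (rot j) (rot j τ * T j) τ := by
  rw [rot_mul_T]
  have h1 : HasDerivAt (fun τ : ℝ => (Real.cos τ) • (1 : ℍ[ℝ])) ((-Real.sin τ) • (1 : ℍ[ℝ])) τ :=
    (Real.hasDerivAt_cos τ).smul_const _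
  have h2 : HasDerivAt (fun τ : ℝ => (Real.sin τ) • T j) ((Real.cos τ) • T j) τ :=
    (Real.hasDerivAt_sin τ).smul_const _
  have e : rot j = (fun τ : ℝ => (Real.cos τ) • (1 : ℍ[ℝ])) + fun τ : ℝ => (Real.sin τ) • T j := by
    funext τ
    rw [rot, Pi.add_apply, ← Quaternion.coe_mul_eq_smul (Real.cos τ) 1, mul_one]
  rw [e]
  refine (h1.add h2).congr_deriv ?_
  rw [← Quaternion.coe_mul_eq_smul (-Real.sin τ) 1, mul_one, Quaternion.coe_neg]

theorem norm_rot (j : Fin 3) (τ : ℝ) : ‖rot j τ‖ = 1 := by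
  have h1 : ‖rot j τ‖ * ‖rot j τ‖ = 1 := by
    have h2 := Real.cos_sq_add_sin_sq τ
    rw [← Quaternion.normSq_eq_norm_mul_self, Quaternion.normSq_def', rot]
    simp only [Quaternion.re_add, Quaternion.imI_add, Quaternion.imJ_add, Quaternion.imK_add,
      Quaternion.re_smul, Quaternion.imI_smul, Quaternion.imJ_smul, Quaternion.imK_smul,
      Quaternion.re_coe, Quaternion.imI_coe, Quaternion.imJ_coe, Quaternion.imK_coe,
      T_re, T_imI, T_imJ, T_imK]
    fin_cases j <;> simp [h2]
  nlinarith [norm_nonneg (rot j τ)]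

/-- The derivative of `q ↦ q / |q|`. -/
theorem fderiv_dir_mul_inv {q : ℍ[ℝ]} (hq : q ≠ 0) (ζ : ℍ[ℝ]) :
    fderiv ℝ dir q ζ * (dir q)⁻¹ = (ζ * q⁻¹).im := by
  have hd : DifferentiableAt ℝ dir q := by
    have : DifferentiableAt ℝ (fun q : ℍ[ℝ] => ‖q‖⁻¹ • q) q :=
      ((differentiableAt_id.norm ℝ hq).inv (norm_ne_zero_iff.2 hq)).smul differentiableAt_id
    exact this
  -- the radial direction
  have h0 : fderiv ℝ dir q q = 0 := by
    have hγ : HasDerivAt (fun s : ℝ => s • q) q 1 := by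
      simpa using (hasDerivAt_id (1 : ℝ)).smul_const q
    have h1 := hd.hasFDerivAt.comp_hasDerivAt_of_eq (1 : ℝ) hγ (by simp)
    refine h1.unique ((hasDerivAt_const (1 : ℝ) (dir q)).congr_of_eventuallyEq ?_)
    filter_upwards [lt_mem_nhds (zero_lt_one' ℝ)] with s hs
    exact dir_smul hs q
  -- the directions of the left action of `SU(2)`
  have hj : ∀ j, fderiv ℝ dir q (T j * q) = T j * dir q := by
    intro j
    have hγ : HasDerivAt (fun τ : ℝ => rot j τ * q) (T j * q) 0 := by
      simpa [rot_zero] using (hasDerivAt_rot j 0).mul_const q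
    have h1 := hd.hasFDerivAt.comp_hasDerivAt_of_eq (0 : ℝ) hγ (by simp [rot_zero])
    refine h1.unique ?_
    have h2 : HasDerivAt (fun τ : ℝ => rot j τ * dir q) (T j * dir q) 0 := by
      simpa [rot_zero] using (hasDerivAt_rot j 0).mul_const (dir q)
    exact h2.congr_of_eventuallyEq (Eventually.of_forall fun τ =>
      dir_mul_of_norm_eq_one_left q (norm_rot j τ))
  set ξ := ζ * q⁻¹ with hξ
  have hζ : ζ = ξ * q := by rw [hξ, mul_assoc, inv_mul_cancel₀ hq, mul_one]
  have h1 : ζ = ξ.re • q + ξ.imI • (T 0 * q) + ξ.imJ • (T 1 * q) + ξ.imK • (T 2 * q) := by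
    rw [hζ]
    conv_lhs => rw [eq_re_add_smul_T ξ]
    simp only [add_mul, smul_mul_assoc, one_mul]
  rw [h1]
  simp only [map_add, map_smul, h0, hj, smul_zero, zero_add, add_mul, smul_mul_assoc]
  simp only [mul_assoc, mul_inv_cancel₀ (dir_ne_zero hq), mul_one]
  exact (im_eq_smul_T ξ).symm

namespace ThreeSasakian

variable {X : Type*} [TopologicalSpace X] [ChartedSpace (EuclideanSpace ℝ (Fin 7)) X]
  [IsManifold I7 ∞ X] (S : ThreeSasakian X)

theorem mdifferentiableAt_act_dir (p : X) {q : ℍ[ℝ]} (hq : q ≠ 0) :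
    MDifferentiableAt I11 I7 (fun z : X × ℍ[ℝ] => S.act z.1 (dir z.2)) (p, q) :=
  (S.act_smooth.contMDiffAt ((isOpen_ne_fun continuous_snd continuous_const).mem_nhds
    hq)).mdifferentiableAt (by simp)

theorem mdifferentiableAt_orbit (p : X) {q : ℍ[ℝ]} (hq : q ≠ 0) :
    MDifferentiableAt 𝓘(ℝ, ℍ[ℝ]) I7 (fun q' : ℍ[ℝ] => S.act p (dir q')) q :=
  MDifferentiableAt.comp (I' := I11) (f := fun q' : ℍ[ℝ] => (p, q')) q
    (S.mdifferentiableAt_act_dir p hq)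
    (mdifferentiableAt_const.prodMk mdifferentiableAt_id)

/-- The connection form reproduces the generators of the action. -/
theorem ηT_fundamental (p : X) (j : Fin 3) :
    S.ηT p (mfderiv 𝓘(ℝ, ℝ) I7 (fun τ : ℝ => S.act p (rot j τ)) 0 (1 : ℝ) :
      EuclideanSpace ℝ (Fin 7)) = T j := by
  refine (S.ηT_apply p _).trans ?_
  refine (Finset.sum_congr rfl fun i _ =>
    congrArg (fun a : ℝ => a • T i) (S.η_fundamental p i j)).trans ?_
  simp

theorem ηT_equivariant {u : ℍ[ℝ]} (hu : ‖u‖ = 1) (p : X) (v : TangentSpace I7 p) :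
    S.ηT (S.act p u) (mfderiv I7 I7 (fun p' => S.act p' u) p v) = star u * S.ηT p v * u := by
  rw [ηT_apply, ηT_apply]
  exact S.η_equivariant u hu p v

/-- The connection form along the orbits of `SU(2)`. -/
theorem ηT_orbit (p : X) {q : ℍ[ℝ]} (hq : q ≠ 0) (ζ : ℍ[ℝ]) :
    S.ηT (S.act p (dir q)) (mfderiv 𝓘(ℝ, ℍ[ℝ]) I7 (fun q' : ℍ[ℝ] => S.act p (dir q')) q ζ :
      EuclideanSpace ℝ (Fin 7)) = (q⁻¹ * ζ).im := by
  set D : ℍ[ℝ] →L[ℝ] EuclideanSpace ℝ (Fin 7) :=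
    mfderiv 𝓘(ℝ, ℍ[ℝ]) I7 (fun q' : ℍ[ℝ] => S.act p (dir q')) q with hD
  have hd := S.mdifferentiableAt_orbit p hq
  -- the chain rule along a curve through `q`
  have chain : ∀ (γ : ℝ → ℍ[ℝ]) (γ' : ℍ[ℝ]) (s : ℝ), γ s = q → HasDerivAt γ γ' s →
      mfderiv 𝓘(ℝ, ℝ) I7 (fun τ => S.act p (dir (γ τ))) s (1 : ℝ) = D γ' := by
    intro γ γ' s hs hγ
    have h1 := mfderiv_comp_of_eq (I := 𝓘(ℝ, ℝ)) (x := s) (f := γ) hd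
      hγ.differentiableAt.mdifferentiableAt hs
    have h2 : mfderiv 𝓘(ℝ, ℝ) 𝓘(ℝ, ℍ[ℝ]) γ s (1 : ℝ) = γ' := by
      rw [mfderiv_eq_fderiv]
      exact (congrArg (fun f : ℝ →L[ℝ] ℍ[ℝ] => f 1) hγ.hasFDerivAt.fderiv).trans (one_smul ℝ γ')
    have h3 := congrArg (fun f : ℝ →L[ℝ] EuclideanSpace ℝ (Fin 7) => f 1) h1
    subst hs
    exact h3.trans (congrArg D h2)
  have h0 : D q = 0 := by
    have hγ : HasDerivAt (fun s : ℝ => s • q) q 1 := by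
      simpa using (hasDerivAt_id (1 : ℝ)).smul_const q
    rw [← chain _ _ 1 (one_smul ℝ q) hγ]
    have h1 : (fun s : ℝ => S.act p (dir (s • q))) =ᶠ[𝓝 1] fun _ => S.act p (dir q) := by
      filter_upwards [lt_mem_nhds (zero_lt_one' ℝ)] with s hs
      rw [dir_smul hs]
    exact congrArg (fun f : ℝ →L[ℝ] EuclideanSpace ℝ (Fin 7) => f 1)
      (h1.mfderiv_eq.trans mfderiv_const)
  have hj : ∀ j, S.ηT (S.act p (dir q)) (D (q * T j) : EuclideanSpace ℝ (Fin 7)) = T j := by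
    intro j
    have hγ : HasDerivAt (fun τ : ℝ => q * rot j τ) (q * T j) 0 := by
      simpa [rot_zero] using (hasDerivAt_rot j 0).const_mul q
    rw [← chain _ _ 0 (by rw [rot_zero, mul_one]) hγ]
    have h1 : (fun τ : ℝ => S.act p (dir (q * rot j τ)))
        = fun τ => S.act (S.act p (dir q)) (rot j τ) := by
      funext τ
      rw [dir_mul_of_norm_eq_one q (norm_rot j τ), S.act_mul _ _ _ (norm_dir hq) (norm_rot j τ)]
    rw [h1]
    exact S.ηT_fundamental _ j
  set ξ := q⁻¹ * ζ with hξ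
  have hζ : ζ = q * ξ := by rw [hξ, ← mul_assoc, mul_inv_cancel₀ hq, one_mul]
  have h1 : ζ = ξ.re • q + ξ.imI • (q * T 0) + ξ.imJ • (q * T 1) + ξ.imK • (q * T 2) := by
    rw [hζ]
    conv_lhs => rw [eq_re_add_smul_T ξ]
    simp only [mul_add, mul_smul_comm, mul_one]
  have h2 : D ζ = ξ.imI • D (q * T 0) + ξ.imJ • D (q * T 1) + ξ.imK • D (q * T 2) := by
    conv_lhs => rw [h1]
    simp only [map_add, map_smul, h0, smul_zero, zero_add]
  set L : EuclideanSpace ℝ (Fin 7) →L[ℝ] ℍ[ℝ] := S.ηT (S.act p (dir q))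
  change L (D ζ) = _
  rw [h2, map_add, map_add, map_smul, map_smul, map_smul, im_eq_smul_T]
  change ξ.imI • S.ηT (S.act p (dir q)) (D (q * T 0)) + ξ.imJ • S.ηT (S.act p (dir q)) (D (q * T 1))
    + ξ.imK • S.ηT (S.act p (dir q)) (D (q * T 2)) = _
  rw [hj, hj, hj]

/-- In the trivial gauge the connection is `x (ū η u + Im (q⁻¹ dq))` with `u = q / |q|`. -/
theorem trivialGauge_radial (x : ℝ → ℝ) (p : X) {q : ℍ[ℝ]} (hq : q ≠ 0)
    (w : EuclideanSpace ℝ (Fin 7) × ℍ[ℝ]) :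
    S.trivialGauge (S.radial x) (p, q) w
      = x ‖q‖ • (star (dir q) * S.ηT p w.1 * dir q + (q⁻¹ * w.2).im) := by
  have hd := S.mdifferentiableAt_act_dir p hq
  have hn : MDifferentiableAt I11 𝓘(ℝ, ℝ) (fun z : X × ℍ[ℝ] => ‖z.2‖) (p, q) :=
    MDifferentiableAt.comp (I' := 𝓘(ℝ, ℍ[ℝ])) (g := fun q : ℍ[ℝ] => ‖q‖) (p, q)
      (differentiableAt_id.norm ℝ hq).mdifferentiableAt mdifferentiableAt_snd
  have h1 : (mfderiv I11 I8 S.polar (p, q) w : ℝ × EuclideanSpace ℝ (Fin 7)).2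
      = mfderiv I11 I7 (fun z : X × ℍ[ℝ] => S.act z.1 (dir z.2)) (p, q) w := by
    have := mfderiv_prodMk hn hd
    exact congrArg (fun f : EuclideanSpace ℝ (Fin 7) × ℍ[ℝ] →L[ℝ]
      ℝ × EuclideanSpace ℝ (Fin 7) => (f w).2) this
  have h2 : mfderiv I11 I7 (fun z : X × ℍ[ℝ] => S.act z.1 (dir z.2)) (p, q) w
      = (mfderiv I7 I7 (fun p' => S.act p' (dir q)) p w.1
        + mfderiv 𝓘(ℝ, ℍ[ℝ]) I7 (fun q' => S.act p (dir q')) q w.2 : EuclideanSpace ℝ (Fin 7)) :=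
    mfderiv_prod_eq_add_apply hd
  set L : EuclideanSpace ℝ (Fin 7) →L[ℝ] ℍ[ℝ] := S.ηT (S.act p (dir q)) with hL
  have h3 : S.trivialGauge (S.radial x) (p, q) w
      = x ‖q‖ • L (mfderiv I11 I8 S.polar (p, q) w : ℝ × EuclideanSpace ℝ (Fin 7)).2 := rfl
  rw [h3, h1, h2]
  have h4 := S.ηT_equivariant (norm_dir hq) p w.1
  have h5 := S.ηT_orbit p hq w.2
  exact congrArg (fun a => x ‖q‖ • a) ((L.map_add _ _).trans (congrArg₂ (· + ·) h4 h5))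

end ThreeSasakian

/-! ### Extension across the zero section -/

/-- The imaginary part of a quaternion, as a continuous linear map. -/
def imL : ℍ[ℝ] →L[ℝ] ℍ[ℝ] :=
  LinearMap.toContinuousLinearMap
    { toFun := Quaternion.im
      map_add' := fun a b => Quaternion.im_add a b
      map_smul' := fun c a => Quaternion.im_smul a c }

/-- The conjugation of quaternions, as a continuous linear map. -/
def conjL : ℍ[ℝ] →L[ℝ] ℍ[ℝ] :=
  LinearMap.toContinuousLinearMap
    { toFun := star
      map_add' := fun a b => star_add a b
      map_smul' := fun c a => Quaternion.star_smul c a }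

theorem inv_eq_smul_star (q : ℍ[ℝ]) : q⁻¹ = (‖q‖ ^ 2)⁻¹ • star q := by
  rw [Quaternion.inv_def, Quaternion.normSq_eq_norm_mul_self, sq]

theorem star_dir (q : ℍ[ℝ]) : star (dir q) = ‖q‖⁻¹ • star q := Quaternion.star_smul _ _

theorem tendsto_norm_quaternion : Tendsto (fun q : ℍ[ℝ] => ‖q‖) (𝓝[≠] 0) (𝓝[>] 0) :=
  tendsto_norm_nhdsNE_zero

open scoped Classical in
/-- A function of the form `r² Y(r²)` near `r = 0` gives a smooth function `f(|q|) / |q|²` on `ℍ`.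
-/
theorem exists_contDiffOn_div_sq {f : ℝ → ℝ} {J : Set ℝ} (hJ : IsOpen J) (hJ0 : J ⊆ Ioi 0)
    (hf : ContDiffOn ℝ ∞ f J) {Y : ℝ → ℝ} (hY : AnalyticAt ℝ Y 0)
    (hfY : ∀ᶠ r in 𝓝[>] 0, f r = r ^ 2 * Y (r ^ 2)) :
    ∃ G : ℍ[ℝ] → ℝ, ContDiffOn ℝ ∞ G {q | q = 0 ∨ ‖q‖ ∈ J} ∧
      ∀ q, q ≠ 0 → f ‖q‖ = ‖q‖ ^ 2 * G q := by
  refine ⟨fun q => if q = 0 then Y 0 else f ‖q‖ / ‖q‖ ^ 2, ?_, fun q hq => ?_⟩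
  · rintro q (rfl | hq)
    · have h1 : ContDiffAt ℝ ∞ (fun q : ℍ[ℝ] => Y (‖q‖ ^ 2)) 0 := by
        have hY' : ContDiffAt ℝ ∞ Y (‖(0 : ℍ[ℝ])‖ ^ 2) := by simpa using hY.contDiffAt
        exact hY'.comp (0 : ℍ[ℝ]) (contDiff_norm_sq ℝ).contDiffAt
      refine (h1.congr_of_eventuallyEq ?_).contDiffWithinAt
      have h2 := tendsto_norm_quaternion.eventually hfY
      rw [eventually_nhdsWithin_iff] at h2
      filter_upwards [h2] with q hq
      by_cases h0 : q = 0
      · simp [h0]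
      · rw [if_neg h0, hq h0]
        have := norm_ne_zero_iff.2 h0
        field_simp
    · have h0 : q ≠ 0 := norm_pos_iff.1 (hJ0 hq)
      have h1 : ContDiffAt ℝ ∞ (fun q : ℍ[ℝ] => f ‖q‖ / ‖q‖ ^ 2) q := by
        have h2 : ContDiffAt ℝ ∞ (fun q : ℍ[ℝ] => f ‖q‖) q :=
          (hf.contDiffAt (hJ.mem_nhds hq)).comp q (contDiffAt_norm ℝ h0)
        exact h2.div (contDiff_norm_sq ℝ).contDiffAt (by simpa using h0)
      refine (h1.congr_of_eventuallyEq ?_).contDiffWithinAt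
      filter_upwards [isOpen_ne.mem_nhds h0] with q' hq'
      exact if_neg hq'
  · have := norm_ne_zero_iff.2 hq
    simp only [if_neg hq]
    field_simp

namespace ThreeSasakian

variable {X : Type*} [TopologicalSpace X] [ChartedSpace (EuclideanSpace ℝ (Fin 7)) X]
  [IsManifold I7 ∞ X] (S : ThreeSasakian X)

theorem contMDiff_ηT : ContMDiff I7.tangent 𝓘(ℝ, ℍ[ℝ]) ∞
    (fun w : TangentBundle I7 X => S.ηT w.1 w.2) := by
  have h : ∀ i, ContMDiff I7.tangent 𝓘(ℝ, ℍ[ℝ]) ∞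
      (fun w : TangentBundle I7 X => S.η i w.1 w.2 • T i) := by
    intro i
    have h1 : ContMDiff I7.tangent 𝓘(ℝ, ℝ) ∞ (fun w : TangentBundle I7 X => S.η i w.1 w.2) := by
      rw [← contMDiffOn_univ]
      simpa [SmoothFormOn] using S.η_smooth i
    exact h1.smul contMDiff_const
  refine ((h 0).add ((h 1).add (h 2))).congr fun w => ?_
  rw [ηT_apply, Fin.sum_univ_three, add_assoc]
  rfl

/-- A 1-form on `X × ℍ` that is a smooth function of the point of `ℍ`, of `η` and of the tangent
vector of `ℍ` is smooth. -/
theorem smoothFormOn_of_contDiffOn {U : Set (X × ℍ[ℝ])} {U' : Set ℍ[ℝ]}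
    (hU : ∀ z ∈ U, z.2 ∈ U') {G : ℍ[ℝ] × ℍ[ℝ] × ℍ[ℝ] → ℍ[ℝ]}
    (hG : ContDiffOn ℝ ∞ G {y | y.1 ∈ U'})
    {B : ∀ z : X × ℍ[ℝ], TangentSpace I11 z →L[ℝ] ℍ[ℝ]}
    (hB : ∀ (z : X × ℍ[ℝ]) (w : EuclideanSpace ℝ (Fin 7) × ℍ[ℝ]),
      B z w = G (z.2, S.ηT z.1 w.1, w.2)) : SmoothFormOn I11 B U := by
  have h1 : ContMDiff I11.tangent 𝓘(ℝ, ℍ[ℝ]) ∞ (fun w : TangentBundle I11 (X × ℍ[ℝ]) => w.1.2) :=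
    contMDiff_snd.comp (Bundle.contMDiff_proj (TangentSpace I11 : X × ℍ[ℝ] → Type _))
  have h2 : ContMDiff I11.tangent 𝓘(ℝ, ℍ[ℝ]) ∞ (fun w : TangentBundle I11 (X × ℍ[ℝ]) =>
      S.ηT w.1.1 (w.2 : EuclideanSpace ℝ (Fin 7) × ℍ[ℝ]).1) := by
    have h3 : ContMDiff I11.tangent I7.tangent ∞
        (tangentMap I11 I7 (Prod.fst : X × ℍ[ℝ] → X)) :=
      ContMDiff.contMDiff_tangentMap (n := ∞) contMDiff_fst le_rfl
    refine (S.contMDiff_ηT.comp h3).congr fun w => ?_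
    have h4 : mfderiv I11 I7 (Prod.fst : X × ℍ[ℝ] → X) w.1
      = ContinuousLinearMap.fst ℝ (EuclideanSpace ℝ (Fin 7)) ℍ[ℝ] := mfderiv_fst
    exact congrArg (fun f : EuclideanSpace ℝ (Fin 7) × ℍ[ℝ] →L[ℝ] EuclideanSpace ℝ (Fin 7) =>
      S.ηT w.1.1 (f w.2)) h4.symm
  have h3 : ContMDiff I11.tangent 𝓘(ℝ, ℍ[ℝ]) ∞ (fun w : TangentBundle I11 (X × ℍ[ℝ]) =>
      (w.2 : EuclideanSpace ℝ (Fin 7) × ℍ[ℝ]).2) := by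
    have h3 : ContMDiff I11.tangent 𝓘(ℝ, ℍ[ℝ]).tangent ∞
        (tangentMap I11 𝓘(ℝ, ℍ[ℝ]) (Prod.snd : X × ℍ[ℝ] → ℍ[ℝ])) :=
      ContMDiff.contMDiff_tangentMap (n := ∞) contMDiff_snd le_rfl
    refine ((contMDiff_snd_tangentBundle_modelSpace ℍ[ℝ] 𝓘(ℝ, ℍ[ℝ])).comp h3).congr fun w => ?_
    have h4 : mfderiv I11 𝓘(ℝ, ℍ[ℝ]) (Prod.snd : X × ℍ[ℝ] → ℍ[ℝ]) w.1
      = ContinuousLinearMap.snd ℝ (EuclideanSpace ℝ (Fin 7)) ℍ[ℝ] := mfderiv_snd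
    exact congrArg (fun f : EuclideanSpace ℝ (Fin 7) × ℍ[ℝ] →L[ℝ] ℍ[ℝ] => f w.2) h4.symm
  have h4 := h1.prodMk_space (h2.prodMk_space h3)
  have h5 := hG.contMDiffOn.comp h4.contMDiffOn 
    (s := {w : TangentBundle I11 (X × ℍ[ℝ]) | w.1 ∈ U}) fun w hw => hU _ hw
  exact h5.congr fun w _ => hB w.1 w.2

theorem extendsFlat_radial {J : Set ℝ} (hJ : IsOpen J) (hJ0 : J ⊆ Ioi 0) {x : ℝ → ℝ}
    (hx : ContDiffOn ℝ ∞ x J) {Y : ℝ → ℝ} (hY : AnalyticAt ℝ Y 0)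
    (hxY : ∀ᶠ r in 𝓝[>] 0, x r = r ^ 2 * Y (r ^ 2)) : S.ExtendsFlat (S.radial x) J := by
  obtain ⟨G, hG, hGx⟩ := exists_contDiffOn_div_sq hJ hJ0 hx hY hxY
  refine ⟨fun z => G z.2 • (((ContinuousLinearMap.mulLeftRight ℝ ℍ[ℝ] (star z.2) z.2).comp
      (S.ηT z.1 : EuclideanSpace ℝ (Fin 7) →L[ℝ] ℍ[ℝ])).comp
        (ContinuousLinearMap.fst ℝ (EuclideanSpace ℝ (Fin 7)) ℍ[ℝ])
      + (imL.comp (ContinuousLinearMap.mul ℝ ℍ[ℝ] (star z.2))).comp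
        (ContinuousLinearMap.snd ℝ (EuclideanSpace ℝ (Fin 7)) ℍ[ℝ])), ?_, ?_, ?_⟩
  · refine S.smoothFormOn_of_contDiffOn (U' := {q | q = 0 ∨ ‖q‖ ∈ J}) (fun z hz => hz)
      (G := fun y => G y.1 • (star y.1 * y.2.1 * y.1 + (star y.1 * y.2.2).im)) ?_ fun z w => rfl
    have h1 : ContDiffOn ℝ ∞ (fun y : ℍ[ℝ] × ℍ[ℝ] × ℍ[ℝ] => G y.1)
        {y | y.1 ∈ {q | q = 0 ∨ ‖q‖ ∈ J}} :=
      hG.comp contDiff_fst.contDiffOn fun y hy => hy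
    have h2 : ContDiff ℝ ∞ (fun y : ℍ[ℝ] × ℍ[ℝ] × ℍ[ℝ] =>
        conjL y.1 * y.2.1 * y.1 + imL (conjL y.1 * y.2.2)) := by
      fun_prop
    exact h1.smul h2.contDiffOn
  · rintro ⟨p, q⟩ hq - w
    have hq' : q ≠ 0 := hq
    refine Eq.trans ?_ (S.trivialGauge_radial x p hq' w).symm
    change G q • (star q * S.ηT p w.1 * q + (star q * w.2).im) = _
    rw [hGx q hq', star_dir, inv_eq_smul_star, dir]
    have := norm_ne_zero_iff.2 hq'
    simp only [smul_mul_assoc, mul_smul_comm, Quaternion.im_smul, smul_add, smul_smul]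
    congr 2 <;> field_simp
  · intro p v
    change G 0 • (star (0 : ℍ[ℝ]) * S.ηT p v * 0 + (star (0 : ℍ[ℝ]) * 0).im) = 0
    simp

/-- In the gauge of `π^*E` the connection is `x η + (x - 1) Im (dq q⁻¹)`: the trivial gauge is
conjugated by `q / |q|`, and the Maurer-Cartan term `Im (dq q⁻¹)` is subtracted. -/
theorem pullbackGauge_radial (x : ℝ → ℝ) (p : X) {q : ℍ[ℝ]} (hq : q ≠ 0)
    (w : EuclideanSpace ℝ (Fin 7) × ℍ[ℝ]) :
    S.pullbackGauge (S.radial x) (p, q) w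
      = x ‖q‖ • S.ηT p w.1 + (x ‖q‖ - 1) • (w.2 * q⁻¹).im := by
  have h1 : S.pullbackGauge (S.radial x) (p, q) w
      = dir q * S.trivialGauge (S.radial x) (p, q) w * (dir q)⁻¹
        - fderiv ℝ dir q w.2 * (dir q)⁻¹ := rfl
  have hu := dir_ne_zero hq
  have hn := norm_ne_zero_iff.2 hq
  have h2 : star (dir q) = (dir q)⁻¹ := by
    rw [inv_eq_smul_star, norm_dir hq]
    simp
  -- conjugation by `q / |q|` commutes with taking the imaginary part
  have h3 : dir q * (q⁻¹ * w.2).im * (dir q)⁻¹ = (w.2 * q⁻¹).im := by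
    have e1 : ∀ a : ℍ[ℝ], a.im = a - (a.re : ℍ[ℝ]) := fun a => (Quaternion.sub_re_self a).symm
    have e2 : (q⁻¹ * w.2).re = (w.2 * q⁻¹).re := by
      rw [Quaternion.re_mul, Quaternion.re_mul]; ring
    have e3 : (dir q)⁻¹ = ‖q‖ • q⁻¹ := by
      rw [dir, smul_inv₀, inv_inv]
    rw [e1, e1, mul_sub, sub_mul, ← Quaternion.coe_commutes, mul_assoc _ (dir q),
      mul_inv_cancel₀ hu, mul_one, e2]
    congr 1
    rw [e3, dir, smul_mul_assoc, smul_mul_smul_comm, inv_mul_cancel₀ hn, one_smul, ← mul_assoc q,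
      mul_inv_cancel₀ hq, one_mul]
  rw [h1, fderiv_dir_mul_inv hq, S.trivialGauge_radial x p hq w, mul_smul_comm, smul_mul_assoc,
    mul_add, add_mul, h3, h2]
  have h4 : dir q * ((dir q)⁻¹ * S.ηT p w.1 * dir q) * (dir q)⁻¹ = S.ηT p w.1 := by
    rw [mul_assoc, mul_assoc ((dir q)⁻¹ * _), mul_inv_cancel₀ hu, mul_one, ← mul_assoc,
      mul_inv_cancel₀ hu, one_mul]
  rw [h4]
  module

theorem extendsLeviCivita_radial {J : Set ℝ} (hJ : IsOpen J) (hJ0 : J ⊆ Ioi 0) {x : ℝ → ℝ}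
    (hx : ContDiffOn ℝ ∞ x J) {Y : ℝ → ℝ} (hY : AnalyticAt ℝ Y 0)
    (hxY : ∀ᶠ r in 𝓝[>] 0, x r = 1 + r ^ 2 * Y (r ^ 2)) :
    S.ExtendsLeviCivita (S.radial x) J := by
  obtain ⟨G, hG, hGx⟩ := exists_contDiffOn_div_sq hJ hJ0 (f := fun r => x r - 1)
    (hx.sub contDiffOn_const) hY (hxY.mono fun r hr => by rw [hr]; ring)
  refine ⟨fun z => (1 + ‖z.2‖ ^ 2 * G z.2) • (S.ηT z.1 : EuclideanSpace ℝ (Fin 7) →L[ℝ] ℍ[ℝ]).comp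
        (ContinuousLinearMap.fst ℝ (EuclideanSpace ℝ (Fin 7)) ℍ[ℝ])
      + G z.2 • (imL.comp ((ContinuousLinearMap.mul ℝ ℍ[ℝ]).flip (star z.2))).comp
        (ContinuousLinearMap.snd ℝ (EuclideanSpace ℝ (Fin 7)) ℍ[ℝ]), ?_, ?_, ?_⟩
  · refine S.smoothFormOn_of_contDiffOn (U' := {q | q = 0 ∨ ‖q‖ ∈ J}) (fun z hz => hz)
      (G := fun y => (1 + ‖y.1‖ ^ 2 * G y.1) • y.2.1 + G y.1 • (y.2.2 * star y.1).im) ?_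
      fun z w => rfl
    have h1 : ContDiffOn ℝ ∞ (fun y : ℍ[ℝ] × ℍ[ℝ] × ℍ[ℝ] => G y.1)
        {y | y.1 ∈ {q | q = 0 ∨ ‖q‖ ∈ J}} :=
      hG.comp contDiff_fst.contDiffOn fun y hy => hy
    have h2 : ContDiff ℝ ∞ (fun y : ℍ[ℝ] × ℍ[ℝ] × ℍ[ℝ] => imL (y.2.2 * conjL y.1)) := by
      fun_prop
    have h3 : ContDiff ℝ ∞ (fun y : ℍ[ℝ] × ℍ[ℝ] × ℍ[ℝ] => ‖y.1‖ ^ 2) :=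
      (contDiff_norm_sq ℝ).comp contDiff_fst
    have h4 : ContDiff ℝ ∞ (fun y : ℍ[ℝ] × ℍ[ℝ] × ℍ[ℝ] => y.2.1) := by fun_prop
    exact ((contDiffOn_const.add (h3.contDiffOn.mul h1)).smul h4.contDiffOn).add
      (h1.smul h2.contDiffOn)
  · rintro ⟨p, q⟩ hq - w
    have hq' : q ≠ 0 := hq
    refine Eq.trans ?_ (S.pullbackGauge_radial x p hq' w).symm
    change (1 + ‖q‖ ^ 2 * G q) • S.ηT p w.1 + G q • (w.2 * star q).im = _
    have hn := norm_ne_zero_iff.2 hq'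
    rw [hGx q hq', inv_eq_smul_star, mul_smul_comm, Quaternion.im_smul, smul_smul, ← hGx q hq',
      add_sub_cancel]
    congr 2
    rw [hGx q hq']
    field_simp
  · intro p v
    change (1 + ‖(0 : ℍ[ℝ])‖ ^ 2 * G 0) • S.ηT p v + G 0 • ((0 : ℍ[ℝ]) * star (0 : ℍ[ℝ])).im = _
    simp

/-- A smooth 1-form on `X × ℍ`, evaluated on a linear vector field of `ℍ`, tends to `0` at the zero
section. -/
theorem tendsto_form_linear {B : ∀ z : X × ℍ[ℝ], TangentSpace I11 z →L[ℝ] ℍ[ℝ]}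
    (hB : SmoothFormOn I11 B {z | z.2 = 0 ∨ ‖z.2‖ ∈ Ioi (0 : ℝ)}) (p : X) (l : ℍ[ℝ] →L[ℝ] ℍ[ℝ]) :
    Tendsto (fun q : ℍ[ℝ] => B (p, q) ((0, l q) : EuclideanSpace ℝ (Fin 7) × ℍ[ℝ])) (𝓝 0)
      (𝓝 0) := by
  have hB' : ContMDiff I11.tangent 𝓘(ℝ, ℍ[ℝ]) ∞
      (fun w : TangentBundle I11 (X × ℍ[ℝ]) => B w.1 w.2) := by
    rw [← contMDiffOn_univ]
    refine ContMDiffOn.mono hB fun w _ => ?_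
    rcases eq_or_ne w.1.2 0 with h | h
    · exact Or.inl h
    · exact Or.inr (norm_pos_iff.2 h)
  have h2 : ContMDiff 𝓘(ℝ, ℍ[ℝ]) 𝓘(ℝ, ℍ[ℝ]).tangent ∞
      (fun q : ℍ[ℝ] => (⟨q, l q⟩ : TangentBundle 𝓘(ℝ, ℍ[ℝ]) ℍ[ℝ])) :=
    contMDiff_vectorSpace_iff_contDiff.2 l.contDiff
  have h3 : ContMDiff 𝓘(ℝ, ℍ[ℝ]).tangent I11.tangent ∞
      (tangentMap 𝓘(ℝ, ℍ[ℝ]) I11 (fun q : ℍ[ℝ] => (p, q))) :=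
    ContMDiff.contMDiff_tangentMap (n := ∞) (contMDiff_const.prodMk contMDiff_id) le_rfl
  have h4 := (hB'.comp (h3.comp h2)).continuous
  have h5 : ((fun w : TangentBundle I11 (X × ℍ[ℝ]) => B w.1 w.2)
      ∘ tangentMap 𝓘(ℝ, ℍ[ℝ]) I11 (fun q : ℍ[ℝ] => (p, q))
      ∘ fun q : ℍ[ℝ] => (⟨q, l q⟩ : TangentBundle 𝓘(ℝ, ℍ[ℝ]) ℍ[ℝ]))
      = fun q : ℍ[ℝ] => B (p, q) ((0, l q) : EuclideanSpace ℝ (Fin 7) × ℍ[ℝ]) := by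
    funext q
    have h6 : mfderiv 𝓘(ℝ, ℍ[ℝ]) I11 (fun q : ℍ[ℝ] => (p, q)) q
        = ContinuousLinearMap.inr ℝ (EuclideanSpace ℝ (Fin 7)) ℍ[ℝ] := mfderiv_prod_right
    exact congrArg (fun f : ℍ[ℝ] →L[ℝ] EuclideanSpace ℝ (Fin 7) × ℍ[ℝ] => B (p, q) (f (l q))) h6
  rw [h5] at h4
  have h6 := h4.tendsto 0
  have h7 : B (p, 0) ((0, l 0) : EuclideanSpace ℝ (Fin 7) × ℍ[ℝ]) = 0 := by
    rw [map_zero]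
    exact (B (p, 0)).map_zero
  rwa [h7] at h6

theorem T_zero_im : (T 0).im = T 0 := by
  rw [im_eq_smul_T]
  simp [T_imI, T_imJ, T_imK]

/-- A function of `|q|` that is the coefficient of a fixed vector and tends to `0`, tends to `0`. -/
theorem tendsto_of_tendsto_norm_smul {f : ℝ → ℝ}
    (h : Tendsto (fun q : ℍ[ℝ] => f ‖q‖ • T 0) (𝓝[≠] 0) (𝓝 0)) :
    Tendsto f (𝓝[>] 0) (𝓝 0) := by
  have h1 : Tendsto (fun r : ℝ => (r : ℍ[ℝ])) (𝓝[>] 0) (𝓝[≠] 0) := by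
    refine tendsto_nhdsWithin_iff.2 ⟨?_, ?_⟩
    · have : Tendsto (fun r : ℝ => (r : ℍ[ℝ])) (𝓝 0) (𝓝 ((0 : ℝ) : ℍ[ℝ])) :=
        Quaternion.continuous_coe.tendsto 0
      rw [Quaternion.coe_zero] at this
      exact this.mono_left nhdsWithin_le_nhds
    · filter_upwards [self_mem_nhdsWithin] with r hr
      have : (r : ℍ[ℝ]) ≠ ((0 : ℝ) : ℍ[ℝ]) := fun h => (ne_of_gt hr) (Quaternion.coe_injective h)
      simpa using this
  have h2 := (Quaternion.continuous_imI.tendsto (0 : ℍ[ℝ])).comp (h.comp h1)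
  rw [Quaternion.imI_zero] at h2
  refine h2.congr' ?_
  filter_upwards [self_mem_nhdsWithin] with r hr
  simp only [Function.comp, Quaternion.imI_smul, T_imI, Matrix.cons_val_zero, smul_eq_mul, mul_one,
    Quaternion.norm_coe]
  rw [Real.norm_of_nonneg (le_of_lt hr)]

theorem tendsto_zero_of_extendsFlat [Nonempty X] {x : ℝ → ℝ}
    (h : S.ExtendsFlat (S.radial x) (Ioi 0)) : Tendsto x (𝓝[>] 0) (𝓝 0) := by
  obtain ⟨B, hB, hBA, -⟩ := h
  obtain ⟨p⟩ := ‹Nonempty X›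
  have h1 := tendsto_form_linear hB p ((ContinuousLinearMap.mul ℝ ℍ[ℝ]).flip (T 0))
  refine tendsto_of_tendsto_norm_smul ((h1.mono_left nhdsWithin_le_nhds).congr' ?_)
  filter_upwards [self_mem_nhdsWithin] with q hq
  have hq' : q ≠ 0 := hq
  refine (hBA (p, q) hq' (norm_pos_iff.2 hq') _).trans
    ((S.trivialGauge_radial x p hq' (0, q * T 0)).trans ?_)
  have h0 : S.ηT p (0 : EuclideanSpace ℝ (Fin 7)) = 0 := (S.ηT p).map_zero
  rw [h0, ← mul_assoc, inv_mul_cancel₀ hq', one_mul, T_zero_im]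
  simp

theorem tendsto_one_of_extendsLeviCivita [Nonempty X] {x : ℝ → ℝ}
    (h : S.ExtendsLeviCivita (S.radial x) (Ioi 0)) : Tendsto x (𝓝[>] 0) (𝓝 1) := by
  obtain ⟨B, hB, hBA, -⟩ := h
  obtain ⟨p⟩ := ‹Nonempty X›
  have h1 := tendsto_form_linear hB p (ContinuousLinearMap.mul ℝ ℍ[ℝ] (T 0))
  have h2 : Tendsto (fun r => x r - 1) (𝓝[>] 0) (𝓝 0) := by
    refine tendsto_of_tendsto_norm_smul ((h1.mono_left nhdsWithin_le_nhds).congr' ?_)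
    filter_upwards [self_mem_nhdsWithin] with q hq
    have hq' : q ≠ 0 := hq
    refine (hBA (p, q) hq' (norm_pos_iff.2 hq') _).trans
      ((S.pullbackGauge_radial x p hq' (0, T 0 * q)).trans ?_)
    have h0 : S.ηT p (0 : EuclideanSpace ℝ (Fin 7)) = 0 := (S.ηT p).map_zero
    rw [h0, mul_assoc, mul_inv_cancel₀ hq', mul_one, T_zero_im]
    simp
  simpa using h2.add_const 1

end ThreeSasakian

/-! ### Asymptotics and irreducibility -/

theorem eq_zero_of_commute_T {a : ℍ[ℝ]} (hre : a.re = 0) (h : ∀ j, a * T j = T j * a) : a = 0 := by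
  have h0 := h 0
  have h1 := h 1
  have e1 := congrArg QuaternionAlgebra.imK h0
  have e2 := congrArg QuaternionAlgebra.imJ h0
  have e3 := congrArg QuaternionAlgebra.imK h1
  simp only [Quaternion.imJ_mul, Quaternion.imK_mul, T_re, T_imI, T_imJ, T_imK, Matrix.cons_val]
    at e1 e2 e3
  ext
  · exact hre
  · change a.imI = 0
    linarith
  · change a.imJ = 0
    linarith
  · change a.imK = 0
    linarith

/-- If the real multiple `x (f T - T f)` is the derivative of the `2π`-periodic `f` and `2 x` is not
an integer, then `f` commutes with `T` at the period. -/
theorem commute_T_of_periodic {f : ℝ → ℍ[ℝ]} {x : ℝ} {j : Fin 3}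
    (hf : ∀ τ, HasDerivAt f (x • (f τ * T j - T j * f τ)) τ) (hper : f (2 * Real.pi) = f 0)
    (hx : Real.sin (x * (2 * Real.pi)) ≠ 0) : f 0 * T j = T j * f 0 := by
  have hrot : ∀ c τ : ℝ, HasDerivAt (fun τ : ℝ => rot j (c * τ)) (c • (rot j (c * τ) * T j)) τ := by
    intro c τ
    have h1 : HasDerivAt (fun τ : ℝ => c * τ) c τ := by simpa using (hasDerivAt_id τ).const_mul c
    exact (hasDerivAt_rot j (c * τ)).scomp τ h1
  -- parallel transport turns `f` into a constant
  have hg : ∀ τ, HasDerivAt (fun τ => rot j (x * τ) * f τ * rot j (-x * τ)) 0 τ := by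
    intro τ
    refine (((hrot x τ).mul (hf τ)).mul (hrot (-x) τ)).congr_deriv ?_
    simp only [Pi.mul_apply]
    rw [← T_mul_rot j (-x * τ)]
    simp only [smul_mul_assoc, mul_smul_comm, add_mul, mul_sub, sub_mul, mul_assoc]
    module
  have hconst := is_const_of_deriv_eq_zero (fun τ => (hg τ).differentiableAt)
    (fun τ => (hg τ).deriv) (2 * Real.pi) 0
  simp only [mul_zero, rot_zero, one_mul, mul_one, hper] at hconst
  set Q := rot j (x * (2 * Real.pi)) with hQ
  have hinv : rot j (-x * (2 * Real.pi)) * Q = 1 := by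
    have h1 : ∀ τ : ℝ, rot j (-τ) = star (rot j τ) := by
      intro τ
      rw [rot, rot, star_add, Quaternion.star_smul, star_T, Quaternion.star_coe, Real.cos_neg,
        Real.sin_neg, neg_smul, smul_neg]
    rw [neg_mul, h1, hQ, Quaternion.star_mul_self, Quaternion.normSq_eq_norm_mul_self, norm_rot]
    simp
  have hcomm : Q * f 0 = f 0 * Q := by
    have := congrArg (· * Q) hconst
    simpa only [mul_assoc, hinv, mul_one] using this
  rw [hQ, rot, add_mul, mul_add, Quaternion.coe_commutes, add_left_cancel_iff, smul_mul_assoc,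
    mul_smul_comm] at hcomm
  exact (smul_right_injective _ hx hcomm).symm

namespace ThreeSasakian

variable {X : Type*} [TopologicalSpace X] [ChartedSpace (EuclideanSpace ℝ (Fin 7)) X]
  [IsManifold I7 ∞ X] (S : ThreeSasakian X)

theorem norm_ηT_sq (p : X) (v : TangentSpace I7 p) : ‖S.ηT p v‖ ^ 2 = ∑ i, S.η i p v ^ 2 := by
  rw [sq, ← Quaternion.normSq_eq_norm_mul_self, Quaternion.normSq_def', ηT_apply,
    Fin.sum_univ_three, Fin.sum_univ_three]
  simp only [Quaternion.re_add, Quaternion.imI_add, Quaternion.imJ_add, Quaternion.imK_add,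
    Quaternion.re_smul, Quaternion.imI_smul, Quaternion.imJ_smul, Quaternion.imK_smul,
    T_re, T_imI, T_imJ, T_imK, Matrix.cons_val, smul_eq_mul]
  ring

theorem h_self_nonneg (p : X) (v : TangentSpace I7 p) : 0 ≤ S.h p v v := by
  obtain ⟨e, -, he, -⟩ := S.adapted p
  rw [he]
  exact Finset.sum_nonneg fun a _ => mul_self_nonneg _

theorem isAsymptoticTo_aInf {x : ℝ → ℝ} (hx : Tendsto x atTop (𝓝 (3 / 5))) :
    S.IsAsymptoticTo (S.radial x) S.aInf := by
  intro ε hε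
  obtain ⟨R, hR⟩ := (Metric.tendsto_atTop.1 hx) (ε / 3) (by positivity)
  refine ⟨R, fun r hr p => ⟨fun v => ?_, ?_⟩⟩
  · have h1 : S.radial x (r, p) ((0, v) : ℝ × EuclideanSpace ℝ (Fin 7)) - S.aInf p v
        = (x r - 3 / 5) • S.ηT p v := by
      rw [sub_smul]
      rfl
    have h2 : |x r - 3 / 5| ≤ ε / 3 := (hR r hr.le).le
    have h3 := S.h_self_nonneg p v
    have h4 := S.norm_ηT_sq p v
    have h5 : ‖S.ηT p v‖ ≤ 3 * √(5⁻¹ * ∑ i, S.η i p v ^ 2 + S.h p v v) := by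
      have h6 : ‖S.ηT p v‖ / 3 ≤ √(5⁻¹ * ∑ i, S.η i p v ^ 2 + S.h p v v) := by
        refine Real.le_sqrt_of_sq_le ?_
        rw [← h4]
        nlinarith [sq_nonneg ‖S.ηT p v‖]
      linarith
    rw [h1, norm_smul, Real.norm_eq_abs]
    calc |x r - 3 / 5| * ‖S.ηT p v‖
        ≤ ε / 3 * (3 * √(5⁻¹ * ∑ i, S.η i p v ^ 2 + S.h p v v)) := by gcongr
      _ = _ := by ring
  · have h1 : S.radial x (r, p) ((1, 0) : ℝ × EuclideanSpace ℝ (Fin 7))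
        = x r • S.ηT p (0 : EuclideanSpace ℝ (Fin 7)) := rfl
    have h2 : S.ηT p (0 : EuclideanSpace ℝ (Fin 7)) = 0 := (S.ηT p).map_zero
    rw [h1, h2, smul_zero, norm_zero, mul_zero]
    exact hε.le

theorem dir_rot (j : Fin 3) (τ : ℝ) : dir (rot j τ) = rot j τ := by
  rw [dir, norm_rot, inv_one, one_smul]

/-- A radial connection is irreducible if its coefficient takes a value in `(0, 1/2)`: along the
orbits of the one-parameter subgroups of `SU(2)`, its holonomies over a full turn are rotations by
angles that are not multiples of `π`. -/
theorem isIrreducibleOn_radial {x : ℝ → ℝ} {r₀ : ℝ} (hr₀ : 0 < r₀) (hx0 : 0 < x r₀)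
    (hx1 : x r₀ < 1 / 2) : IsIrreducibleOn I8 (S.radial x) {z | 0 < z.1} := by
  intro ξ hξ
  -- `ξ` does not depend on `r`, because the connection has no `dr`-component
  have hconst : ∀ p : X, ∀ r, 0 < r → ξ (r, p) = ξ (r₀, p) := by
    intro p r hr
    have hd : ∀ s, 0 < s → HasDerivAt (fun s => ξ (s, p)) 0 s := by
      intro s hs
      obtain ⟨-, hξd, hξ'⟩ := hξ (s, p) hs
      have h1 : MDifferentiableAt 𝓘(ℝ, ℝ) I8 (fun s : ℝ => (s, p)) s :=
        mdifferentiableAt_id.prodMk mdifferentiableAt_const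
      have h2 : mfderiv 𝓘(ℝ, ℝ) I8 (fun s : ℝ => (s, p)) s
          = ContinuousLinearMap.inl ℝ ℝ (EuclideanSpace ℝ (Fin 7)) := mfderiv_prod_left
      have h3 : MDifferentiableAt 𝓘(ℝ, ℝ) 𝓘(ℝ, ℍ[ℝ]) (fun s => ξ (s, p)) s :=
        MDifferentiableAt.comp (I' := I8) (f := fun s : ℝ => (s, p)) s hξd h1
      have h4 : mfderiv 𝓘(ℝ, ℝ) 𝓘(ℝ, ℍ[ℝ]) (ξ ∘ fun s => (s, p)) s = _ :=
        mfderiv_comp (I' := I8) s hξd h1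
      have h5 : deriv (fun s => ξ (s, p)) s
          = mfderiv I8 𝓘(ℝ, ℍ[ℝ]) ξ (s, p) ((1, 0) : ℝ × EuclideanSpace ℝ (Fin 7)) := by
        rw [h2, mfderiv_eq_fderiv] at h4
        exact congrArg (fun f : ℝ →L[ℝ] ℍ[ℝ] => f 1) h4
      have h6 : S.radial x (s, p) ((1, 0) : ℝ × EuclideanSpace ℝ (Fin 7)) = 0 := by
        have h2 : S.ηT p (0 : EuclideanSpace ℝ (Fin 7)) = 0 := (S.ηT p).map_zero
        exact (congrArg (fun a => x s • a) h2).trans (smul_zero _)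
      have h7 := mdifferentiableAt_iff_differentiableAt.1 h3 |>.hasDerivAt
      rw [h5] at h7
      refine h7.congr_deriv ((hξ' _).trans ?_)
      rw [h6]
      simp
      rfl
    exact isOpen_Ioi.is_const_of_deriv_eq_zero isPreconnected_Ioi
      (fun s hs => (hd s hs).differentiableAt.differentiableWithinAt)
      (fun s hs => (hd s hs).deriv) hr hr₀
  rintro ⟨r, p⟩ hr
  rw [hconst p r hr]
  refine eq_zero_of_commute_T (hξ (r₀, p) hr₀).1 fun j => ?_
  have hrot : ∀ τ, rot j τ ≠ 0 := fun τ => by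
    rw [← norm_ne_zero_iff, norm_rot]
    exact one_ne_zero
  -- the equation along the orbit of the one-parameter subgroup generated by `T j`
  have hd : ∀ τ, HasDerivAt (fun τ => ξ (r₀, S.act p (dir (rot j τ))))
      (x r₀ • (ξ (r₀, S.act p (dir (rot j τ))) * T j - T j * ξ (r₀, S.act p (dir (rot j τ))))) τ := by
    intro τ
    set z : ℝ × X := (r₀, S.act p (dir (rot j τ))) with hz
    obtain ⟨-, hξd, hξ'⟩ := hξ z hr₀
    have h0 := S.mdifferentiableAt_orbit p (hrot τ)
    have h1 : MDifferentiableAt 𝓘(ℝ, ℍ[ℝ]) I8 (fun q : ℍ[ℝ] => (r₀, S.act p (dir q))) (rot j τ) :=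
      mdifferentiableAt_const.prodMk h0
    have h3 : MDifferentiableAt 𝓘(ℝ, ℍ[ℝ]) 𝓘(ℝ, ℍ[ℝ]) (fun q : ℍ[ℝ] => ξ (r₀, S.act p (dir q)))
        (rot j τ) := MDifferentiableAt.comp (I' := I8) (rot j τ) hξd h1
    have h4 : mfderiv 𝓘(ℝ, ℍ[ℝ]) 𝓘(ℝ, ℍ[ℝ]) (ξ ∘ fun q : ℍ[ℝ] => (r₀, S.act p (dir q))) (rot j τ) = _ :=
      mfderiv_comp (I' := I8) (rot j τ) hξd h1
    have h5 : mfderiv 𝓘(ℝ, ℍ[ℝ]) I8 (fun q : ℍ[ℝ] => (r₀, S.act p (dir q))) (rot j τ) = _ :=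
      mfderiv_prodMk mdifferentiableAt_const h0
    set w : ℝ × EuclideanSpace ℝ (Fin 7) :=
      mfderiv 𝓘(ℝ, ℍ[ℝ]) I8 (fun q : ℍ[ℝ] => (r₀, S.act p (dir q))) (rot j τ) (rot j τ * T j) with hw
    have hw2 : w.2 = mfderiv 𝓘(ℝ, ℍ[ℝ]) I7 (fun q : ℍ[ℝ] => S.act p (dir q)) (rot j τ)
        (rot j τ * T j) :=
      congrArg (fun f : ℍ[ℝ] →L[ℝ] ℝ × EuclideanSpace ℝ (Fin 7) => (f (rot j τ * T j)).2) h5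
    have h6 : S.radial x z w = x r₀ • T j := by
      have e1 : S.radial x z w = x r₀ • S.ηT (S.act p (dir (rot j τ))) w.2 := rfl
      have e2 := S.ηT_orbit p (hrot τ) (rot j τ * T j)
      rw [← mul_assoc, inv_mul_cancel₀ (hrot τ), one_mul] at e2
      have e3 : (T j).im = T j := by
        rw [← Quaternion.sub_re_self, T_re]
        simp
      rw [e1, hw2]
      exact congrArg (fun a => x r₀ • a) (e2.trans e3)
    have h7 := (mdifferentiableAt_iff_differentiableAt.1 h3).hasFDerivAt.comp_hasDerivAt τ
      (hasDerivAt_rot j τ)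
    refine h7.congr_deriv ?_
    rw [mfderiv_eq_fderiv] at h4
    have h8 : fderiv ℝ (fun q : ℍ[ℝ] => ξ (r₀, S.act p (dir q))) (rot j τ) (rot j τ * T j)
        = mfderiv I8 𝓘(ℝ, ℍ[ℝ]) ξ z w :=
      congrArg (fun f : ℍ[ℝ] →L[ℝ] ℍ[ℝ] => f (rot j τ * T j)) h4
    rw [h8]
    refine (hξ' w).trans ?_
    rw [h6, mul_smul_comm, smul_mul_assoc, smul_sub]
  have hsin : Real.sin (x r₀ * (2 * Real.pi)) ≠ 0 := by
    refine (Real.sin_pos_of_pos_of_lt_pi (by positivity) ?_).ne'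
    nlinarith [Real.pi_pos]
  have hper : rot j (2 * Real.pi) = rot j 0 := by
    simp [rot]
  have h := commute_T_of_periodic hd (by simp only [hper]) hsin
  have h1 : dir (rot j 0) = 1 := by rw [dir_rot, rot_zero]
  simpa only [h1, S.act_one] using h

end ThreeSasakian

/-! ### The classification of radial instantons -/

namespace ThreeSasakian

variable {X : Type*} [TopologicalSpace X] [ChartedSpace (EuclideanSpace ℝ (Fin 7)) X]
  [IsManifold I7 ∞ X] (S : ThreeSasakian X) {ν₀ : ℝ} {t ν : ℝ → ℝ}

theorem isRadialInstanton_family [Nonempty X] (hp : IsProfile ν₀ t ν) {J : Set ℝ} (hJo : IsOpen J)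
    (hJ : J ⊆ Ioi 0) {y₀ : ℝ} (h : ∀ r ∈ J, 3 + y₀ * (ν r ^ 2 - ν₀ ^ 2) ≠ 0) :
    S.IsRadialInstanton t ν J (family ν₀ t ν y₀) :=
  (S.isRadialInstanton_iff hJo (fun r hr => hp.t_pos r (hJ hr))
    (fun r hr => hp.ν_pos r (hJ hr))).2
    ⟨fun _ hr => (hp.analyticAt_family hJ h hr).contDiffAt.contDiffWithinAt,
      hp.radialODE_family hJ h⟩

theorem isRadialInstanton_limitSol [Nonempty X] (hp : IsProfile ν₀ t ν) :
    S.IsRadialInstanton t ν (Ioi 0) (limitSol ν₀ t ν) :=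
  (S.isRadialInstanton_iff isOpen_Ioi hp.t_pos hp.ν_pos).2
    ⟨fun _ hr => (hp.analyticAt_limitSol hr).contDiffAt.contDiffWithinAt, hp.radialODE_limitSol⟩

theorem extendsFlat_of_eqOn_family (hp : IsProfile ν₀ t ν) {J : Set ℝ} (hJo : IsOpen J)
    (hJ : J ⊆ Ioi 0) {y₀ : ℝ} {x : ℝ → ℝ} (hx : ContDiffOn ℝ ∞ x J)
    (h : x =ᶠ[𝓝[>] 0] family ν₀ t ν y₀) : S.ExtendsFlat (S.radial x) J := by
  obtain ⟨Y, hY, -, hYe⟩ := hp.exists_family_eq y₀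
  exact S.extendsFlat_radial hJo hJ hx hY (h.trans hYe)

theorem extendsLeviCivita_of_eqOn_limitSol (hp : IsProfile ν₀ t ν) {x : ℝ → ℝ}
    (hx : ContDiffOn ℝ ∞ x (Ioi 0)) (h : EqOn x (limitSol ν₀ t ν) (Ioi 0)) :
    S.ExtendsLeviCivita (S.radial x) (Ioi 0) := by
  obtain ⟨Y, hY, hYe⟩ := hp.exists_limitSol_eq
  exact S.extendsLeviCivita_radial isOpen_Ioi Subset.rfl hx hY
    ((eventuallyEq_nhdsWithin_of_eqOn h).trans hYe)

theorem not_extendsFlat_of_eqOn_limitSol [Nonempty X] (hp : IsProfile ν₀ t ν) {x : ℝ → ℝ}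
    (h : EqOn x (limitSol ν₀ t ν) (Ioi 0)) : ¬ S.ExtendsFlat (S.radial x) (Ioi 0) := fun hf =>
  zero_ne_one (tendsto_nhds_unique (S.tendsto_zero_of_extendsFlat hf)
    (hp.tendsto_limitSol_one.congr' (eventuallyEq_nhdsWithin_of_eqOn h).symm))

theorem not_extendsLeviCivita_of_eqOn_family [Nonempty X] (hp : IsProfile ν₀ t ν) {y₀ : ℝ}
    {x : ℝ → ℝ} (h : EqOn x (family ν₀ t ν y₀) (Ioi 0)) :
    ¬ S.ExtendsLeviCivita (S.radial x) (Ioi 0) := fun hf =>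
  one_ne_zero (tendsto_nhds_unique (S.tendsto_one_of_extendsLeviCivita hf)
    ((hp.tendsto_family_zero y₀).congr' (eventuallyEq_nhdsWithin_of_eqOn h).symm))

theorem isFlatOn_radial_of_eqOn_zero {x : ℝ → ℝ} (hx : ∀ r ∈ Ioi (0 : ℝ), x r = 0) :
    IsFlatOn I8 (S.radial x) {z | 0 < z.1} := fun _ hz u v =>
  S.curvature_radial_zero (Filter.eventually_of_mem (Ioi_mem_nhds hz) hx) u v

theorem isIrreducibleOn_family (hp : IsProfile ν₀ t ν) {y₀ : ℝ} (hy : 0 < y₀) :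
    IsIrreducibleOn I8 (S.radial (family ν₀ t ν y₀)) {z | 0 < z.1} := by
  have h1 : ∀ᶠ r in 𝓝[>] 0, family ν₀ t ν y₀ r < 1 / 2 :=
    (hp.tendsto_family_zero y₀).eventually_lt_const (by norm_num)
  obtain ⟨r, hr, hr0⟩ := (h1.and self_mem_nhdsWithin).exists
  refine S.isIrreducibleOn_radial hr0 ?_ hr
  have h2 := hp.t_pos r hr0
  have h3 := hp.family_denom_pos hy.le hr0
  rw [family]
  positivity

end ThreeSasakian

end Spin7

end

theorem theorem7 {X : Type*} [TopologicalSpace X]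
    [ChartedSpace (EuclideanSpace ℝ (Fin 7)) X] [IsManifold Spin7.I7 ∞ X] [Nonempty X]
    (S : Spin7.ThreeSasakian X) (ν₀ : ℝ) (t ν : ℝ → ℝ) (hprofile : Spin7.IsProfile ν₀ t ν) :
    -- every instanton of radial form
    (∀ x : ℝ → ℝ, S.IsRadialInstanton t ν (Ioi 0) x →
      (¬ Spin7.IsFlatOn Spin7.I8 (S.radial x) {z | 0 < z.1} →
        S.IsAsymptoticTo (S.radial x) S.aInf) ∧
      (S.ExtendsLeviCivita (S.radial x) (Ioi 0) ∧ ¬ S.ExtendsFlat (S.radial x) (Ioi 0) ∨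
        S.ExtendsFlat (S.radial x) (Ioi 0) ∧ ¬ S.ExtendsLeviCivita (S.radial x) (Ioi 0))) ∧
    -- the Levi-Civita case: existence and uniqueness
    (∃ xlim : ℝ → ℝ, S.IsRadialInstanton t ν (Ioi 0) xlim ∧
      S.ExtendsLeviCivita (S.radial xlim) (Ioi 0) ∧
      ∀ x : ℝ → ℝ, S.IsRadialInstanton t ν (Ioi 0) x →
        S.ExtendsLeviCivita (S.radial x) (Ioi 0) → EqOn x xlim (Ioi 0)) ∧
    -- the flat case: the family with parameter in `[0, ∞)`
    (∃ xfam : ℝ → ℝ → ℝ,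
      (∀ y₀ : ℝ, 0 ≤ y₀ → S.IsRadialInstanton t ν (Ioi 0) (xfam y₀) ∧
        S.ExtendsFlat (S.radial (xfam y₀)) (Ioi 0) ∧
        Spin7.HasParameter (Ioi 0) (xfam y₀) y₀) ∧
      (∀ x : ℝ → ℝ, S.IsRadialInstanton t ν (Ioi 0) x →
        S.ExtendsFlat (S.radial x) (Ioi 0) → ∃! y₀, 0 ≤ y₀ ∧ EqOn x (xfam y₀) (Ioi 0)) ∧
      Spin7.IsFlatOn Spin7.I8 (S.radial (xfam 0)) {z | 0 < z.1} ∧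
      ∀ y₀ : ℝ, 0 < y₀ →
        Spin7.IsIrreducibleOn Spin7.I8 (S.radial (xfam y₀)) {z | 0 < z.1}) ∧
    -- negative parameters: solutions that exist only near the zero section
    (∀ y₀ : ℝ, y₀ < 0 → ∃ R : ℝ, 0 < R ∧ ∃ x : ℝ → ℝ,
      S.IsRadialInstanton t ν (Ioo 0 R) x ∧
      S.ExtendsFlat (S.radial x) (Ioo 0 R) ∧ Spin7.HasParameter (Ioo 0 R) x y₀ ∧
      ∀ (R' : ℝ) (x' : ℝ → ℝ), 0 < R' → S.IsRadialInstanton t ν (Ioo 0 R') x' →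
        Spin7.HasParameter (Ioo 0 R') x' y₀ → R' ≤ R ∧ EqOn x' x (Ioo 0 R')) := by
  have hode : ∀ x, S.IsRadialInstanton t ν (Ioi 0) x → Spin7.RadialODE t ν (Ioi 0) x :=
    fun x hx => ((S.isRadialInstanton_iff isOpen_Ioi hprofile.t_pos hprofile.ν_pos).1 hx).2
  have hden : ∀ y₀ : ℝ, 0 ≤ y₀ → ∀ r ∈ Ioi (0 : ℝ), 3 + y₀ * (ν r ^ 2 - ν₀ ^ 2) ≠ 0 :=
    fun y₀ hy r hr => (hprofile.family_denom_pos hy hr).ne'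
  refine ⟨fun x hx => ⟨fun hflat => ?_, ?_⟩, ⟨Spin7.limitSol ν₀ t ν,
    S.isRadialInstanton_limitSol hprofile, ?_, fun x hx hext => ?_⟩, ⟨Spin7.family ν₀ t ν,
    fun y₀ hy => ⟨S.isRadialInstanton_family hprofile isOpen_Ioi Subset.rfl (hden y₀ hy), ?_,
      hprofile.hasParameter_family Subset.rfl (hden y₀ hy)⟩, fun x hx hext => ?_, ?_,
    fun y₀ hy => S.isIrreducibleOn_family hprofile hy⟩, fun y₀ hy => ?_⟩
  · rcases hprofile.tendsto_atTop_of_radialODE (hode x hx) with h | h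
    · exact absurd (S.isFlatOn_radial_of_eqOn_zero h) hflat
    · exact S.isAsymptoticTo_aInf h
  · rcases hprofile.radialODE_Ioi_cases (hode x hx) with h | ⟨y₀, -, h⟩
    · exact Or.inl ⟨S.extendsLeviCivita_of_eqOn_limitSol hprofile hx.1 h,
        S.not_extendsFlat_of_eqOn_limitSol hprofile h⟩
    · exact Or.inr ⟨S.extendsFlat_of_eqOn_family hprofile isOpen_Ioi Subset.rfl hx.1
        (eventuallyEq_nhdsWithin_of_eqOn h), S.not_extendsLeviCivita_of_eqOn_family hprofile h⟩
  · exact S.extendsLeviCivita_of_eqOn_limitSol hprofile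
      (S.isRadialInstanton_limitSol hprofile).1 (eqOn_refl _ _)
  · exact (hprofile.radialODE_Ioi_cases (hode x hx)).resolve_right fun ⟨y₀, _, h⟩ =>
      S.not_extendsLeviCivita_of_eqOn_family hprofile h hext
  · exact S.extendsFlat_of_eqOn_family hprofile isOpen_Ioi Subset.rfl
      (S.isRadialInstanton_family hprofile isOpen_Ioi Subset.rfl (hden y₀ hy)).1
      EventuallyEq.rfl
  · obtain ⟨y₀, hy, h⟩ := (hprofile.radialODE_Ioi_cases (hode x hx)).resolve_left fun h =>
      S.not_extendsFlat_of_eqOn_limitSol hprofile h hext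
    exact ⟨y₀, ⟨hy, h⟩, fun y₁ ⟨hy₁, h₁⟩ =>
      hprofile.family_injective hy₁ hy (h₁.symm.trans h)⟩
  · exact S.isFlatOn_radial_of_eqOn_zero fun r _ => by simp [Spin7.family]
  · -- the solution blows up where the denominator `3 + y₀ (ν² - ν₀²)` vanishes
    obtain ⟨R, hR, hRν⟩ := hprofile.exists_sq_eq (w := ν₀ ^ 2 + 3 / -y₀)
      (lt_add_of_pos_right _ (div_pos three_pos (neg_pos.2 hy)))
    have hsub : Ioo 0 R ⊆ Ioi 0 := fun r hr => hr.1
    have hzero : 3 + y₀ * (ν R ^ 2 - ν₀ ^ 2) = 0 := by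
      rw [hRν]
      have := hy.ne
      field_simp
      ring
    have hd : ∀ r ∈ Ioo 0 R, 3 + y₀ * (ν r ^ 2 - ν₀ ^ 2) ≠ 0 := by
      intro r hr
      have h1 : ν r ^ 2 < ν R ^ 2 := hprofile.strictMonoOn_sq hr.1 hR hr.2
      nlinarith
    have hI := S.isRadialInstanton_family hprofile isOpen_Ioo hsub hd
    refine ⟨R, hR, Spin7.family ν₀ t ν y₀, hI, S.extendsFlat_of_eqOn_family hprofile isOpen_Ioo hsub
      hI.1 EventuallyEq.rfl, hprofile.hasParameter_family hsub hd, fun R' x' hR' hx' hpar => ?_⟩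
    have hx'' := ((S.isRadialInstanton_iff isOpen_Ioo (fun r hr => hprofile.t_pos r hr.1)
      (fun r hr => hprofile.ν_pos r hr.1)).1 hx').2
    obtain ⟨h1, h2⟩ := hprofile.eqOn_family_of_hasParameter hR' hy.ne hx'' hpar
    exact ⟨not_lt.1 fun hlt => h1 R ⟨hR, hlt⟩ hzero, h2⟩
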